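/- Notation. Let $\mathbb T$ be the unit circle with normalized Lebesgue measure $m$, $(f,h)=\int f\bar h\,dm$, and let $H^2\subset L^2(\mathbb T)$ be the Hardy space. Let $(\tilde S_tf)(x)=f(x-t)$ on $L^2(\mathbb R)$, and let $S_t=\tilde S_t|_{L^2(\mathbb R_+)}$, $t\ge 0$. A cocycle is a strongly continuous family $(W_t)_{t\ge0}$ of unitary operators on $L^2(\mathbb R_+)$, extended by the identity to $L^2(\mathbb R)=L^2(\mathbb R_+)\oplus L^2(\mathbb R_-)$, with $W_{t+s}=W_t\tilde S_tW_s\tilde S_{-t}$ for $t,s\ge0$ and $W_0=I$. Its cocyclic perturbation is $V_t=W_tS_t$ on $L^2(\mathbb R_+)$; put $\tilde V_t=W_t\tilde S_t$ on $L^2(\mathbb R)$, $t\ge 0$. The cogenerator of $(V_t)_{t\ge0}$ is $(A-iI)(A+iI)^{-1}$ with $A=\lim_{t\to0+}(V_t-I)/(it)$, and similarly for $(\tilde V_t)_{t\ge 0}$. The Wold–Kolmogorov decomposition of an isometry $V$ on $E$ is the reducing decomposition $E=E_0\oplus E_0^\perp$ with $V$ unitary on $E_0$ (the unitary part) and completely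 nonunitary on $E_0^\perp$. Let $\mu$ be a finite Borel measure on $\mathbb T$ that is singular with respect to Lebesgue measure. Define $\theta$ and $g$ in the unit disc $\mathbb D$ by $$\frac{1+\theta(z)}{1-\theta(z)}=\int_{\mathbb T}\frac{\xi+z}{\xi-z}\,d\mu(\xi),\qquad g(z)=\frac{\theta(z)-\theta(0)}{z(1-\theta(0))},$$ and, identifying functions in the Hardy space of the disc with their boundary functions, $$(Vf)(z)=zf(z)+(f,g)(1-\theta(z)),\quad f\in H^2,\qquad(\mathrm{mod1})$$ $$(\tilde Vf)(z)=zf(z)+(f,g)(1-\theta(z))-(f,\bar z)(1-\overline{\theta(1)}\,\theta(z)),\quad f\in L^2(\mathbb T),\qquad(\mathrm{mod2})$$ where in (mod2), and in every claim about $\tilde V$ below, it is assumed that the radial limit $\theta(1)=\lim_{r\to1-}\theta(r)$ exists and $|\theta(1)|=1$. Proposition 7. (1) $\theta$ is a well-defined inner function (with $\theta\neq1$ in $\mathbb D$). (2) $V$ is an isometry of $H^2$ with Wold–Kolmogorov decomposition $H^2=K_\theta\oplus\theta H^2$, where $K_\theta=H^2\ominus\theta H^2$; its unitary part $V|_{K_\theta}$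 is unitarily equivalent to multiplication by $z$ on $L^2(\mu)$, and $Vf=zf$ for $f\in\theta H^2$. (3) $\tilde V$ is the (minimal) unitary dilation of $V$; moreover $\tilde Vf=Vf$ for $f\in H^2$, and $\tilde V^*f=\bar zf$ for $f\in L^2(\mathbb T)\ominus H^2$. (4) If $\mu(\{1\})=0$, there are a unitary $J:L^2(\mathbb R)\to L^2(\mathbb T)$ with $JL^2(\mathbb R_+)=H^2$ that carries the cogenerator of $(\tilde S_t)_{t\ge0}$ to multiplication by $z$, and a cocycle $(W_t)$, such that $J$ carries the cogenerator of $(V_t)$ to $V$ and the cogenerator of $(\tilde V_t)$ to $\tilde V$. (5) Conversely, if $(W_t)$ is a cocycle such that the unitary part, in the Wold–Kolmogorov decomposition, of the cogenerator $C$ of $(V_t)$ is unitarily equivalent to multiplication by $z$ on $L^2(\mu)$, then $\mu(\{1\})=0$, and $C$ is carried to $V$ by a unitary $J_+:L^2(\mathbb R_+)\to H^2$; moreover $J_+$ extends to a unitary $J:L^2(\mathbb R)\to L^2(\mathbb T)$ that carries the cogenerator of $(\tilde V_t)$ to $\tilde V$. (6) If $\int_{\mathbb T}|1-\xi|^{-q}\,d\mu(\xi)<\infty$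 for some $q>3$, then $\theta(1)$ exists and $|\theta(1)|=1$. If $\mu(\{1\})=0$, then for each $q>3$ there is a finite measure $\nu$, mutually absolutely continuous with $\mu$, with $\int_{\mathbb T}|1-\xi|^{-q}\,d\nu(\xi)<\infty$, and multiplication by $z$ on $L^2(\nu)$ is unitarily equivalent to multiplication by $z$ on $L^2(\mu)$. -/

import Mathlib

open MeasureTheory Filter Topology Set

noncomputable section

namespace CocyclicModel

/-! Semigroups, cogenerators, the Wold decomposition and unitary dilations. -/

/-- `C` is the cogenerator `(A - iI)(A + iI)⁻¹` of the one-parameter family `(T t, t ≥ 0)`, where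
`A f = lim_{t → 0+} (T t f - f) / (i t)` on the domain where the limit exists: every `u` is of the
form `A f + i f`, and then `C u = A f - i f`. -/
def IsCogenerator {E : Type*} [NormedAddCommGroup E] [NormedSpace ℂ E]
    (T : ℝ → E →L[ℂ] E) (C : E →L[ℂ] E) : Prop :=
  ∀ u : E, ∃ f Af : E,
    Tendsto (fun t : ℝ => (Complex.I * (t : ℂ))⁻¹ • (T t f - f)) (𝓝[>] 0) (𝓝 Af) ∧
    u = Af + Complex.I • f ∧ C u = Af - Complex.I • f

/-- `E = E₀ ⊕ E₀ᗮ` is the Wold–Kolmogorov decomposition of the isometric operator `V`: both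
summands are invariant, `V` is unitary on `E₀`, and `E₀ᗮ` contains no nontrivial (closed)
invariant subspace on which `V` is unitary. -/
structure IsWoldDecomposition {E : Type*} [NormedAddCommGroup E] [InnerProductSpace ℂ E]
    (V : E →L[ℂ] E) (E₀ : Submodule ℂ E) : Prop where
  isometry : ∀ f, ‖V f‖ = ‖f‖
  isClosed : IsClosed (E₀ : Set E)
  unitary_part : E₀.map (V : E →ₗ[ℂ] E) = E₀
  invariant_compl : E₀ᗮ.map (V : E →ₗ[ℂ] E) ≤ E₀ᗮ
  completely_nonunitary : ∀ M : Submodule ℂ E, M ≤ E₀ᗮ → IsClosed (M : Set E) →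
    M.map (V : E →ₗ[ℂ] E) = M → M = ⊥

/-- `U` is the (minimal) unitary dilation of the operator `V` on the subspace `K`: `U` is
unitary, `Vⁿ` is the compression of `Uⁿ` to `K` for all `n ≥ 0`, and the subspaces `Uⁿ K`,
`n ∈ ℤ`, span a dense subspace. -/
structure IsUnitaryDilation {E : Type*} [NormedAddCommGroup E] [InnerProductSpace ℂ E]
    [CompleteSpace E] (K : Submodule ℂ E) [K.HasOrthogonalProjection]
    (V : K →L[ℂ] K) (U : E →L[ℂ] E) : Prop where
  unitary : U ∈ unitary (E →L[ℂ] E)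
  compression : ∀ (n : ℕ) (f : K), K.orthogonalProjectionOnto ((U ^ n) (f : E)) = (V ^ n) f
  minimal : ((⨆ n : ℕ, K.map ((U ^ n : E →L[ℂ] E) : E →ₗ[ℂ] E)) ⊔
    (⨆ n : ℕ, K.map ((ContinuousLinearMap.adjoint U ^ n : E →L[ℂ] E) : E →ₗ[ℂ] E))
    ).topologicalClosure = ⊤

/-! Shifts on the line and on the semiaxis, cocycles, cocyclic perturbations. -/

/-- The space `L²(ℝ)`. -/
abbrev L2R : Type := Lp ℂ 2 (volume : Measure ℝ)

/-- The group of shifts `(S̃_t g)(x) = g(x - t)` in `L²(ℝ)`. -/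
def shiftR (t : ℝ) : L2R →L[ℂ] L2R :=
  (Lp.compMeasurePreservingₗᵢ ℂ (fun x : ℝ => x - t)
    (measurePreserving_sub_right volume t)).toContinuousLinearMap

/-- `L²(ℝ₊)`, realized as the subspace of the functions in `L²(ℝ)` that vanish on the negative
semiaxis. -/
def L2plus : Submodule ℂ L2R :=
  (LpToLpRestrictCLM ℝ ℂ ℂ (volume : Measure ℝ) 2 (Iio 0)).toLinearMap.ker

theorem mem_L2plus {f : L2R} : f ∈ L2plus ↔ ∀ᵐ x : ℝ, x < 0 → f x = 0 := by
  have h := LpToLpRestrictCLM_coeFn (F := ℂ) (μ := (volume : Measure ℝ)) (p := 2) ℂ (Iio 0) f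
  have h0 : f ∈ L2plus ↔ LpToLpRestrictCLM ℝ ℂ ℂ (volume : Measure ℝ) 2 (Iio 0) f = 0 := Iff.rfl
  rw [h0, Lp.eq_zero_iff_ae_eq_zero]
  have h1 : (∀ᵐ x : ℝ, x < 0 → f x = 0) ↔ ∀ᵐ x ∂(volume.restrict (Iio (0 : ℝ))), f x = 0 :=
    (ae_restrict_iff' measurableSet_Iio).symm
  rw [h1]
  constructor
  · intro h2
    filter_upwards [h, h2] with x hx hx2
    rw [← hx, hx2]; rfl
  · intro h2
    filter_upwards [h, h2] with x hx hx2
    rw [hx, hx2]; rfl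

theorem isClosed_L2plus : IsClosed (L2plus : Set L2R) :=
  ContinuousLinearMap.isClosed_ker
    (LpToLpRestrictCLM ℝ ℂ ℂ (volume : Measure ℝ) 2 (Iio 0))

instance : CompleteSpace L2plus := isClosed_L2plus.completeSpace_coe

/-- The semigroup of shifts `(S_t, t ≥ 0)` in `L²(ℝ₊)`. For `t ≥ 0` the shift `S̃_t` maps
`L²(ℝ₊)` into itself, so that the projection acts trivially (`coe_shiftPlus`). -/
def shiftPlus (t : ℝ) : L2plus →L[ℂ] L2plus :=
  L2plus.orthogonalProjectionOnto ∘L shiftR t ∘L L2plus.subtypeL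

theorem shiftR_mem_L2plus {t : ℝ} (ht : 0 ≤ t) (f : L2plus) : shiftR t f ∈ L2plus := by
  have hmp := measurePreserving_sub_right (volume : Measure ℝ) t
  have hf := mem_L2plus.1 f.2
  rw [mem_L2plus]
  have h1 : ⇑(shiftR t (f : L2R)) =ᵐ[volume] (f : L2R) ∘ (fun x : ℝ => x - t) :=
    Lp.coeFn_compMeasurePreserving (f : L2R) hmp
  filter_upwards [h1, hmp.quasiMeasurePreserving.ae hf] with x hx hx2 hx0
  rw [hx]
  exact hx2 (by linarith)

theorem coe_shiftPlus {t : ℝ} (ht : 0 ≤ t) (f : L2plus) :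
    (shiftPlus t f : L2R) = shiftR t f := by
  have h := Submodule.orthogonalProjectionOnto_mem_subspace_eq_self
    (⟨shiftR t f, shiftR_mem_L2plus ht f⟩ : L2plus)
  exact congrArg Subtype.val h

/-- The extension of a unitary operator on `L²(ℝ₊)` to `L²(ℝ)` that is the identity on the
functions supported on the negative semiaxis. -/
def extendById (W : L2plus ≃ₗᵢ[ℂ] L2plus) : L2R →L[ℂ] L2R :=
  L2plus.subtypeL ∘L (W.toContinuousLinearEquiv : L2plus →L[ℂ] L2plus) ∘L
      L2plus.orthogonalProjectionOnto
    + (ContinuousLinearMap.id ℂ L2R - L2plus.starProjection)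

/-- `(W_t, t ≥ 0)` is a cocycle of the semigroup of shifts: a strongly continuous family of
unitary operators in `L²(ℝ₊)` with `W_{t+s} = W_t S̃_t W_s S̃_{-t}` for `t, s ≥ 0` and `W_0 = I`.
The values at negative `t` play no role. -/
structure IsCocycle (W : ℝ → (L2plus ≃ₗᵢ[ℂ] L2plus)) : Prop where
  continuous : ∀ f : L2plus, ContinuousOn (fun t => W t f) (Ici 0)
  zero : W 0 = LinearIsometryEquiv.refl ℂ L2plus
  add : ∀ t s : ℝ, 0 ≤ t → 0 ≤ s → extendById (W (t + s)) =
    extendById (W t) ∘L shiftR t ∘L extendById (W s) ∘L shiftR (-t)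

/-- The cocyclic perturbation `V_t = W_t S_t`, `t ≥ 0`, in `L²(ℝ₊)`. -/
def perturbation (W : ℝ → (L2plus ≃ₗᵢ[ℂ] L2plus)) (t : ℝ) : L2plus →L[ℂ] L2plus :=
  ((W t).toContinuousLinearEquiv : L2plus →L[ℂ] L2plus) ∘L shiftPlus t

/-- The unitary operators `Ṽ_t = W_t S̃_t`, `t ≥ 0`, in `L²(ℝ)`. -/
def perturbationR (W : ℝ → (L2plus ≃ₗᵢ[ℂ] L2plus)) (t : ℝ) : L2R →L[ℂ] L2R :=
  extendById (W t) ∘L shiftR t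

/-! The circle and the Hardy space. The unit circle is parametrized by `ℝ / ℤ` through
`x ↦ exp (2 π i x)`; the point `1` corresponds to `x = 0`. -/

/-- The point `exp (2 π i x)` of the unit circle. -/
def pt (x : UnitAddCircle) : ℂ := (AddCircle.toCircle x : ℂ)

theorem norm_pt (x : UnitAddCircle) : ‖pt x‖ = 1 := Circle.norm_coe _

theorem continuous_pt : Continuous pt :=
  continuous_subtype_val.comp AddCircle.continuous_toCircle

/-- Normalized Lebesgue measure on the unit circle. -/
abbrev leb : Measure UnitAddCircle := AddCircle.haarAddCircle

/-- The space `L²(ν)` of a measure on the unit circle. -/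
abbrev L2 (ν : Measure UnitAddCircle) : Type := Lp ℂ 2 ν

theorem memLp_pt_mul (ν : Measure UnitAddCircle) (f : L2 ν) :
    MemLp (fun x => pt x * f x) 2 ν := by
  refine (Lp.memLp f).of_le
    (continuous_pt.aestronglyMeasurable.mul (Lp.aestronglyMeasurable f)) ?_
  filter_upwards with x
  rw [norm_mul, norm_pt, one_mul]

/-- The operator of multiplication by `z` in `L²(ν)`. -/
def mulZ (ν : Measure UnitAddCircle) : L2 ν →L[ℂ] L2 ν :=
  LinearMap.mkContinuous
    { toFun := fun f => (memLp_pt_mul ν f).toLp _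
      map_add' := by
        intro f g
        apply Lp.ext
        filter_upwards [(memLp_pt_mul ν (f + g)).coeFn_toLp, (memLp_pt_mul ν f).coeFn_toLp,
          (memLp_pt_mul ν g).coeFn_toLp, Lp.coeFn_add f g,
          Lp.coeFn_add ((memLp_pt_mul ν f).toLp _) ((memLp_pt_mul ν g).toLp _)]
          with x h1 h2 h3 h4 h5
        rw [h1, h5, Pi.add_apply, h2, h3, h4, Pi.add_apply, mul_add]
      map_smul' := by
        intro c f
        apply Lp.ext
        filter_upwards [(memLp_pt_mul ν (c • f)).coeFn_toLp, (memLp_pt_mul ν f).coeFn_toLp,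
          Lp.coeFn_smul c f, Lp.coeFn_smul c ((memLp_pt_mul ν f).toLp _)]
          with x h1 h2 h3 h4
        rw [h1, RingHom.id_apply, h4, Pi.smul_apply, h2, h3, Pi.smul_apply, smul_eq_mul,
          smul_eq_mul, mul_left_comm] }
    1 (by
      intro f
      rw [one_mul]
      refine Lp.norm_le_norm_of_ae_le ?_
      filter_upwards [(memLp_pt_mul ν f).coeFn_toLp] with x h1
      change ‖((memLp_pt_mul ν f).toLp _ : L2 ν) x‖ ≤ _
      rw [h1, norm_mul, norm_pt, one_mul])

theorem coeFn_mulZ (ν : Measure UnitAddCircle) (f : L2 ν) :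
    ⇑(mulZ ν f) =ᵐ[ν] fun x => pt x * f x :=
  (memLp_pt_mul ν f).coeFn_toLp

/-- The monomial `z ^ n`, `n ∈ ℤ`, as an element of `L²(𝕋)`. -/
def zmon (n : ℤ) : L2 leb := fourierLp 2 n

/-- The Hardy space `H²` as a subspace of `L²(𝕋)`: the functions whose Fourier coefficients with
negative indices vanish. -/
def H2 : Submodule ℂ (L2 leb) := (Submodule.span ℂ (range fun n : ℕ => zmon (-(n + 1 : ℤ))))ᗮ

instance : CompleteSpace H2 :=
  inferInstanceAs (CompleteSpace
    ((Submodule.span ℂ (range fun n : ℕ => zmon (-(n + 1 : ℤ))))ᗮ : Submodule ℂ (L2 leb)))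

theorem isClosed_H2 : IsClosed (H2 : Set (L2 leb)) := Submodule.isClosed_orthogonal _

theorem mem_H2 {f : L2 leb} : f ∈ H2 ↔ ∀ n : ℤ, n < 0 → inner ℂ (zmon n) f = 0 := by
  unfold H2
  rw [Submodule.mem_orthogonal]
  constructor
  · intro h n hn
    have hn' : -(((-n - 1).toNat : ℤ) + 1) = n := by omega
    have h' := h (zmon (-(((-n - 1).toNat : ℤ) + 1)))
      (Submodule.subset_span (mem_range_self (-n - 1).toNat))
    rwa [hn'] at h'
  · intro h u hu
    induction hu using Submodule.span_induction with
    | mem x hx =>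
      obtain ⟨n, rfl⟩ := hx
      exact h _ (by omega)
    | zero => exact inner_zero_left _
    | add x y _ _ hx hy => rw [inner_add_left, hx, hy, add_zero]
    | smul c x _ hx => rw [inner_smul_left, hx, mul_zero]

theorem zmon_mem_H2 (n : ℕ) : zmon (n : ℤ) ∈ H2 := by
  rw [mem_H2]
  intro m hm
  exact (orthonormal_fourier (T := 1)).2 (by omega)

theorem mulZ_mem_H2 (f : H2) : mulZ leb f ∈ H2 := by
  rw [mem_H2]
  intro n hn
  have h := mem_H2.1 f.2 (n - 1) (by omega)
  rw [L2.inner_def] at h ⊢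
  rw [← h]
  refine integral_congr_ae ?_
  filter_upwards [coeFn_mulZ leb (f : L2 leb), coeFn_fourierLp (T := 1) 2 n,
    coeFn_fourierLp (T := 1) 2 (n - 1)] with x h1 h2 h3
  have h2' : zmon n x = fourier n x := h2
  have h3' : zmon (n - 1) x = fourier (n - 1) x := h3
  have h4 : fourier n x = fourier (n - 1) x * pt x := by
    have h5 := fourier_add (T := 1) (m := n - 1) (n := 1) (x := x)
    rw [sub_add_cancel, fourier_one] at h5
    exact h5
  have h6 : pt x * (starRingEnd ℂ) (pt x) = 1 := by
    rw [Complex.mul_conj, Complex.normSq_eq_norm_sq, norm_pt]; norm_num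
  rw [h1, h2', h3', h4, RCLike.inner_apply, RCLike.inner_apply, map_mul]
  linear_combination ((f : L2 leb) x) * (starRingEnd ℂ) (fourier (n - 1) x) * h6

/-- The boundary function in `L²(𝕋)` of a function `h`, analytic in the unit disc, with square
summable Taylor coefficients `cₙ` (that is, `h ∈ H²(𝔻)`): the sum `∑ cₙ zⁿ` in `L²(𝕋)`. -/
def bdry (h : ℂ → ℂ) : L2 leb :=
  ∑' n : ℕ, (iteratedDeriv n h 0 / (n.factorial : ℂ)) • zmon (n : ℤ)

theorem bdry_mem_H2 (h : ℂ → ℂ) : bdry h ∈ H2 := by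
  by_cases hs : Summable fun n : ℕ => (iteratedDeriv n h 0 / (n.factorial : ℂ)) • zmon (n : ℤ)
  · refine isClosed_H2.mem_of_tendsto hs.hasSum (Eventually.of_forall fun s => ?_)
    exact H2.sum_mem fun n _ => H2.smul_mem _ (zmon_mem_H2 n)
  · unfold bdry
    rw [tsum_eq_zero_of_not_summable hs]
    exact H2.zero_mem

/-- `h` is an inner function: analytic and bounded in the unit disc, with boundary values of
modulus one almost everywhere. -/
structure IsInner (h : ℂ → ℂ) : Prop where
  analytic : DifferentiableOn ℂ h (Metric.ball 0 1)
  bounded : ∃ M : ℝ, ∀ z ∈ Metric.ball (0 : ℂ) 1, ‖h z‖ ≤ M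
  unimodular : ∀ᵐ x ∂leb, ‖bdry h x‖ = 1

/-- The subspace `θ H²` of `H²`. -/
def innerH2 (θ : ℂ → ℂ) : Submodule ℂ H2 where
  carrier := {f | ∃ h : H2, ⇑(f : L2 leb) =ᵐ[leb] fun x => bdry θ x * (h : L2 leb) x}
  add_mem' := by
    rintro f g ⟨h, hh⟩ ⟨k, hk⟩
    refine ⟨h + k, ?_⟩
    filter_upwards [hh, hk, Lp.coeFn_add (f : L2 leb) (g : L2 leb),
      Lp.coeFn_add (h : L2 leb) (k : L2 leb)] with x h1 h2 h3 h4
    rw [Submodule.coe_add, Submodule.coe_add, h3, h4, Pi.add_apply, Pi.add_apply, h1, h2, mul_add]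
  zero_mem' := by
    refine ⟨0, ?_⟩
    filter_upwards [Lp.coeFn_zero ℂ 2 leb] with x h1
    rw [Submodule.coe_zero, h1, Pi.zero_apply, mul_zero]
  smul_mem' := by
    rintro c f ⟨h, hh⟩
    refine ⟨c • h, ?_⟩
    filter_upwards [hh, Lp.coeFn_smul c (f : L2 leb), Lp.coeFn_smul c (h : L2 leb)]
      with x h1 h2 h3
    rw [Submodule.coe_smul, Submodule.coe_smul, h2, h3, Pi.smul_apply, Pi.smul_apply, h1,
      smul_eq_mul, smul_eq_mul, mul_left_comm]

/-- The model space `K_θ = H² ⊖ θ H²`. -/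
def modelSpace (θ : ℂ → ℂ) : Submodule ℂ H2 := (innerH2 θ)ᗮ

/-! The Clark function of a measure and the model operators. -/

/-- The function `F(z) = ∫ (ξ + z) / (ξ - z) dμ(ξ)`. -/
def herglotz (μ : Measure UnitAddCircle) (z : ℂ) : ℂ := ∫ x, (pt x + z) / (pt x - z) ∂μ

/-- The function `θ` of the measure `μ`, i.e. the solution of
`(1 + θ(z)) / (1 - θ(z)) = ∫ (ξ + z) / (ξ - z) dμ(ξ)`. -/
def clarkFn (μ : Measure UnitAddCircle) (z : ℂ) : ℂ := (herglotz μ z - 1) / (herglotz μ z + 1)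

/-- The function `g(z) = (θ(z) - θ(0)) / (z (1 - θ(0)))`, continued analytically to `z = 0`. -/
def clarkG (μ : Measure UnitAddCircle) (z : ℂ) : ℂ :=
  dslope (clarkFn μ) 0 z / (1 - clarkFn μ 0)

/-- The operator `f ↦ z f + (f, g) (1 - θ)` on `L²(𝕋)`. -/
def modelAux (μ : Measure UnitAddCircle) : L2 leb →L[ℂ] L2 leb :=
  mulZ leb + (innerSL ℂ (bdry (clarkG μ))).smulRight (zmon 0 - bdry (clarkFn μ))

/-- The operator `V f = z f + (f, g) (1 - θ)` on `H²`. -/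
def modelV (μ : Measure UnitAddCircle) : H2 →L[ℂ] H2 :=
  (modelAux μ ∘L H2.subtypeL).codRestrict H2 fun f =>
    H2.add_mem (mulZ_mem_H2 f) (H2.smul_mem _
      (H2.sub_mem (zmon_mem_H2 0) (bdry_mem_H2 (clarkFn μ))))

/-- The operator `Ṽ f = z f + (f, g) (1 - θ) - (f, z̄) (1 - c̄ θ)` on `L²(𝕋)`, where `c = θ(1)`. -/
def modelVtilde (μ : Measure UnitAddCircle) (c : ℂ) : L2 leb →L[ℂ] L2 leb :=
  modelAux μ -
    (innerSL ℂ (zmon (-1))).smulRight (zmon 0 - (starRingEnd ℂ) c • bdry (clarkFn μ))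

/-- `c` is the unimodular boundary value `θ(1)`: the radial limit of `θ` at `1`, with `|c| = 1`. -/
def IsUnimodularValueAtOne (θ : ℂ → ℂ) (c : ℂ) : Prop :=
  ‖c‖ = 1 ∧ Tendsto (fun r : ℝ => θ (r : ℂ)) (𝓝[<] 1) (𝓝 c)

/-- The operator `V` on `E` is unitarily equivalent on the subspace `E₀` to multiplication by `z`
in `L²(ν)`. -/
def IsMulZOn {E : Type*} [NormedAddCommGroup E] [InnerProductSpace ℂ E]
    (V : E →L[ℂ] E) (E₀ : Submodule ℂ E) (ν : Measure UnitAddCircle) : Prop :=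
  ∃ Ω : L2 ν ≃ₗᵢ[ℂ] E₀, ∀ f : L2 ν, ((Ω (mulZ ν f) : E₀) : E) = V (Ω f : E)

end CocyclicModel

end

open CocyclicModel

/-!
The function `θ` is inner because `1 - |θ|²` is bounded both by `1` and by four times the Poisson
integral of `μ`, and the mean value of the minimum of the two tends to zero on the circles of radius
`r → 1` when `μ` is singular (`one_sub_le_norm_bdry_sq`). Boundary functions are handled through
Taylor coefficients and convergence in `L²`, so that no theorem on nontangential limits is needed.

That `V` is an isometry whose range is the complement of `θ` in `H²` is a computation with the
identity `(z f, θ) = (1 - θ(0)) (f, g)` (`norm_modelV`, `isDefectVector_modelV`). On `θ H²` it is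
multiplication by `z`. On `K_θ` it is unitary with cyclic vector `g`, and the numbers `(Vⁿ g, g)` are
the moments of `μ`, since the recursion that the formula for `V` gives for them is the comparison of
the Taylor coefficients in `F (1 - θ) = 1 + θ`, where `F` is the Herglotz integral
(`inner_clarkG_modelV_pow`). A unitary operator with a cyclic vector is determined by such moments;
this identifies the unitary part of `V` with multiplication by `z` in `L²(μ)`.

The operator `Ṽ` is the orthogonal sum of the unitary part of `V` and of multiplication by `z`
transferred by the isometry `x ↦ c̄ θ P₊ x + P₋ x`, `c = θ(1)` (`modelVtilde_dilationIntertwiner`). All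
that is used of `c` is `|c| = 1`.

The shifts on the line are carried to the multiplications by `exp (t (z + 1) / (z - 1))`, and `L²(ℝ₊)`
to `H²`, by the unitary operator that maps the translates of `√2 e⁻ˣ`, `x > 0`, to the orbit of the
function `1`: both families are complete and have the Gram matrix `exp (-|s - t|)`
(`exists_lineToCircle`). The cogenerator of these multiplications is multiplication by `z`, in `L²(ν)`
for every measure `ν` without mass at `1`. If `μ` has no mass at `1`, the description of `Ṽ` as an
orthogonal sum therefore exhibits it as the cogenerator of a unitary group; this group coincides with
the shifts on the functions that are not moved out of the negative semiaxis, and its quotient by the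
shifts is the cocycle (`exists_cocycle`).

Conversely, for any cocycle the inverse of the cogenerator of `(Ṽ_t)` acts on the functions on the
negative semiaxis as `z̄`, because `Ṽ_t⁻¹` is a shift there. It follows that the cogenerator `C` of
`(V_t)` has a one-dimensional defect space, spanned by the image of `z̄` (`exists_isDefectVector`).
Isometries with one-dimensional defect are determined by their unitary parts
(`exists_equiv_of_wold`), which yields the equivalence of `C` and `V` (`exists_equiv_modelV`). As a
cogenerator does not have the eigenvalue `1`, the measure `μ` has no mass at `1`.

Finally, the limit of `F(r)` as `r → 1` is found by dominated convergence, and the measure `ν` is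
`|1 - ξ|^q μ`.
-/

noncomputable section

set_option linter.unusedSectionVars false

namespace CocyclicModel

/-! ### Isometries determined by Gram matrices -/

theorem inner_map_of_norm_map {E : Type*} [NormedAddCommGroup E] [InnerProductSpace ℂ E]
    {V : E →L[ℂ] E} (h : ∀ f, ‖V f‖ = ‖f‖) (f g : E) :
    inner ℂ (V f) (V g) = inner ℂ f g :=
  (⟨(V : E →ₗ[ℂ] E), h⟩ : E →ₗᵢ[ℂ] E).inner_map_map f g

section Gram

variable {E F : Type*} [NormedAddCommGroup E] [InnerProductSpace ℂ E] [CompleteSpace E]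
  [NormedAddCommGroup F] [InnerProductSpace ℂ F] [CompleteSpace F]

theorem topologicalClosure_span_eq_top {ι : Type*} {x : ι → E}
    (h : ∀ f, (∀ i, inner ℂ (x i) f = 0) → f = 0) :
    (Submodule.span ℂ (range x)).topologicalClosure = ⊤ := by
  rw [Submodule.topologicalClosure_eq_top_iff, Submodule.eq_bot_iff]
  intro f hf
  exact h f fun i => (Submodule.mem_orthogonal _ _).1 hf _
    (Submodule.subset_span (mem_range_self i))

theorem denseRange_linearCombination {ι : Type*} {x : ι → E}
    (h : ∀ f, (∀ i, inner ℂ (x i) f = 0) → f = 0) :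
    DenseRange (Finsupp.linearCombination ℂ x) := by
  have h1 := topologicalClosure_span_eq_top h
  rw [← Finsupp.range_linearCombination] at h1
  exact Submodule.dense_iff_topologicalClosure_eq_top.2 h1

/-- Two complete families with the same Gram matrix are exchanged by a unitary operator. -/
theorem exists_equiv_of_gram {ι : Type*} {x : ι → E} {y : ι → F}
    (hxy : ∀ i j, inner ℂ (x i) (x j) = inner ℂ (y i) (y j))
    (hx : ∀ f, (∀ i, inner ℂ (x i) f = 0) → f = 0)
    (hy : ∀ f, (∀ i, inner ℂ (y i) f = 0) → f = 0) :
    ∃ J : E ≃ₗᵢ[ℂ] F, ∀ i, J (x i) = y i := by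
  have hn : ∀ c : ι →₀ ℂ, ‖Finsupp.linearCombination ℂ y (LinearEquiv.refl ℂ _ c)‖
      = ‖Finsupp.linearCombination ℂ x c‖ := by
    intro c
    have h2 : inner ℂ (Finsupp.linearCombination ℂ y c) (Finsupp.linearCombination ℂ y c)
        = inner ℂ (Finsupp.linearCombination ℂ x c) (Finsupp.linearCombination ℂ x c) := by
      simp only [Finsupp.linearCombination_apply, Finsupp.sum, sum_inner, inner_sum,
        inner_smul_left, inner_smul_right, hxy]
    rw [inner_self_eq_norm_sq_to_K, inner_self_eq_norm_sq_to_K] at h2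
    have h3 : ‖Finsupp.linearCombination ℂ y c‖ ^ 2 = ‖Finsupp.linearCombination ℂ x c‖ ^ 2 := by
      exact_mod_cast h2
    exact (sq_eq_sq₀ (norm_nonneg _) (norm_nonneg _)).1 h3
  refine ⟨(LinearEquiv.refl ℂ (ι →₀ ℂ)).extendOfIsometry (Finsupp.linearCombination ℂ x)
    (Finsupp.linearCombination ℂ y) (denseRange_linearCombination hx) (denseRange_linearCombination hy) hn, fun i => ?_⟩
  have h := LinearEquiv.extendOfIsometry_eq (LinearEquiv.refl ℂ (ι →₀ ℂ))
    (Finsupp.linearCombination ℂ x) (Finsupp.linearCombination ℂ y) (denseRange_linearCombination hx) (denseRange_linearCombination hy) hn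
    (Finsupp.single i 1)
  simpa using h

end Gram

/-- Operators that are equal on a complete family are equal. -/
theorem eq_of_eq_on_complete {E F : Type*} [NormedAddCommGroup E] [InnerProductSpace ℂ E]
    [CompleteSpace E] [NormedAddCommGroup F] [InnerProductSpace ℂ F] {ι : Type*} {x : ι → E}
    (hx : ∀ f, (∀ i, inner ℂ (x i) f = 0) → f = 0) {A B : E →L[ℂ] F}
    (h : ∀ i, A (x i) = B (x i)) : A = B := by
  have h1 := topologicalClosure_span_eq_top hx
  refine ContinuousLinearMap.ext_on (s := range x)
    (Submodule.dense_iff_topologicalClosure_eq_top.2 h1) ?_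
  rintro _ ⟨i, rfl⟩
  exact h i


/-! ### Contraction semigroups and their cogenerators -/

section Cogenerator

variable {E F G : Type*} [NormedAddCommGroup E] [InnerProductSpace ℂ E]
  [NormedAddCommGroup F] [InnerProductSpace ℂ F] [NormedAddCommGroup G] [InnerProductSpace ℂ G]

/-- A strongly continuous one-parameter semigroup of contractions; only the values at `t ≥ 0`
matter. -/
structure IsContractionSemigroup (T : ℝ → E →L[ℂ] E) : Prop where
  norm_le : ∀ t, 0 ≤ t → ∀ f, ‖T t f‖ ≤ ‖f‖
  zero : ∀ f, T 0 f = f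
  add : ∀ t s, 0 ≤ t → 0 ≤ s → ∀ f, T (t + s) f = T t (T s f)
  continuousOn : ∀ f, ContinuousOn (fun t => T t f) (Ici 0)

/-- The generator of a contraction semigroup is dissipative, whence `A + iI` is injective. -/
theorem eq_zero_of_tendsto_neg {T : ℝ → E →L[ℂ] E}
    (hT : ∀ t, 0 ≤ t → ∀ f, ‖T t f‖ ≤ ‖f‖) {f : E}
    (h : Tendsto (fun t : ℝ => (Complex.I * (t : ℂ))⁻¹ • (T t f - f)) (𝓝[>] 0)
      (𝓝 (-(Complex.I • f)))) : f = 0 := by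
  have h1 : Tendsto (fun t : ℝ => (inner ℂ f (Complex.I • ((Complex.I * (t : ℂ))⁻¹ •
      (T t f - f)))).re) (𝓝[>] 0) (𝓝 (inner ℂ f (Complex.I • (-(Complex.I • f)))).re) :=
    (Complex.continuous_re.tendsto _).comp
      ((tendsto_const_nhds (x := f)).inner (h.const_smul Complex.I))
  have h2 : (inner ℂ f (Complex.I • (-(Complex.I • f)))).re = ‖f‖ ^ 2 := by
    rw [smul_neg, smul_smul, Complex.I_mul_I, neg_smul, one_smul, neg_neg,
      inner_self_eq_norm_sq_to_K]
    norm_cast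
  rw [h2] at h1
  have h3 : ‖f‖ ^ 2 ≤ 0 := by
    refine le_of_tendsto h1 ?_
    filter_upwards [self_mem_nhdsWithin] with t ht
    have ht' : (0 : ℝ) < t := ht
    rw [smul_smul, mul_inv, ← mul_assoc, mul_inv_cancel₀ Complex.I_ne_zero, one_mul,
      inner_smul_right, inner_sub_right, inner_self_eq_norm_sq_to_K, ← Complex.ofReal_inv,
      Complex.re_ofReal_mul]
    refine mul_nonpos_of_nonneg_of_nonpos (inv_nonneg.2 ht'.le) ?_
    rw [Complex.sub_re]
    have h4 : (inner ℂ f (T t f)).re ≤ ‖f‖ * ‖T t f‖ := re_inner_le_norm (𝕜 := ℂ) f (T t f)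
    have h5 := mul_le_mul_of_nonneg_left (hT t ht'.le f) (norm_nonneg f)
    have h6 : (((‖f‖ : ℝ) : ℂ) ^ 2).re = ‖f‖ ^ 2 := by norm_cast
    have h7 : ((RCLike.ofReal ‖f‖ : ℂ) ^ 2).re = ‖f‖ ^ 2 := h6
    rw [h7]
    nlinarith
  have : ‖f‖ = 0 := by nlinarith [norm_nonneg f]
  exact norm_eq_zero.1 this

/-- A cogenerator maps `A f + i f` to `A f - i f` for every `f` in the domain of `A`: since `A + iI` is
injective, the vector `f` in the definition of `IsCogenerator` is unique. -/
theorem IsCogenerator.apply_eq {T : ℝ → E →L[ℂ] E} {C : E →L[ℂ] E} (hC : IsCogenerator T C)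
    (hT : ∀ t, 0 ≤ t → ∀ f, ‖T t f‖ ≤ ‖f‖) {f Af : E}
    (h : Tendsto (fun t : ℝ => (Complex.I * (t : ℂ))⁻¹ • (T t f - f)) (𝓝[>] 0) (𝓝 Af)) :
    C (Af + Complex.I • f) = Af - Complex.I • f := by
  obtain ⟨f', Af', h1, h2, h3⟩ := hC (Af + Complex.I • f)
  have h4 : f - f' = 0 := by
    refine eq_zero_of_tendsto_neg hT ?_
    have h5 := h.sub h1
    have h6 : Af - Af' = -(Complex.I • (f - f')) := by
      rw [smul_sub, neg_sub, sub_eq_sub_iff_add_eq_add, h2, add_comm]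
    rw [h6] at h5
    refine h5.congr fun t => ?_
    rw [← smul_sub, map_sub]
    congr 1
    abel
  have h5 : f = f' := sub_eq_zero.1 h4
  subst h5
  have h6 : Af = Af' := by simpa using h2
  rw [h3, h6]

theorem IsCogenerator.unique {T : ℝ → E →L[ℂ] E} {C C' : E →L[ℂ] E} (hC : IsCogenerator T C)
    (hC' : IsCogenerator T C') (hT : ∀ t, 0 ≤ t → ∀ f, ‖T t f‖ ≤ ‖f‖) : C = C' := by
  ext u
  obtain ⟨f, Af, h1, rfl, h3⟩ := hC' u
  rw [h3, hC.apply_eq hT h1]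

/-- `1` is not an eigenvalue of a cogenerator. -/
theorem IsCogenerator.eq_zero_of_apply_eq_self {T : ℝ → E →L[ℂ] E} {C : E →L[ℂ] E}
    (hC : IsCogenerator T C) {u : E} (hu : C u = u) : u = 0 := by
  obtain ⟨f, Af, h1, h2, h3⟩ := hC u
  have h4 : Complex.I • f = -(Complex.I • f) := by
    have : Af + Complex.I • f = Af - Complex.I • f := by rw [← h2, ← h3, hu]
    rw [sub_eq_add_neg] at this
    exact add_left_cancel this
  have h5 : f = 0 := by
    have h6 : (2 * Complex.I) • f = 0 := by
      rw [mul_smul, two_smul]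
      nth_rewrite 1 [h4]
      exact neg_add_cancel _
    simpa using h6
  subst h5
  have h6 : Af = 0 := by
    refine tendsto_nhds_unique h1 ?_
    simp
  rw [h2, h6]; simp

/-- Cogenerators of isometric semigroups are isometric. -/
theorem IsCogenerator.norm_map {T : ℝ → E →L[ℂ] E} {C : E →L[ℂ] E} (hC : IsCogenerator T C)
    (hT : ∀ t, 0 ≤ t → ∀ f, ‖T t f‖ = ‖f‖) (u : E) : ‖C u‖ = ‖u‖ := by
  obtain ⟨f, Af, h1, rfl, h3⟩ := hC u
  rw [h3]
  -- `A` is symmetric: `Re (T_t f - f, T_t f + f) = 0`, divided by `t`, tends to `2 Im (A f, f)` up to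
  -- the sign.
  have key : (inner ℂ Af (Complex.I • f)).re = 0 := by
    have h4 : Tendsto (fun t : ℝ => (T t f - f)) (𝓝[>] 0) (𝓝 0) := by
      have h5 : Tendsto (fun t : ℝ => (Complex.I * (t : ℂ))) (𝓝[>] 0) (𝓝 0) := by
        have : Continuous fun t : ℝ => Complex.I * (t : ℂ) := by fun_prop
        have h := this.tendsto 0
        simp only [Complex.ofReal_zero, mul_zero] at h
        exact h.mono_left nhdsWithin_le_nhds
      have h6 := h5.smul h1
      rw [zero_smul] at h6
      refine h6.congr' ?_
      filter_upwards [self_mem_nhdsWithin] with t ht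
      have ht' : (t : ℂ) ≠ 0 := by
        have : (0 : ℝ) < t := ht
        exact_mod_cast this.ne'
      rw [smul_smul, mul_inv_cancel₀ (mul_ne_zero Complex.I_ne_zero ht'), one_smul]
    have h5 := h1.inner (𝕜 := ℂ) (h4.add_const ((2 : ℂ) • f))
    have h6 := h5.const_mul Complex.I
    have h7 := (Complex.continuous_re.tendsto _).comp h6
    have h8 : ∀ᶠ t : ℝ in 𝓝[>] 0, (Complex.re ∘ fun t : ℝ => Complex.I *
        inner ℂ ((Complex.I * (t : ℂ))⁻¹ • (T t f - f)) (T t f - f + (2 : ℂ) • f)) t = 0 := by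
      filter_upwards [self_mem_nhdsWithin] with t ht
      have ht' : (0 : ℝ) ≤ t := le_of_lt ht
      have e1 : T t f - f + (2 : ℂ) • f = T t f + f := by rw [two_smul]; abel
      have e2 : (starRingEnd ℂ) (Complex.I * (t : ℂ))⁻¹ = -(Complex.I⁻¹ * ((t⁻¹ : ℝ) : ℂ)) := by
        simp [Complex.ofReal_inv]
        ring
      simp only [Function.comp, e1, inner_smul_left, e2]
      have e3 : Complex.I * (-(Complex.I⁻¹ * ((t⁻¹ : ℝ) : ℂ)) * inner ℂ (T t f - f) (T t f + f))
          = ((-t⁻¹ : ℝ) : ℂ) * inner ℂ (T t f - f) (T t f + f) := by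
        rw [Complex.ofReal_neg, neg_mul, mul_neg, ← mul_assoc, ← mul_assoc,
          mul_inv_cancel₀ Complex.I_ne_zero]
        ring
      rw [e3, Complex.re_ofReal_mul]
      have e4 : (inner ℂ (T t f - f) (T t f + f)).re = 0 := by
        rw [inner_sub_left, inner_add_right, inner_add_right, inner_self_eq_norm_sq_to_K,
          inner_self_eq_norm_sq_to_K, hT t ht']
        have e5 : (inner ℂ (T t f) f).re = (inner ℂ f (T t f)).re :=
          inner_re_symm (𝕜 := ℂ) (T t f) f
        simp only [Complex.sub_re, Complex.add_re, e5]
        ring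
      rw [e4, mul_zero]
    have h9 := tendsto_nhds_unique (h7.congr' h8) tendsto_const_nhds
    rw [zero_add, inner_smul_right] at h9
    rw [inner_smul_right]
    have : (Complex.I * (2 * inner ℂ Af f)).re = 2 * (Complex.I * inner ℂ Af f).re := by
      simp
    rw [this] at h9
    linarith
  have e1 := norm_add_sq (𝕜 := ℂ) Af (Complex.I • f)
  have e2 := norm_sub_sq (𝕜 := ℂ) Af (Complex.I • f)
  have key' : RCLike.re (inner ℂ Af (Complex.I • f)) = 0 := key
  rw [key'] at e1 e2
  have e3 : ‖Af - Complex.I • f‖ ^ 2 = ‖Af + Complex.I • f‖ ^ 2 := by rw [e1, e2]; ring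
  exact (sq_eq_sq₀ (norm_nonneg _) (norm_nonneg _)).1 e3

/-- The cogenerator of a direct sum of two families. -/
theorem IsCogenerator.directSum {T : ℝ → E →L[ℂ] E} {T₁ : ℝ → F →L[ℂ] F} {T₂ : ℝ → G →L[ℂ] G}
    {C : E →L[ℂ] E} {C₁ : F →L[ℂ] F} {C₂ : G →L[ℂ] G} (h₁ : IsCogenerator T₁ C₁)
    (h₂ : IsCogenerator T₂ C₂) (a : F →L[ℂ] E) (b : G →L[ℂ] E)
    (hab : ∀ u, ∃ v w, u = a v + b w)
    (ha : ∀ t, 0 < t → ∀ f, T t (a f) = a (T₁ t f))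
    (hb : ∀ t, 0 < t → ∀ f, T t (b f) = b (T₂ t f))
    (hCa : ∀ f, C (a f) = a (C₁ f)) (hCb : ∀ f, C (b f) = b (C₂ f)) : IsCogenerator T C := by
  intro u
  obtain ⟨v, w, rfl⟩ := hab u
  obtain ⟨f, Af, p1, p2, p3⟩ := h₁ v
  obtain ⟨g, Ag, q1, q2, q3⟩ := h₂ w
  refine ⟨a f + b g, a Af + b Ag, ?_, ?_, ?_⟩
  · refine (((a.continuous.tendsto _).comp p1).add ((b.continuous.tendsto _).comp q1)).congr' ?_
    filter_upwards [self_mem_nhdsWithin] with t ht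
    simp only [Function.comp, map_smul, map_add, map_sub, ha t ht, hb t ht, smul_sub, smul_add]
    abel
  · rw [p2, q2]
    simp only [map_add, map_smul, smul_add]
    abel
  · rw [map_add, hCa, hCb, p3, q3]
    simp only [map_sub, map_smul, smul_add]
    abel

/-- The cogenerator of a unitarily equivalent family. -/
theorem IsCogenerator.transport {T : ℝ → E →L[ℂ] E} {T₁ : ℝ → F →L[ℂ] F}
    {C : E →L[ℂ] E} {C₁ : F →L[ℂ] F} (h₁ : IsCogenerator T₁ C₁) (e : F ≃ₗᵢ[ℂ] E)
    (he : ∀ t, 0 < t → ∀ f, T t (e f) = e (T₁ t f)) (hC : ∀ f, C (e f) = e (C₁ f)) :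
    IsCogenerator T C :=
  h₁.directSum h₁ (e : F →L[ℂ] E) (e : F →L[ℂ] E)
    (fun u => ⟨e.symm u, 0, by simp⟩) he he hC hC

/-- The cogenerator of the restriction to an invariant subspace: in the definition of
`IsCogenerator` one has `f = (u - C u) / 2i` and `A f = (u + C u) / 2`, so that `f` and `A f` lie
in every `C`-invariant subspace that contains `u`. -/
theorem IsCogenerator.restrict {T : ℝ → E →L[ℂ] E} {C : E →L[ℂ] E} (hC : IsCogenerator T C)
    {M : Submodule ℂ E} {TM : ℝ → M →L[ℂ] M} {CM : M →L[ℂ] M}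
    (hTM : ∀ t, 0 < t → ∀ f : M, (TM t f : E) = T t f) (hCM : ∀ f : M, (CM f : E) = C f) :
    IsCogenerator TM CM := by
  intro u
  obtain ⟨f, Af, h1, h2, h3⟩ := hC u
  have e1 : f = (-(Complex.I / 2)) • ((u : E) - C u) := by
    rw [h2, ← h2, h3, h2]
    have : Af + Complex.I • f - (Af - Complex.I • f) = (2 * Complex.I) • f := by
      rw [mul_smul, two_smul]; abel
    rw [this, smul_smul]
    have : -(Complex.I / 2) * (2 * Complex.I) = 1 := by
      linear_combination (-1 : ℂ) * Complex.I_mul_I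
    rw [this, one_smul]
  have e2 : Af = (1 / 2 : ℂ) • ((u : E) + C u) := by
    rw [h3, h2]
    have : Af + Complex.I • f + (Af - Complex.I • f) = (2 : ℂ) • Af := by
      rw [two_smul]; abel
    rw [this, smul_smul]
    norm_num
  have m1 : f ∈ M := by
    rw [e1, ← hCM]
    exact M.smul_mem _ (M.sub_mem u.2 (CM u).2)
  have m2 : Af ∈ M := by
    rw [e2, ← hCM]
    exact M.smul_mem _ (M.add_mem u.2 (CM u).2)
  refine ⟨⟨f, m1⟩, ⟨Af, m2⟩, ?_, Subtype.ext h2, Subtype.ext ((hCM u).trans h3)⟩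
  rw [tendsto_subtype_rng]
  refine h1.congr' ?_
  filter_upwards [self_mem_nhdsWithin] with t ht
  simp only [Submodule.coe_smul, Submodule.coe_sub, hTM t ht]

end Cogenerator

section Resolvent

variable {E : Type*} [NormedAddCommGroup E] [InnerProductSpace ℂ E] [CompleteSpace E]

theorem IsContractionSemigroup.integrableOn {T : ℝ → E →L[ℂ] E} (hT : IsContractionSemigroup T)
    (u : E) : IntegrableOn (fun t : ℝ => Real.exp (-t) • T t u) (Ioi 0) := by
  have h1 : IntegrableOn (fun t : ℝ => Real.exp (-t) * ‖u‖) (Ioi 0) :=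
    (integrableOn_exp_neg_Ioi 0).mul_const _
  refine Integrable.mono' h1 ?_ ?_
  · refine ContinuousOn.aestronglyMeasurable ?_ measurableSet_Ioi
    exact ((Real.continuous_exp.comp continuous_neg).continuousOn.smul
      ((hT.continuousOn u).mono Ioi_subset_Ici_self))
  · filter_upwards [ae_restrict_mem measurableSet_Ioi] with t ht
    rw [norm_smul, Real.norm_of_nonneg (Real.exp_pos _).le]
    exact mul_le_mul_of_nonneg_left (hT.norm_le t (le_of_lt ht) u) (Real.exp_pos _).le

/-- The value at `1` of the resolvent `∫₀^∞ e⁻ᵗ T_t u dt` of the generator of a contraction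
semigroup. -/
def resolventAtOne (T : ℝ → E →L[ℂ] E) (u : E) : E := ∫ t in Ioi (0 : ℝ), Real.exp (-t) • T t u

/-- The semigroup property in the form `T_h R u = e^h ∫_h^∞ e⁻ᵗ T_t u dt`, from which the derivative
of `T_h R u` at `h = 0` is read off. -/
theorem IsContractionSemigroup.apply_resolventAtOne {T : ℝ → E →L[ℂ] E}
    (hT : IsContractionSemigroup T) (u : E) {h : ℝ} (hh : 0 ≤ h) :
    T h (resolventAtOne T u) =
      Real.exp h • (resolventAtOne T u - ∫ t in (0 : ℝ)..h, Real.exp (-t) • T t u) := by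
  have hi := hT.integrableOn u
  have e0 : resolventAtOne T u - ∫ t in (0 : ℝ)..h, Real.exp (-t) • T t u
      = ∫ t in Ioi h, Real.exp (-t) • T t u := by
    rw [resolventAtOne, sub_eq_iff_eq_add, add_comm,
      intervalIntegral.integral_interval_add_Ioi hi (hi.mono_set (Ioi_subset_Ioi hh))]
  have e1 : ∫ t in Ioi h, Real.exp (-t) • T t u
      = ∫ t in Ioi (0 : ℝ), Real.exp (-(t + h)) • T (t + h) u := by
    have h1 := (measurePreserving_add_right volume h).setIntegral_preimage_emb
      (measurableEmbedding_addRight h) (fun t : ℝ => Real.exp (-t) • T t u) (Ioi h)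
    rw [← h1]
    simp
  rw [e0, e1, resolventAtOne, ← ContinuousLinearMap.integral_comp_comm _ hi, ← integral_smul]
  refine setIntegral_congr_fun measurableSet_Ioi fun t ht => ?_
  have ht' : (0 : ℝ) ≤ t := le_of_lt ht
  rw [add_comm t h, hT.add h t hh ht', smul_smul, ← Real.exp_add]
  have : h + -(h + t) = -t := by ring
  rw [this, ← Complex.coe_smul, map_smul, Complex.coe_smul]

theorem IsContractionSemigroup.tendsto_resolventAtOne {T : ℝ → E →L[ℂ] E}
    (hT : IsContractionSemigroup T) (u : E) :
    Tendsto (fun t : ℝ => (t : ℂ)⁻¹ • (T t (resolventAtOne T u) - resolventAtOne T u)) (𝓝[>] 0)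
      (𝓝 (resolventAtOne T u - u)) := by
  set R := resolventAtOne T u
  have hcont : ContinuousOn (fun t : ℝ => Real.exp (-t) • T t u) (Ici 0) :=
    (Real.continuous_exp.comp continuous_neg).continuousOn.smul (hT.continuousOn u)
  have d1 : HasDerivWithinAt (fun h : ℝ => ∫ t in (0 : ℝ)..h, Real.exp (-t) • T t u) u
      (Ici 0) 0 := by
    have := intervalIntegral.integral_hasDerivWithinAt_right (a := (0 : ℝ)) (b := 0)
      (f := fun t : ℝ => Real.exp (-t) • T t u) (s := Ici 0) (t := Ioi 0) (by simp)
      ?_ ((hcont 0 (by simp)).mono Ioi_subset_Ici_self)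
    · simpa [hT.zero] using this
    · exact ⟨Ioi 0, self_mem_nhdsWithin,
        (hcont.mono Ioi_subset_Ici_self).aestronglyMeasurable measurableSet_Ioi⟩
  have d2 : HasDerivWithinAt (fun h : ℝ => Real.exp h •
      (R - ∫ t in (0 : ℝ)..h, Real.exp (-t) • T t u)) (R - u) (Ici 0) 0 := by
    have := ((Real.hasDerivAt_exp 0).hasDerivWithinAt (s := Ici 0)).smul (d1.const_sub R)
    have e1 : Real.exp 0 • -u + Real.exp 0 •
        (R - ∫ t in (0 : ℝ)..0, Real.exp (-t) • T t u) = R - u := by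
      simp [sub_eq_add_neg, add_comm]
    rw [e1] at this
    exact this
  have d3 := (hasDerivWithinAt_iff_tendsto_slope.1 d2)
  rw [Ici_sdiff_left] at d3
  refine d3.congr' ?_
  filter_upwards [self_mem_nhdsWithin] with t ht
  have ht' : (0 : ℝ) ≤ t := le_of_lt ht
  rw [slope_def_module, ← hT.apply_resolventAtOne u ht', ← Complex.ofReal_inv, Complex.coe_smul]
  simp [R]

/-- A contraction semigroup has a cogenerator, namely `u ↦ u - 2 ∫₀^∞ e⁻ᵗ T_t u dt`. -/
theorem IsContractionSemigroup.exists_cogenerator {T : ℝ → E →L[ℂ] E}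
    (hT : IsContractionSemigroup T) :
    ∃ C : E →L[ℂ] E, IsCogenerator T C ∧ ∀ u, C u = u - (2 : ℂ) • resolventAtOne T u := by
  let R : E →L[ℂ] E := LinearMap.mkContinuous
    { toFun := resolventAtOne T
      map_add' := fun u v => by
        simp only [resolventAtOne, map_add, smul_add]
        exact integral_add (hT.integrableOn u) (hT.integrableOn v)
      map_smul' := fun c u => by
        simp only [resolventAtOne, map_smul, RingHom.id_apply]
        rw [← integral_smul]
        congr 1
        ext t
        rw [smul_comm] } 1 (fun u => by
      rw [one_mul]
      have h1 : IntegrableOn (fun t : ℝ => Real.exp (-t) * ‖u‖) (Ioi 0) :=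
        (integrableOn_exp_neg_Ioi 0).mul_const _
      refine (norm_integral_le_of_norm_le h1 ?_).trans ?_
      · filter_upwards [ae_restrict_mem measurableSet_Ioi] with t ht
        rw [norm_smul, Real.norm_of_nonneg (Real.exp_pos _).le]
        exact mul_le_mul_of_nonneg_left (hT.norm_le t (le_of_lt ht) u) (Real.exp_pos _).le
      · rw [integral_mul_const, integral_exp_neg_Ioi_zero, one_mul])
  refine ⟨ContinuousLinearMap.id ℂ E - (2 : ℂ) • R, fun u => ?_, fun u => rfl⟩
  refine ⟨-(Complex.I • resolventAtOne T u), u - resolventAtOne T u, ?_, ?_, ?_⟩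
  · have h1 := (hT.tendsto_resolventAtOne u).const_smul (-1 : ℂ)
    have h2 : (-1 : ℂ) • (resolventAtOne T u - u) = u - resolventAtOne T u := by
      rw [neg_one_smul, neg_sub]
    rw [h2] at h1
    refine h1.congr fun t => ?_
    rw [map_neg, map_smul, ← smul_neg, ← smul_neg, ← smul_sub, smul_smul, smul_smul, mul_inv,
      mul_right_comm, inv_mul_cancel₀ Complex.I_ne_zero, one_mul, neg_one_mul, neg_smul,
      ← smul_neg]
    congr 1
    abel
  · rw [smul_neg, smul_smul, Complex.I_mul_I]
    simp
  · change u - (2 : ℂ) • resolventAtOne T u = _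
    rw [smul_neg, smul_smul, Complex.I_mul_I, two_smul]
    simp only [neg_smul, one_smul]
    abel

theorem IsCogenerator.apply_eq_sub_resolventAtOne {T : ℝ → E →L[ℂ] E} {C : E →L[ℂ] E}
    (hC : IsCogenerator T C) (hT : IsContractionSemigroup T) (u : E) :
    C u = u - (2 : ℂ) • resolventAtOne T u := by
  obtain ⟨C', h1, h2⟩ := hT.exists_cogenerator
  rw [hC.unique h1 hT.norm_le, h2]

/-- A closed subspace that is invariant under a contraction semigroup is invariant under its
cogenerator. -/
theorem IsCogenerator.mem_of_invariant {T : ℝ → E →L[ℂ] E} {C : E →L[ℂ] E}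
    (hC : IsCogenerator T C) (hT : IsContractionSemigroup T) {M : Submodule ℂ E}
    (hM : IsClosed (M : Set E)) (hTM : ∀ t, 0 ≤ t → ∀ f ∈ M, T t f ∈ M) {f : E} (hf : f ∈ M) :
    C f ∈ M := by
  rw [hC.apply_eq_sub_resolventAtOne hT]
  refine M.sub_mem hf (M.smul_mem _ ?_)
  have hc : CompleteSpace M := hM.completeSpace_coe
  -- The integral is orthogonal to everything that is orthogonal to `M`.
  have h1 := M.orthogonal_orthogonal
  rw [← h1, Submodule.mem_orthogonal]
  intro g hg
  rw [resolventAtOne, ← integral_inner (hT.integrableOn f) g]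
  refine (setIntegral_congr_fun (g := fun _ => (0 : ℂ)) measurableSet_Ioi fun t ht => ?_).trans
    (by simp)
  simp only
  rw [← Complex.coe_smul, inner_smul_right,
    Submodule.inner_left_of_mem_orthogonal (hTM t (le_of_lt ht) f hf) hg, mul_zero]

/-- The cogenerator of the semigroup of inverses is the inverse of the cogenerator. -/
theorem IsCogenerator.apply_apply_of_inverse {T T' : ℝ → E →L[ℂ] E} {C C' : E →L[ℂ] E}
    (hC : IsCogenerator T C) (hC' : IsCogenerator T' C') (hT : IsContractionSemigroup T)
    (hTT' : ∀ t, 0 ≤ t → ∀ f, T t (T' t f) = f) (u : E) : C (C' u) = u := by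
  obtain ⟨f, Af, h1, h2, h3⟩ := hC' u
  -- Since `T_t f - f = -T_t (T'_t f - f)`, the generator of `T` maps `f` to `-A' f`.
  have h4 : Tendsto (fun t : ℝ => (Complex.I * (t : ℂ))⁻¹ • (T t f - f)) (𝓝[>] 0)
      (𝓝 (-Af)) := by
    have h5 : Tendsto (fun t : ℝ => T t Af) (𝓝[>] 0) (𝓝 Af) := by
      have := hT.continuousOn Af 0 (by simp)
      rw [ContinuousWithinAt, hT.zero] at this
      exact this.mono_left (nhdsWithin_mono _ Ioi_subset_Ici_self)
    have h6 : Tendsto (fun t : ℝ => T t ((Complex.I * (t : ℂ))⁻¹ • (T' t f - f) - Af))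
        (𝓝[>] 0) (𝓝 0) := by
      have h7 : Tendsto (fun t : ℝ => (Complex.I * (t : ℂ))⁻¹ • (T' t f - f) - Af) (𝓝[>] 0)
          (𝓝 0) := by simpa using h1.sub_const Af
      refine squeeze_zero_norm' ?_ (tendsto_zero_iff_norm_tendsto_zero.1 h7)
      filter_upwards [self_mem_nhdsWithin] with t ht
      exact hT.norm_le t (le_of_lt ht) _
    have h8 := (h6.add h5).neg
    rw [zero_add] at h8
    refine h8.congr' ?_
    filter_upwards [self_mem_nhdsWithin] with t ht
    rw [← map_add, sub_add_cancel, map_smul, map_sub, hTT' t (le_of_lt ht), ← smul_neg, neg_sub]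
  have h5 := hC.apply_eq hT.norm_le h4
  have e1 : -Af + Complex.I • f = -(C' u) := by rw [h3]; abel
  have e2 : -Af - Complex.I • f = -u := by rw [h2]; abel
  rw [e1, e2, map_neg, neg_inj] at h5
  exact h5

/-- The inverses of a semigroup of unitary operators form a contraction semigroup. -/
theorem IsContractionSemigroup.inverse {T T' : ℝ → E →L[ℂ] E} (hT : IsContractionSemigroup T)
    (hn : ∀ t, 0 ≤ t → ∀ f, ‖T t f‖ = ‖f‖)
    (hTT' : ∀ t, 0 ≤ t → ∀ f, T t (T' t f) = f) : IsContractionSemigroup T' := by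
  have hinj : ∀ t, 0 ≤ t → Function.Injective (T t) := fun t ht =>
    (injective_iff_map_eq_zero (T t)).2 fun f hf => by
      rw [← norm_eq_zero, ← hn t ht, hf, norm_zero]
  have hn' : ∀ t, 0 ≤ t → ∀ f, ‖T' t f‖ = ‖f‖ := fun t ht f => by
    rw [← hn t ht, hTT' t ht]
  refine ⟨fun t ht f => (hn' t ht f).le, fun f => ?_, fun t s ht hs f => ?_, fun f t ht => ?_⟩
  · have := hTT' 0 le_rfl f
    rwa [hT.zero] at this
  · apply hinj (t + s) (add_nonneg ht hs)
    rw [hTT' _ (add_nonneg ht hs), add_comm t s, hT.add s t hs ht, hTT' t ht, hTT' s hs]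
  · have h1 := hT.continuousOn (T' t f) t ht
    rw [ContinuousWithinAt, tendsto_iff_norm_sub_tendsto_zero] at h1 ⊢
    refine h1.congr' ?_
    filter_upwards [self_mem_nhdsWithin] with s hs
    rw [hTT' t ht, ← hn s hs (T' s f - T' t f), map_sub, hTT' s hs, norm_sub_rev]

end Resolvent

/-! ### Isometries with one-dimensional defect -/

section Wold

variable {E F : Type*} [NormedAddCommGroup E] [InnerProductSpace ℂ E] [CompleteSpace E]
  [NormedAddCommGroup F] [InnerProductSpace ℂ F] [CompleteSpace F]

/-- The orthogonal complement of the range of `V` is spanned by the unit vector `e`. -/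
structure IsDefectVector (V : E →L[ℂ] E) (e : E) : Prop where
  norm_eq_one : ‖e‖ = 1
  inner_eq_zero_iff : ∀ x, inner ℂ e x = 0 ↔ ∃ y, V y = x

theorem IsDefectVector.inner_pow {V : E →L[ℂ] E} {e : E} (he : IsDefectVector V e)
    (hV : ∀ f, ‖V f‖ = ‖f‖) (n m : ℕ) :
    inner ℂ ((V ^ n) e) ((V ^ m) e) = if n = m then 1 else 0 := by
  induction n generalizing m with
  | zero =>
    cases m with
    | zero => simp [he.norm_eq_one]
    | succ m =>
      rw [pow_succ', pow_zero]
      simpa using (he.inner_eq_zero_iff _).2 ⟨(V ^ m) e, rfl⟩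
  | succ n ih =>
    cases m with
    | zero =>
      rw [pow_succ', pow_zero, inner_eq_zero_symm.1]
      · simp
      · simpa using (he.inner_eq_zero_iff _).2 ⟨(V ^ n) e, rfl⟩
    | succ m =>
      rw [pow_succ', pow_succ']
      simp only [mul_apply_eq_comp, inner_map_of_norm_map hV, ih]
      simp

theorem IsDefectVector.inner_pow_unitary_part {V : E →L[ℂ] E} {e : E} (he : IsDefectVector V e)
    {E₀ : Submodule ℂ E} (hE : IsWoldDecomposition V E₀) {k : E} (hk : k ∈ E₀) (n : ℕ) :
    inner ℂ ((V ^ n) e) k = 0 := by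
  induction n generalizing k with
  | zero =>
    rw [← hE.unitary_part] at hk
    obtain ⟨k', -, rfl⟩ := hk
    simpa using (he.inner_eq_zero_iff _).2 ⟨k', rfl⟩
  | succ n ih =>
    rw [← hE.unitary_part] at hk
    obtain ⟨k', hk', rfl⟩ := hk
    rw [pow_succ']
    simpa [inner_map_of_norm_map hE.isometry] using ih hk'

/-- The completely nonunitary part of `V` is the shift generated by the defect vector. -/
theorem IsDefectVector.eq_zero {V : E →L[ℂ] E} {e : E} (he : IsDefectVector V e)
    {E₀ : Submodule ℂ E} (hE : IsWoldDecomposition V E₀) {f : E} (hf : ∀ k ∈ E₀, inner ℂ k f = 0)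
    (hf' : ∀ n : ℕ, inner ℂ ((V ^ n) e) f = 0) : f = 0 := by
  -- The vectors of `E₀ᗮ` orthogonal to the orbit of `e` form a subspace on which `V` is unitary.
  set N : Submodule ℂ E := E₀ᗮ ⊓ (Submodule.span ℂ (range fun n : ℕ => (V ^ n) e))ᗮ
  have hN : ∀ g, g ∈ N ↔ (∀ k ∈ E₀, inner ℂ k g = 0) ∧ ∀ n : ℕ, inner ℂ ((V ^ n) e) g = 0 := by
    intro g
    rw [Submodule.mem_inf, Submodule.mem_orthogonal, Submodule.mem_orthogonal]
    refine and_congr Iff.rfl ⟨fun h n => h _ (Submodule.subset_span (mem_range_self n)),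
      fun h u hu => ?_⟩
    induction hu using Submodule.span_induction with
    | mem x hx => obtain ⟨n, rfl⟩ := hx; exact h n
    | zero => exact inner_zero_left _
    | add x y _ _ hx hy => rw [inner_add_left, hx, hy, add_zero]
    | smul c x _ hx => rw [inner_smul_left, hx, mul_zero]
  have h1 : N = ⊥ := by
    refine hE.completely_nonunitary N inf_le_left ?_ (le_antisymm ?_ ?_)
    · exact (Submodule.isClosed_orthogonal _).inter (Submodule.isClosed_orthogonal _)
    · rintro _ ⟨x, hx, rfl⟩
      have hx1 := (hN x).1 hx
      have hx2 : V x ∈ E₀ᗮ := hE.invariant_compl ⟨x, hx.1, rfl⟩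
      refine (hN _).2 ⟨fun k hk => (Submodule.mem_orthogonal _ _).1 hx2 k hk, fun n => ?_⟩
      cases n with
      | zero => simpa using (he.inner_eq_zero_iff _).2 ⟨x, rfl⟩
      | succ n =>
        rw [pow_succ']
        simpa [inner_map_of_norm_map hE.isometry] using hx1.2 n
    · intro x hx
      have hx1 := (hN x).1 hx
      obtain ⟨y, rfl⟩ := (he.inner_eq_zero_iff x).1 (by simpa using hx1.2 0)
      refine ⟨y, (hN y).2 ⟨fun k hk => ?_, fun n => ?_⟩, rfl⟩
      · rw [← inner_map_of_norm_map hE.isometry]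
        refine hx1.1 _ ?_
        have : V k ∈ E₀.map (V : E →ₗ[ℂ] E) := ⟨k, hk, rfl⟩
        rwa [hE.unitary_part] at this
      · rw [← inner_map_of_norm_map hE.isometry]
        simpa [pow_succ'] using hx1.2 (n + 1)
  have h2 : f ∈ N := (hN f).2 ⟨hf, hf'⟩
  rw [h1] at h2
  exact (Submodule.mem_bot ℂ).1 h2

/-- Isometries with one-dimensional defect are determined up to unitary equivalence by their
unitary parts. -/
theorem exists_equiv_of_wold {V : E →L[ℂ] E} {V' : F →L[ℂ] F} {E₀ : Submodule ℂ E}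
    {F₀ : Submodule ℂ F} {e : E} {e' : F} {ν : Measure UnitAddCircle}
    (hE : IsWoldDecomposition V E₀) (hF : IsWoldDecomposition V' F₀)
    (he : IsDefectVector V e) (he' : IsDefectVector V' e')
    (hm : IsMulZOn V E₀ ν) (hm' : IsMulZOn V' F₀ ν) :
    ∃ J : E ≃ₗᵢ[ℂ] F, (∀ f, J (V f) = V' (J f)) ∧ J e = e' := by
  obtain ⟨Ω, hΩ⟩ := hm
  obtain ⟨Ω', hΩ'⟩ := hm'
  let x : L2 ν ⊕ ℕ → E := Sum.elim (fun f => (Ω f : E)) (fun n => (V ^ n) e)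
  let y : L2 ν ⊕ ℕ → F := Sum.elim (fun f => (Ω' f : F)) (fun n => (V' ^ n) e')
  have hx : ∀ f, (∀ i, inner ℂ (x i) f = 0) → f = 0 := fun f hf =>
    he.eq_zero hE (fun k hk => by simpa [x] using hf (Sum.inl (Ω.symm ⟨k, hk⟩)))
      (fun n => hf (Sum.inr n))
  have hy : ∀ f, (∀ i, inner ℂ (y i) f = 0) → f = 0 := fun f hf =>
    he'.eq_zero hF (fun k hk => by simpa [y] using hf (Sum.inl (Ω'.symm ⟨k, hk⟩)))
      (fun n => hf (Sum.inr n))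
  obtain ⟨J, hJ⟩ := exists_equiv_of_gram (x := x) (y := y) (fun i j => by
    rcases i with f | n <;> rcases j with g | m
    · simp only [x, y, Sum.elim_inl, ← Submodule.coe_inner, LinearIsometryEquiv.inner_map_map]
    · simp only [x, y, Sum.elim_inl, Sum.elim_inr]
      rw [inner_eq_zero_symm.1 (he.inner_pow_unitary_part hE (Ω f).2 m),
        inner_eq_zero_symm.1 (he'.inner_pow_unitary_part hF (Ω' f).2 m)]
    · simp only [x, y, Sum.elim_inl, Sum.elim_inr]
      rw [he.inner_pow_unitary_part hE (Ω g).2 n, he'.inner_pow_unitary_part hF (Ω' g).2 n]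
    · simp only [x, y, Sum.elim_inr]
      rw [he.inner_pow hE.isometry, he'.inner_pow hF.isometry]) hx hy
  have hJ0 : ∀ n : ℕ, J ((V ^ n) e) = (V' ^ n) e' := fun n => hJ (Sum.inr n)
  refine ⟨J, fun f => ?_, by simpa using hJ0 0⟩
  have h1 : (J : E →L[ℂ] F) ∘L V = V' ∘L (J : E →L[ℂ] F) := by
    refine eq_of_eq_on_complete hx fun i => ?_
    rcases i with f | n
    · have h2 : J (Ω f) = Ω' f := hJ (Sum.inl f)
      have h3 : J (Ω (mulZ ν f)) = Ω' (mulZ ν f) := hJ (Sum.inl (mulZ ν f))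
      change J (V (Ω f)) = V' (J (Ω f))
      rw [h2, ← hΩ, h3, hΩ']
    · change J (V ((V ^ n) e)) = V' (J ((V ^ n) e))
      rw [hJ0, ← mul_apply_eq_comp, ← mul_apply_eq_comp, ← pow_succ',
        ← pow_succ', hJ0]
  exact congrArg (fun A : E →L[ℂ] F => A f) h1

end Wold

/-! ### Multiplication by unimodular functions -/

section Multiplication

/-- Dominated convergence in `L²`, for functions that are known up to null sets. -/
theorem tendsto_L2_zero_of_dominated {α ι : Type*} [MeasurableSpace α] {ν : Measure α}
    {l : Filter ι} [l.IsCountablyGenerated] {f : ι → Lp ℂ 2 ν} {F : ι → α → ℂ} {g : α → ℝ}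
    (hF : ∀ n, f n =ᵐ[ν] F n) (hg : MemLp g 2 ν) (hb : ∀ᶠ n in l, ∀ᵐ x ∂ν, ‖F n x‖ ≤ g x)
    (hl : ∀ᵐ x ∂ν, Tendsto (fun n => F n x) l (𝓝 0)) : Tendsto f l (𝓝 0) := by
  rw [Lp.tendsto_Lp_iff_tendsto_eLpNorm']
  have e1 : ∀ n, eLpNorm (⇑(f n) - ⇑(0 : Lp ℂ 2 ν)) 2 ν
      = (∫⁻ x, ‖F n x‖ₑ ^ (2 : ℝ) ∂ν) ^ (1 / (2 : ℝ)) := by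
    intro n
    have h1 : (⇑(f n) - ⇑(0 : Lp ℂ 2 ν)) =ᵐ[ν] F n := by
      filter_upwards [hF n, Lp.coeFn_zero ℂ 2 ν] with x h1 h2
      rw [Pi.sub_apply, h1, h2, Pi.zero_apply, sub_zero]
    rw [eLpNorm_congr_ae h1, eLpNorm_eq_lintegral_rpow_enorm_toReal (by norm_num) (by norm_num)]
    norm_num
  simp only [e1]
  have h2 : Tendsto (fun n => ∫⁻ x, ‖F n x‖ₑ ^ (2 : ℝ) ∂ν) l (𝓝 (∫⁻ _, 0 ∂ν)) := by
    refine tendsto_lintegral_filter_of_dominated_convergence' (fun x => ‖g x‖ₑ ^ (2 : ℝ)) ?_ ?_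
      ?_ ?_
    · refine Eventually.of_forall fun n => ?_
      exact (((Lp.aestronglyMeasurable (f n)).congr (hF n)).enorm).pow_const _
    · filter_upwards [hb] with n hn
      filter_upwards [hn] with x hx
      refine ENNReal.rpow_le_rpow ?_ (by norm_num)
      rw [enorm_le_iff_norm_le]
      exact hx.trans (le_abs_self _)
    · have := hg.2
      rw [eLpNorm_eq_lintegral_rpow_enorm_toReal (by norm_num) (by norm_num)] at this
      intro h
      rw [ENNReal.toReal_ofNat, h, ENNReal.top_rpow_of_pos (by norm_num)] at this
      exact lt_irrefl _ this
    · filter_upwards [hl] with x hx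
      have h3 : Tendsto (fun n => ‖F n x‖ₑ ^ (2 : ℝ)) l (𝓝 (‖(0 : ℂ)‖ₑ ^ (2 : ℝ))) :=
        (ENNReal.continuous_rpow_const.tendsto _).comp ((continuous_enorm.tendsto _).comp hx)
      simpa using h3
  rw [lintegral_zero] at h2
  have h3 := (ENNReal.continuous_rpow_const (y := 1 / (2 : ℝ))).tendsto (0 : ENNReal)
  rw [ENNReal.zero_rpow_of_pos (by norm_num)] at h3
  exact h3.comp h2

variable {ν : Measure UnitAddCircle}

/-- A measurable function of modulus one almost everywhere. -/
structure IsUnimodular (ν : Measure UnitAddCircle) (φ : UnitAddCircle → ℂ) : Prop where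
  aestronglyMeasurable : AEStronglyMeasurable φ ν
  norm_eq_one : ∀ᵐ x ∂ν, ‖φ x‖ = 1

theorem IsUnimodular.memLp_mul {φ : UnitAddCircle → ℂ} (hφ : IsUnimodular ν φ) (f : L2 ν) :
    MemLp (fun x => φ x * f x) 2 ν := by
  refine (Lp.memLp f).of_le (hφ.1.mul (Lp.aestronglyMeasurable f)) ?_
  filter_upwards [hφ.2] with x hx
  rw [norm_mul, hx, one_mul]

/-- Multiplication by a unimodular function. -/
def mulU {φ : UnitAddCircle → ℂ} (hφ : IsUnimodular ν φ) : L2 ν →ₗᵢ[ℂ] L2 ν where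
  toFun f := (hφ.memLp_mul f).toLp _
  map_add' f g := by
    apply Lp.ext
    filter_upwards [(hφ.memLp_mul (f + g)).coeFn_toLp, (hφ.memLp_mul f).coeFn_toLp,
      (hφ.memLp_mul g).coeFn_toLp, Lp.coeFn_add f g,
      Lp.coeFn_add ((hφ.memLp_mul f).toLp _) ((hφ.memLp_mul g).toLp _)] with x h1 h2 h3 h4 h5
    rw [h1, h5, Pi.add_apply, h2, h3, h4, Pi.add_apply, mul_add]
  map_smul' c f := by
    apply Lp.ext
    filter_upwards [(hφ.memLp_mul (c • f)).coeFn_toLp, (hφ.memLp_mul f).coeFn_toLp,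
      Lp.coeFn_smul c f, Lp.coeFn_smul c ((hφ.memLp_mul f).toLp _)] with x h1 h2 h3 h4
    rw [h1, RingHom.id_apply, h4, Pi.smul_apply, h2, h3, Pi.smul_apply, smul_eq_mul,
      smul_eq_mul, mul_left_comm]
  norm_map' f := by
    have h : ∀ᵐ x ∂ν, ‖((hφ.memLp_mul f).toLp _ : L2 ν) x‖ = ‖f x‖ := by
      filter_upwards [(hφ.memLp_mul f).coeFn_toLp, hφ.2] with x h1 h2
      rw [h1, norm_mul, h2, one_mul]
    exact le_antisymm (Lp.norm_le_norm_of_ae_le (h.mono fun x hx => hx.le))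
      (Lp.norm_le_norm_of_ae_le (h.mono fun x hx => hx.ge))

theorem coeFn_mulU {φ : UnitAddCircle → ℂ} (hφ : IsUnimodular ν φ) (f : L2 ν) :
    ⇑(mulU hφ f) =ᵐ[ν] fun x => φ x * f x :=
  (hφ.memLp_mul f).coeFn_toLp

theorem mulU_mulU {φ ψ χ : UnitAddCircle → ℂ} (hφ : IsUnimodular ν φ) (hψ : IsUnimodular ν ψ)
    (hχ : IsUnimodular ν χ) (h : ∀ᵐ x ∂ν, φ x * ψ x = χ x) (f : L2 ν) :
    mulU hφ (mulU hψ f) = mulU hχ f := by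
  apply Lp.ext
  filter_upwards [coeFn_mulU hφ (mulU hψ f), coeFn_mulU hψ f, coeFn_mulU hχ f, h]
    with x h1 h2 h3 h4
  rw [h1, h2, h3, ← h4, mul_assoc]

theorem mulU_eq_self {φ : UnitAddCircle → ℂ} (hφ : IsUnimodular ν φ)
    (h : ∀ᵐ x ∂ν, φ x = 1) (f : L2 ν) : mulU hφ f = f := by
  apply Lp.ext
  filter_upwards [coeFn_mulU hφ f, h] with x h1 h2
  rw [h1, h2, one_mul]

theorem mulU_comm {φ ψ : UnitAddCircle → ℂ} (hφ : IsUnimodular ν φ) (hψ : IsUnimodular ν ψ)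
    (f : L2 ν) : mulU hφ (mulU hψ f) = mulU hψ (mulU hφ f) := by
  apply Lp.ext
  filter_upwards [coeFn_mulU hφ (mulU hψ f), coeFn_mulU hψ f, coeFn_mulU hψ (mulU hφ f),
    coeFn_mulU hφ f] with x h1 h2 h3 h4
  rw [h1, h2, h3, h4, mul_left_comm]

theorem isUnimodular_pt : IsUnimodular ν pt :=
  ⟨continuous_pt.aestronglyMeasurable, Eventually.of_forall norm_pt⟩

theorem isUnimodular_conj_pt : IsUnimodular ν fun x => (starRingEnd ℂ) (pt x) :=
  ⟨(Complex.continuous_conj.comp continuous_pt).aestronglyMeasurable,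
    Eventually.of_forall fun x => by simp [norm_pt]⟩

theorem pt_mul_conj (x : UnitAddCircle) : pt x * (starRingEnd ℂ) (pt x) = 1 := by
  rw [Complex.mul_conj, Complex.normSq_eq_norm_sq, norm_pt]; norm_num

theorem mulU_pt (f : L2 ν) : mulU isUnimodular_pt f = mulZ ν f := by
  apply Lp.ext
  filter_upwards [coeFn_mulU isUnimodular_pt f, coeFn_mulZ ν f] with x h1 h2
  rw [h1, h2]

/-- Multiplication by `z`, as a unitary operator. -/
def mulZEquiv (ν : Measure UnitAddCircle) : L2 ν ≃ₗᵢ[ℂ] L2 ν :=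
  { mulU (ν := ν) isUnimodular_pt with
    invFun := mulU isUnimodular_conj_pt
    left_inv := fun f => by
      change mulU isUnimodular_conj_pt (mulU isUnimodular_pt f) = f
      rw [mulU_mulU isUnimodular_conj_pt isUnimodular_pt (χ := fun _ => 1)
        ⟨aestronglyMeasurable_const, by simp⟩
        (Eventually.of_forall fun x => by rw [mul_comm, pt_mul_conj])]
      exact mulU_eq_self _ (by simp) f
    right_inv := fun f => by
      change mulU isUnimodular_pt (mulU isUnimodular_conj_pt f) = f
      rw [mulU_mulU isUnimodular_pt isUnimodular_conj_pt (χ := fun _ => 1)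
        ⟨aestronglyMeasurable_const, by simp⟩ (Eventually.of_forall pt_mul_conj)]
      exact mulU_eq_self _ (by simp) f }

theorem mulZEquiv_apply (f : L2 ν) : mulZEquiv ν f = mulZ ν f := mulU_pt f

theorem coeFn_mulZEquiv_symm (f : L2 ν) :
    ⇑((mulZEquiv ν).symm f) =ᵐ[ν] fun x => (starRingEnd ℂ) (pt x) * f x :=
  coeFn_mulU isUnimodular_conj_pt f

theorem norm_mulZ (f : L2 ν) : ‖mulZ ν f‖ = ‖f‖ := by
  rw [← mulZEquiv_apply, LinearIsometryEquiv.norm_map]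

theorem inner_mulZ_mulZ (f g : L2 ν) : inner ℂ (mulZ ν f) (mulZ ν g) = inner ℂ f g := by
  rw [← mulZEquiv_apply, ← mulZEquiv_apply, LinearIsometryEquiv.inner_map_map]

theorem mulZ_mulZEquiv_symm (f : L2 ν) : mulZ ν ((mulZEquiv ν).symm f) = f := by
  rw [← mulZEquiv_apply, LinearIsometryEquiv.apply_symm_apply]

theorem mulZEquiv_symm_mulZ (f : L2 ν) : (mulZEquiv ν).symm (mulZ ν f) = f := by
  rw [← mulZEquiv_apply, LinearIsometryEquiv.symm_apply_apply]

/-! ### The unitary group with cogenerator multiplication by `z` -/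

/-- The Cayley transform `(z + 1) / (z - 1)` on the circle; at the point `1` its value is `0`. -/
def cayley (x : UnitAddCircle) : ℂ := (pt x + 1) / (pt x - 1)

theorem measurable_cayley : Measurable cayley :=
  (continuous_pt.measurable.add_const _).div (continuous_pt.measurable.sub_const _)

/-- The Cayley transform is purely imaginary on the circle, including the value `0` at the point `1`. -/
theorem cayley_eq (x : UnitAddCircle) : cayley x = Complex.I * ((cayley x).im : ℂ) := by
  have h1 : (starRingEnd ℂ) (cayley x) = -cayley x := by
    have h2 := pt_mul_conj x
    have h3 : pt x ≠ 0 := fun h => by rw [h, zero_mul] at h2; exact zero_ne_one h2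
    have h4 : (starRingEnd ℂ) (pt x) = (pt x)⁻¹ := eq_inv_of_mul_eq_one_right h2
    rw [cayley, map_div₀, map_add, map_sub, h4, map_one]
    by_cases h : pt x = 1
    · simp [h]
    · have h5 : pt x - 1 ≠ 0 := sub_ne_zero.2 h
      have h6 : (pt x)⁻¹ - 1 = -((pt x - 1) / pt x) := by field_simp; ring
      have h7 : (pt x)⁻¹ + 1 = (pt x + 1) / pt x := by field_simp; ring
      rw [h6, h7, div_neg, div_div_div_cancel_right₀ h3]
  have h2 : (cayley x).re = 0 := by
    have := congrArg Complex.re h1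
    rw [Complex.conj_re, Complex.neg_re] at this
    linarith
  apply Complex.ext <;> simp [h2]

/-- The function `exp (t (z + 1) / (z - 1))` on the circle. -/
def expCayley (t : ℝ) (x : UnitAddCircle) : ℂ := Complex.exp ((t : ℂ) * cayley x)

theorem expCayley_eq (t : ℝ) (x : UnitAddCircle) :
    expCayley t x = Complex.exp (Complex.I * ((t * (cayley x).im : ℝ) : ℂ)) := by
  rw [expCayley, cayley_eq, Complex.ofReal_mul]
  congr 1
  simp
  ring

theorem norm_expCayley (t : ℝ) (x : UnitAddCircle) : ‖expCayley t x‖ = 1 := by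
  rw [expCayley_eq, mul_comm, Complex.norm_exp_ofReal_mul_I]

theorem norm_expCayley_sub_one_le (t : ℝ) (x : UnitAddCircle) :
    ‖expCayley t x - 1‖ ≤ |t| * ‖cayley x‖ := by
  have h := Real.norm_exp_I_mul_ofReal_sub_one_le (x := t * (cayley x).im)
  rw [← expCayley_eq, Real.norm_eq_abs, abs_mul] at h
  exact h.trans (mul_le_mul_of_nonneg_left (Complex.abs_im_le_norm _) (abs_nonneg _))

theorem isUnimodular_expCayley (t : ℝ) : IsUnimodular ν (expCayley t) :=
  ⟨(Complex.measurable_exp.comp (measurable_cayley.const_mul _)).aestronglyMeasurable,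
    Eventually.of_forall (norm_expCayley t)⟩

/-- The unitary group of multiplications by `exp (t (z + 1) / (z - 1))` in `L²(ν)`. -/
def cayleyGroup (ν : Measure UnitAddCircle) (t : ℝ) : L2 ν →L[ℂ] L2 ν :=
  (mulU (ν := ν) (isUnimodular_expCayley t)).toContinuousLinearMap

theorem coeFn_cayleyGroup (t : ℝ) (f : L2 ν) :
    ⇑(cayleyGroup ν t f) =ᵐ[ν] fun x => expCayley t x * f x :=
  coeFn_mulU (isUnimodular_expCayley t) f

theorem norm_cayleyGroup (t : ℝ) (f : L2 ν) : ‖cayleyGroup ν t f‖ = ‖f‖ :=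
  (mulU (isUnimodular_expCayley t)).norm_map f

theorem cayleyGroup_add (t s : ℝ) (f : L2 ν) :
    cayleyGroup ν (t + s) f = cayleyGroup ν t (cayleyGroup ν s f) :=
  (mulU_mulU (isUnimodular_expCayley t) (isUnimodular_expCayley s)
    (isUnimodular_expCayley (t + s)) (Eventually.of_forall fun x => by
    rw [expCayley, expCayley, expCayley, ← Complex.exp_add, Complex.ofReal_add, add_mul]) f).symm

theorem cayleyGroup_zero (f : L2 ν) : cayleyGroup ν 0 f = f :=
  mulU_eq_self (isUnimodular_expCayley 0) (Eventually.of_forall fun x => by simp [expCayley]) f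

theorem continuous_cayleyGroup (f : L2 ν) : Continuous fun t => cayleyGroup ν t f := by
  rw [continuous_iff_continuousAt]
  intro s
  rw [ContinuousAt, ← tendsto_sub_nhds_zero_iff]
  refine tendsto_L2_zero_of_dominated
    (F := fun t x => expCayley t x * f x - expCayley s x * f x) (g := fun x => ‖f x‖ + ‖f x‖)
    (fun t => ?_) ((Lp.memLp f).norm.add (Lp.memLp f).norm) ?_ ?_
  · filter_upwards [Lp.coeFn_sub (cayleyGroup ν t f) (cayleyGroup ν s f), coeFn_cayleyGroup t f,
      coeFn_cayleyGroup s f] with x h1 h2 h3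
    rw [h1, Pi.sub_apply, h2, h3]
  · refine Eventually.of_forall fun t => Eventually.of_forall fun x => ?_
    refine (norm_sub_le _ _).trans ?_
    simp [norm_expCayley]
  · refine Eventually.of_forall fun x => ?_
    have h1 : Continuous fun t => expCayley t x * f x - expCayley s x * f x := by
      unfold expCayley; fun_prop
    have h2 := h1.tendsto s
    rwa [sub_self] at h2

theorem isContractionSemigroup_cayleyGroup : IsContractionSemigroup (cayleyGroup ν) :=
  ⟨fun t _ f => (norm_cayleyGroup t f).le, cayleyGroup_zero, fun t s _ _ => cayleyGroup_add t s,
    fun f => (continuous_cayleyGroup f).continuousOn⟩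

theorem pt_eq_one_iff {x : UnitAddCircle} : pt x = 1 ↔ x = 0 := by
  constructor
  · intro h
    apply AddCircle.injective_toCircle (T := 1) one_ne_zero
    rw [AddCircle.toCircle_zero]
    exact Subtype.ext h
  · rintro rfl
    simp [pt]

/-- The generator of the group is multiplication by `(z + 1) / (i (z - 1))`, and its domain contains the
functions `f = (u - z u) / 2i`, for which `A f = (u + z u) / 2`. When the point `1` carries mass,
`cayley` is the junk value `0` there and the statement fails. -/
theorem isCogenerator_cayleyGroup (h0 : ν {0} = 0) :
    IsCogenerator (cayleyGroup ν) (mulZ ν) := by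
  intro u
  set f : L2 ν := (-(Complex.I / 2)) • (u - mulZ ν u) with hf
  set Af : L2 ν := (1 / 2 : ℂ) • (u + mulZ ν u) with hAf
  have ef : ⇑f =ᵐ[ν] fun x => -(Complex.I / 2) * ((1 - pt x) * u x) := by
    filter_upwards [Lp.coeFn_smul (-(Complex.I / 2)) (u - mulZ ν u),
      Lp.coeFn_sub u (mulZ ν u), coeFn_mulZ ν u] with x h1 h2 h3
    rw [hf, h1, Pi.smul_apply, h2, Pi.sub_apply, h3, smul_eq_mul, sub_mul, one_mul]
  have eA : ⇑Af =ᵐ[ν] fun x => (1 / 2 : ℂ) * ((1 + pt x) * u x) := by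
    filter_upwards [Lp.coeFn_smul (1 / 2 : ℂ) (u + mulZ ν u),
      Lp.coeFn_add u (mulZ ν u), coeFn_mulZ ν u] with x h1 h2 h3
    rw [hAf, h1, Pi.smul_apply, h2, Pi.add_apply, h3, smul_eq_mul, add_mul, one_mul]
  have hne : ∀ᵐ x ∂ν, pt x ≠ 1 := by
    have : ∀ᵐ x ∂ν, x ≠ 0 := by
      rw [ae_iff]; simpa using h0
    filter_upwards [this] with x hx h
    exact hx (pt_eq_one_iff.1 h)
  refine ⟨f, Af, ?_, ?_, ?_⟩
  · rw [← tendsto_sub_nhds_zero_iff]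
    refine tendsto_L2_zero_of_dominated (F := fun t x => (Complex.I * (t : ℂ))⁻¹ *
      ((expCayley t x - 1) * (-(Complex.I / 2) * ((1 - pt x) * u x)))
      - (1 / 2 : ℂ) * ((1 + pt x) * u x)) (g := fun x => ‖u x‖ + ‖u x‖)
      (fun t => ?_) ((Lp.memLp u).norm.add (Lp.memLp u).norm) ?_ ?_
    · filter_upwards [Lp.coeFn_sub ((Complex.I * (t : ℂ))⁻¹ • (cayleyGroup ν t f - f)) Af,
        Lp.coeFn_smul (Complex.I * (t : ℂ))⁻¹ (cayleyGroup ν t f - f),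
        Lp.coeFn_sub (cayleyGroup ν t f) f, coeFn_cayleyGroup t f, ef, eA]
        with x h1 h2 h3 h4 h5 h6
      rw [h1, Pi.sub_apply, h2, Pi.smul_apply, h3, Pi.sub_apply, h4, h5, h6, smul_eq_mul]
      ring
    · filter_upwards [self_mem_nhdsWithin] with t ht
      have ht' : (0 : ℝ) < t := ht
      filter_upwards [hne] with x hx
      have hx' : pt x - 1 ≠ 0 := sub_ne_zero.2 hx
      have b1 : ‖1 + pt x‖ ≤ 2 := by
        refine (norm_add_le _ _).trans ?_
        rw [norm_pt, norm_one]; norm_num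
      refine (norm_sub_le _ _).trans (add_le_add ?_ ?_)
      · have b2 : ‖expCayley t x - 1‖ * ‖1 - pt x‖ ≤ t * 2 := by
          have b3 := norm_expCayley_sub_one_le t x
          rw [abs_of_pos ht'] at b3
          calc ‖expCayley t x - 1‖ * ‖1 - pt x‖ ≤ t * ‖cayley x‖ * ‖1 - pt x‖ :=
                mul_le_mul_of_nonneg_right b3 (norm_nonneg _)
            _ = t * ‖1 + pt x‖ := by
                rw [mul_assoc, norm_sub_rev 1 (pt x), ← norm_mul, cayley,
                  div_mul_cancel₀ _ hx', add_comm]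
            _ ≤ t * 2 := mul_le_mul_of_nonneg_left b1 ht'.le
        have e1 : ‖(Complex.I * (t : ℂ))⁻¹ *
            ((expCayley t x - 1) * (-(Complex.I / 2) * ((1 - pt x) * u x)))‖
            = t⁻¹ * (1 / 2) * (‖expCayley t x - 1‖ * ‖1 - pt x‖) * ‖u x‖ := by
          simp only [norm_mul, norm_inv, norm_neg, norm_div, Complex.norm_I, Complex.norm_real,
            Real.norm_eq_abs, abs_of_pos ht', Complex.norm_ofNat, one_mul]
          ring
        rw [e1]
        refine (mul_le_mul_of_nonneg_right (mul_le_mul_of_nonneg_left b2 (by positivity))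
          (norm_nonneg _)).trans (le_of_eq ?_)
        field_simp
      · rw [norm_mul, norm_mul]
        have : ‖(1 / 2 : ℂ)‖ = 1 / 2 := by norm_num
        rw [this]
        nlinarith [norm_nonneg (u x)]
    · filter_upwards [hne] with x hx
      have hx' : pt x - 1 ≠ 0 := sub_ne_zero.2 hx
      have d1 : HasDerivAt (fun t : ℝ => expCayley t x) (cayley x) 0 := by
        have := (((hasDerivAt_id (0 : ℝ)).ofReal_comp).mul_const (cayley x)).cexp
        simpa [expCayley] using this
      have d2 := (hasDerivAt_iff_tendsto_slope.1 d1).mono_left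
        (nhdsWithin_mono (0 : ℝ) (fun y hy => (ne_of_gt hy : y ≠ 0)) :
          𝓝[>] (0 : ℝ) ≤ 𝓝[≠] 0)
      have d3 := ((d2.const_mul Complex.I⁻¹).mul_const
        (-(Complex.I / 2) * ((1 - pt x) * u x))).sub_const ((1 / 2 : ℂ) * ((1 + pt x) * u x))
      have e1 : Complex.I⁻¹ * cayley x * (-(Complex.I / 2) * ((1 - pt x) * u x))
          - (1 / 2 : ℂ) * ((1 + pt x) * u x) = 0 := by
        have := div_mul_cancel₀ (pt x + 1) hx'
        rw [← cayley] at this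
        have hI : Complex.I⁻¹ * Complex.I = 1 := inv_mul_cancel₀ Complex.I_ne_zero
        linear_combination (1 / 2 * cayley x * (pt x - 1) * u x) * hI + (1 / 2 * u x) * this
      rw [e1] at d3
      refine d3.congr fun t => ?_
      rw [slope_def_module, sub_zero, mul_inv, ← Complex.ofReal_inv]
      simp only [expCayley, Complex.ofReal_zero, zero_mul, Complex.exp_zero, Complex.real_smul]
      ring
  · rw [hf, hAf, smul_smul]
    have : Complex.I * -(Complex.I / 2) = 1 / 2 := by
      linear_combination (-1 / 2 : ℂ) * Complex.I_mul_I
    rw [this, ← smul_add]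
    have : u + mulZ ν u + (u - mulZ ν u) = (2 : ℂ) • u := by rw [two_smul]; abel
    rw [this, smul_smul]; norm_num
  · rw [hf, hAf, smul_smul]
    have : Complex.I * -(Complex.I / 2) = 1 / 2 := by
      linear_combination (-1 / 2 : ℂ) * Complex.I_mul_I
    rw [this, ← smul_sub]
    have : u + mulZ ν u - (u - mulZ ν u) = (2 : ℂ) • mulZ ν u := by rw [two_smul]; abel
    rw [this, smul_smul]; norm_num

end Multiplication

/-! ### Fourier coefficients and the Hardy space -/

section Hardy

theorem inner_zmon (n m : ℤ) : inner ℂ (zmon n) (zmon m) = if n = m then 1 else 0 :=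
  (orthonormal_iff_ite.1 (orthonormal_fourier (T := 1))) n m

theorem norm_zmon (n : ℤ) : ‖zmon n‖ = 1 := (orthonormal_fourier (T := 1)).1 n

theorem coeFn_zmon (n : ℤ) : ⇑(zmon n) =ᵐ[leb] fun x => fourier n x :=
  coeFn_fourierLp (T := 1) 2 n

theorem hasSum_zmon (f : L2 leb) : HasSum (fun n : ℤ => inner ℂ (zmon n) f • zmon n) f := by
  have h := (fourierBasis (T := 1)).hasSum_repr f
  simpa only [HilbertBasis.repr_apply_apply, coe_fourierBasis] using! h

theorem eq_zero_of_inner_zmon {f : L2 leb} (h : ∀ n : ℤ, inner ℂ (zmon n) f = 0) : f = 0 := by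
  have h1 := hasSum_zmon f
  simp only [h, zero_smul] at h1
  exact h1.unique hasSum_zero

theorem ext_inner_zmon {f g : L2 leb} (h : ∀ n : ℤ, inner ℂ (zmon n) f = inner ℂ (zmon n) g) :
    f = g :=
  sub_eq_zero.1 (eq_zero_of_inner_zmon fun n => by rw [inner_sub_right, h, sub_self])

theorem mulZ_zmon (n : ℤ) : mulZ leb (zmon n) = zmon (n + 1) := by
  apply Lp.ext
  filter_upwards [coeFn_mulZ leb (zmon n), coeFn_zmon n, coeFn_zmon (n + 1)] with x h1 h2 h3
  rw [h1, h2, h3, fourier_add, fourier_one, mul_comm]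
  rfl

theorem inner_zmon_mulZ (n : ℤ) (f : L2 leb) :
    inner ℂ (zmon n) (mulZ leb f) = inner ℂ (zmon (n - 1)) f := by
  have h := mulZ_zmon (n - 1)
  rw [sub_add_cancel] at h
  rw [← h, inner_mulZ_mulZ]

theorem inner_zmon_mulZEquiv_symm (n : ℤ) (f : L2 leb) :
    inner ℂ (zmon n) ((mulZEquiv leb).symm f) = inner ℂ (zmon (n + 1)) f := by
  have h := inner_zmon_mulZ (n + 1) ((mulZEquiv leb).symm f)
  rw [mulZ_mulZEquiv_symm, add_sub_cancel_right] at h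
  exact h.symm

theorem mem_H2_orthogonal {f : L2 leb} :
    f ∈ H2ᗮ ↔ ∀ n : ℤ, 0 ≤ n → inner ℂ (zmon n) f = 0 := by
  constructor
  · intro h n hn
    obtain ⟨k, rfl⟩ := Int.eq_ofNat_of_zero_le hn
    exact (Submodule.mem_orthogonal _ _).1 h _ (zmon_mem_H2 k)
  · intro h
    refine (Submodule.isClosed_orthogonal H2).mem_of_tendsto (hasSum_zmon f)
      (Eventually.of_forall fun s => H2ᗮ.sum_mem fun n _ => ?_)
    rcases lt_or_ge n 0 with hn | hn
    · refine H2ᗮ.smul_mem _ ((Submodule.mem_orthogonal' _ _).2 fun g hg => ?_)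
      exact mem_H2.1 hg n hn
    · rw [h n hn, zero_smul]
      exact H2ᗮ.zero_mem

theorem mulZEquiv_symm_mem_H2_orthogonal {f : L2 leb} (hf : f ∈ H2ᗮ) :
    (mulZEquiv leb).symm f ∈ H2ᗮ := by
  rw [mem_H2_orthogonal] at hf ⊢
  intro n hn
  rw [inner_zmon_mulZEquiv_symm]
  exact hf _ (by omega)

theorem zmon_neg_one_mem : zmon (-1) ∈ H2ᗮ := by
  rw [mem_H2_orthogonal]
  intro n hn
  rw [inner_zmon, if_neg (by omega)]

/-- The orthogonal complement of `H²` is spanned by `z̄` and `z̄ (H²)ᗮ`. -/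
theorem exists_eq_of_mem_H2_orthogonal {f : L2 leb} (hf : f ∈ H2ᗮ) :
    ∃ h ∈ H2ᗮ, f = inner ℂ (zmon (-1)) f • zmon (-1) + (mulZEquiv leb).symm h := by
  refine ⟨mulZ leb (f - inner ℂ (zmon (-1)) f • zmon (-1)), ?_, ?_⟩
  · rw [mem_H2_orthogonal] at hf ⊢
    intro n hn
    rw [inner_zmon_mulZ, inner_sub_right, inner_smul_right, inner_zmon]
    rcases eq_or_lt_of_le hn with rfl | hn'
    · simp
    · rw [if_neg (by omega), hf _ (by omega)]; simp
  · rw [mulZEquiv_symm_mulZ]; abel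

/-- The shift on `H²` is completely nonunitary. -/
theorem eq_zero_of_forall_eq_mulZ_pow {f : L2 leb}
    (h : ∀ n : ℕ, ∃ g ∈ H2, f = (mulZ leb ^ n) g) : f = 0 := by
  refine eq_zero_of_inner_zmon fun k => ?_
  obtain ⟨g, hg, rfl⟩ := h (k.toNat + 1)
  have key : ∀ (n : ℕ) (k : ℤ), inner ℂ (zmon k) ((mulZ leb ^ n) g)
      = inner ℂ (zmon (k - n)) g := by
    intro n
    induction n with
    | zero => simp
    | succ n ih =>
      intro k
      rw [pow_succ', mul_apply_eq_comp, inner_zmon_mulZ, ih]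
      push_cast
      ring_nf
  rw [key]
  exact mem_H2.1 hg _ (by push_cast; omega)

/-! ### Boundary functions of bounded analytic functions -/

/-- Taylor coefficients at the origin. -/
def taylorCoeff (h : ℂ → ℂ) (n : ℕ) : ℂ := iteratedDeriv n h 0 / (n.factorial : ℂ)

theorem inner_of_hasSum_zmon {c : ℕ → ℂ} {f : L2 leb}
    (h : HasSum (fun n : ℕ => c n • zmon (n : ℤ)) f) (k : ℕ) :
    inner ℂ (zmon (k : ℤ)) f = c k := by
  have h1 := h.mapL (innerSL ℂ (zmon (k : ℤ)))
  simp only [innerSL_apply_apply, inner_smul_right, inner_zmon, Nat.cast_inj] at h1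
  have h2 : HasSum (fun n : ℕ => c n * if k = n then (1 : ℂ) else 0) (c k) := by
    have := hasSum_single (f := fun n : ℕ => c n * if k = n then (1 : ℂ) else 0) k
      (fun n hn => by rw [if_neg (Ne.symm hn), mul_zero])
    simpa using this
  exact h1.unique h2

theorem norm_sq_of_hasSum_zmon {c : ℕ → ℂ} {f : L2 leb}
    (h : HasSum (fun n : ℕ => c n • zmon (n : ℤ)) f) :
    HasSum (fun n => ‖c n‖ ^ 2) (‖f‖ ^ 2) := by
  have h1 := h.mapL (innerSL ℂ f)
  simp only [innerSL_apply_apply, inner_smul_right] at h1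
  have h2 : ∀ n : ℕ, c n * inner ℂ f (zmon (n : ℤ)) = ((‖c n‖ ^ 2 : ℝ) : ℂ) := by
    intro n
    rw [← inner_conj_symm, inner_of_hasSum_zmon h n, Complex.mul_conj,
      Complex.normSq_eq_norm_sq]
  simp only [h2] at h1
  rw [inner_self_eq_norm_sq_to_K] at h1
  have h3 : ((RCLike.ofReal ‖f‖ : ℂ) ^ 2) = ((‖f‖ ^ 2 : ℝ) : ℂ) := by norm_cast
  rw [h3] at h1
  exact Complex.hasSum_ofReal.1 h1

theorem summable_zmon {c : ℕ → ℂ} (h : Summable fun n => ‖c n‖ ^ 2) :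
    Summable fun n : ℕ => c n • zmon (n : ℤ) := by
  have ho : Orthonormal ℂ fun n : ℕ => zmon (n : ℤ) :=
    (orthonormal_fourier (T := 1)).comp (fun n : ℕ => (n : ℤ)) Nat.cast_injective
  have := (ho.orthogonalFamily.summable_iff_norm_sq_summable c).2 h
  simpa using this

theorem hasSum_bdry {h : ℂ → ℂ} (hs : Summable fun n => ‖taylorCoeff h n‖ ^ 2) :
    HasSum (fun n : ℕ => taylorCoeff h n • zmon (n : ℤ)) (bdry h) :=
  (summable_zmon hs).hasSum

theorem inner_zmon_bdry {h : ℂ → ℂ} (hs : Summable fun n => ‖taylorCoeff h n‖ ^ 2) (n : ℕ) :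
    inner ℂ (zmon (n : ℤ)) (bdry h) = taylorCoeff h n :=
  inner_of_hasSum_zmon (hasSum_bdry hs) n

theorem hasSum_taylorCoeff {h : ℂ → ℂ} (hh : DifferentiableOn ℂ h (Metric.ball 0 1)) {z : ℂ}
    (hz : z ∈ Metric.ball (0 : ℂ) 1) : HasSum (fun n => taylorCoeff h n * z ^ n) (h z) := by
  have h1 := Complex.hasSum_taylorSeries_on_ball hh hz
  simp only [sub_zero, smul_eq_mul] at h1
  have h2 : (fun n => taylorCoeff h n * z ^ n)
      = fun n : ℕ => ((n.factorial : ℂ))⁻¹ * (z ^ n * iteratedDeriv n h 0) := by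
    funext n
    rw [taylorCoeff]
    ring
  rw [h2]
  exact h1

/-- The restriction of an analytic function to the circle of radius `r`, as a function on the unit
circle. -/
def dilation (h : ℂ → ℂ) (r : ℝ) : L2 leb :=
  ∑' n : ℕ, (taylorCoeff h n * (r : ℂ) ^ n) • zmon (n : ℤ)

theorem fourier_natCast (n : ℕ) (x : UnitAddCircle) : fourier (n : ℤ) x = pt x ^ n := by
  induction n with
  | zero => simp
  | succ n ih =>
    push_cast
    rw [fourier_add, ih, fourier_one, pow_succ]
    rfl

theorem ofReal_mul_pt_mem {r : ℝ} (h0 : 0 ≤ r) (h1 : r < 1) (x : UnitAddCircle) :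
    (r : ℂ) * pt x ∈ Metric.ball (0 : ℂ) 1 := by
  rw [mem_ball_zero_iff, norm_mul, norm_pt, mul_one, Complex.norm_real, Real.norm_eq_abs,
    abs_of_nonneg h0]
  exact h1

/-- The Fourier series of `h(r ξ)` converges absolutely, hence uniformly, to this function. -/
theorem dilation_spec {h : ℂ → ℂ} (hh : DifferentiableOn ℂ h (Metric.ball 0 1)) {r : ℝ}
    (h0 : 0 ≤ r) (h1 : r < 1) :
    HasSum (fun n : ℕ => (taylorCoeff h n * (r : ℂ) ^ n) • zmon (n : ℤ)) (dilation h r) ∧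
    ⇑(dilation h r) =ᵐ[leb] fun x => h ((r : ℂ) * pt x) := by
  have hr : (r : ℂ) ∈ Metric.ball (0 : ℂ) 1 := by
    rw [mem_ball_zero_iff, Complex.norm_real, Real.norm_eq_abs, abs_of_nonneg h0]
    exact h1
  have hs : Summable fun n : ℕ => (taylorCoeff h n * (r : ℂ) ^ n) •
      (fourier (n : ℤ) : C(UnitAddCircle, ℂ)) := by
    refine Summable.of_norm ?_
    simp only [norm_smul, fourier_norm, mul_one]
    exact (hasSum_taylorCoeff hh hr).summable.norm
  have hG := hs.hasSum
  set G := ∑' n : ℕ, (taylorCoeff h n * (r : ℂ) ^ n) • (fourier (n : ℤ) : C(UnitAddCircle, ℂ))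
  have hL := hG.mapL (ContinuousMap.toLp (E := ℂ) 2 leb ℂ)
  simp only [map_smul] at hL
  have hL' : HasSum (fun n : ℕ => (taylorCoeff h n * (r : ℂ) ^ n) • zmon (n : ℤ))
    (ContinuousMap.toLp (E := ℂ) 2 leb ℂ G) := hL
  have e1 : dilation h r = ContinuousMap.toLp (E := ℂ) 2 leb ℂ G := hL'.tsum_eq
  rw [e1]
  refine ⟨hL', ?_⟩
  filter_upwards [ContinuousMap.coeFn_toLp (p := 2) (𝕜 := ℂ) leb G] with x hx
  rw [hx]
  have e2 := ContinuousMap.hasSum_apply hG x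
  simp only [ContinuousMap.coe_smul, Pi.smul_apply, fourier_natCast, smul_eq_mul, mul_assoc,
    ← mul_pow] at e2
  exact e2.unique (hasSum_taylorCoeff hh (ofReal_mul_pt_mem h0 h1 x))

theorem norm_dilation_le {h : ℂ → ℂ} (hh : DifferentiableOn ℂ h (Metric.ball 0 1)) {M : ℝ}
    (hM : ∀ z ∈ Metric.ball (0 : ℂ) 1, ‖h z‖ ≤ M) {r : ℝ} (h0 : 0 ≤ r) (h1 : r < 1) :
    ‖dilation h r‖ ≤ M := by
  have hM0 : 0 ≤ M := (norm_nonneg _).trans (hM 0 (by simp))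
  have := Lp.norm_le_of_ae_bound (f := dilation h r) hM0 (by
    filter_upwards [(dilation_spec hh h0 h1).2] with x hx
    rw [hx]
    exact hM _ (ofReal_mul_pt_mem h0 h1 x))
  have h2 : measureUnivNNReal leb = 1 := by simp [measureUnivNNReal]
  simpa [h2] using this

theorem summable_taylorCoeff_sq {h : ℂ → ℂ} (hh : DifferentiableOn ℂ h (Metric.ball 0 1))
    {M : ℝ} (hM : ∀ z ∈ Metric.ball (0 : ℂ) 1, ‖h z‖ ≤ M) :
    Summable fun n => ‖taylorCoeff h n‖ ^ 2 := by
  refine summable_of_sum_le (c := M ^ 2) (fun n => by positivity) fun s => ?_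
  have h1 : Continuous fun r : ℝ => ∑ n ∈ s, ‖taylorCoeff h n * (r : ℂ) ^ n‖ ^ 2 := by fun_prop
  have h2 := (h1.tendsto 1).mono_left (nhdsWithin_le_nhds (s := Iio 1))
  simp only [Complex.ofReal_one, one_pow, mul_one] at h2
  refine le_of_tendsto h2 ?_
  filter_upwards [Ioo_mem_nhdsLT (zero_lt_one' ℝ)] with r hr
  refine (sum_le_hasSum s (fun n _ => by positivity)
    (norm_sq_of_hasSum_zmon (dilation_spec hh hr.1.le hr.2).1)).trans ?_
  exact pow_le_pow_left₀ (norm_nonneg _) (norm_dilation_le hh hM hr.1.le hr.2) 2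

theorem tendsto_dilation {h : ℂ → ℂ} (hh : DifferentiableOn ℂ h (Metric.ball 0 1))
    (hs : Summable fun n => ‖taylorCoeff h n‖ ^ 2) :
    Tendsto (dilation h) (𝓝[<] 1) (𝓝 (bdry h)) := by
  rw [← tendsto_sub_nhds_zero_iff, tendsto_zero_iff_norm_tendsto_zero]
  have key : ∀ r ∈ Ioo (0 : ℝ) 1, ‖dilation h r - bdry h‖ ^ 2
      = ∑' n : ℕ, ‖taylorCoeff h n * (r : ℂ) ^ n - taylorCoeff h n‖ ^ 2 := by
    intro r hr
    have h1 := (dilation_spec hh hr.1.le hr.2).1.sub (hasSum_bdry hs)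
    simp only [← sub_smul] at h1
    exact (norm_sq_of_hasSum_zmon h1).tsum_eq.symm
  have h2 : Tendsto (fun r : ℝ => ∑' n : ℕ,
      ‖taylorCoeff h n * (r : ℂ) ^ n - taylorCoeff h n‖ ^ 2) (𝓝[<] 1) (𝓝 (∑' _ : ℕ, (0 : ℝ))) := by
    refine tendsto_tsum_of_dominated_convergence hs (fun n => ?_) ?_
    · have h3 : Continuous fun r : ℝ => ‖taylorCoeff h n * (r : ℂ) ^ n - taylorCoeff h n‖ ^ 2 := by
        fun_prop
      have h4 := (h3.tendsto 1).mono_left (nhdsWithin_le_nhds (s := Iio 1))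
      simpa using h4
    · filter_upwards [Ioo_mem_nhdsLT (zero_lt_one' ℝ)] with r hr n
      have e1 : taylorCoeff h n * (r : ℂ) ^ n - taylorCoeff h n
          = taylorCoeff h n * ((r ^ n - 1 : ℝ) : ℂ) := by push_cast; ring
      have e2 : |r ^ n - 1| ≤ 1 := by
        have h3 : r ^ n ≤ 1 := pow_le_one₀ hr.1.le hr.2.le
        have h4 : 0 ≤ r ^ n := pow_nonneg hr.1.le n
        rw [abs_le]
        constructor <;> linarith
      rw [Real.norm_of_nonneg (by positivity), e1, norm_mul, Complex.norm_real, Real.norm_eq_abs]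
      exact pow_le_pow_left₀ (by positivity)
        (mul_le_of_le_one_right (norm_nonneg _) e2) 2
  rw [tsum_zero] at h2
  have h3 := h2.sqrt
  rw [Real.sqrt_zero] at h3
  refine h3.congr' ?_
  filter_upwards [Ioo_mem_nhdsLT (zero_lt_one' ℝ)] with r hr
  rw [← key r hr, Real.sqrt_sq (norm_nonneg _)]

/-- Convergence in `L²` of the dilations gives convergence almost everywhere along a sequence of radii,
which suffices to identify boundary functions without the theorem of Fatou. -/
theorem exists_seq_tendsto_bdry {h : ℂ → ℂ} (hh : DifferentiableOn ℂ h (Metric.ball 0 1))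
    (hs : Summable fun n => ‖taylorCoeff h n‖ ^ 2) :
    ∃ r : ℕ → ℝ, (∀ k, r k ∈ Ioo (0 : ℝ) 1) ∧ Tendsto r atTop (𝓝[<] 1) ∧
      ∀ᵐ x ∂leb, Tendsto (fun k => h ((r k : ℂ) * pt x)) atTop (𝓝 (bdry h x)) := by
  obtain ⟨ρ, -, hρ, hρ'⟩ := exists_seq_strictMono_tendsto' (zero_lt_one' ℝ)
  have hρ1 : Tendsto ρ atTop (𝓝[<] 1) :=
    tendsto_nhdsWithin_iff.2 ⟨hρ', Eventually.of_forall fun n => (hρ n).2⟩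
  have h1 : Tendsto (fun k => dilation h (ρ k)) atTop (𝓝 (bdry h)) :=
    (tendsto_dilation hh hs).comp hρ1
  obtain ⟨ns, hns, hae⟩ := (tendstoInMeasure_of_tendsto_Lp h1).exists_seq_tendsto_ae
  refine ⟨fun k => ρ (ns k), fun k => hρ _, hρ1.comp hns.tendsto_atTop, ?_⟩
  have h2 : ∀ᵐ x ∂leb, ∀ k, dilation h (ρ (ns k)) x = h ((ρ (ns k) : ℂ) * pt x) :=
    ae_all_iff.2 fun k => (dilation_spec hh (hρ _).1.le (hρ _).2).2
  filter_upwards [hae, h2] with x hx hx2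
  exact hx.congr hx2

/-- Radial limits, where they exist, are the values of the boundary function. -/
theorem bdry_ae_eq_of_tendsto {h : ℂ → ℂ} (hh : DifferentiableOn ℂ h (Metric.ball 0 1))
    (hs : Summable fun n => ‖taylorCoeff h n‖ ^ 2) {φ : UnitAddCircle → ℂ}
    (hφ : ∀ᵐ x ∂leb, Tendsto (fun r : ℝ => h ((r : ℂ) * pt x)) (𝓝[<] 1) (𝓝 (φ x))) :
    ⇑(bdry h) =ᵐ[leb] φ := by
  obtain ⟨r, -, hr, hae⟩ := exists_seq_tendsto_bdry hh hs
  filter_upwards [hae, hφ] with x h1 h2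
  exact tendsto_nhds_unique h1 (h2.comp hr)

theorem norm_bdry_le {h : ℂ → ℂ} (hh : DifferentiableOn ℂ h (Metric.ball 0 1)) {M : ℝ}
    (hM : ∀ z ∈ Metric.ball (0 : ℂ) 1, ‖h z‖ ≤ M) : ∀ᵐ x ∂leb, ‖bdry h x‖ ≤ M := by
  obtain ⟨r, hr, -, hae⟩ := exists_seq_tendsto_bdry hh (summable_taylorCoeff_sq hh hM)
  filter_upwards [hae] with x h1
  exact le_of_tendsto h1.norm (Eventually.of_forall fun k =>
    hM _ (ofReal_mul_pt_mem (hr k).1.le (hr k).2 x))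

end Hardy

/-! ### Power series in the disc -/

section PowerSeries

theorem hasFPowerSeriesAt_of_hasSum {c : ℕ → ℂ} {f : ℂ → ℂ}
    (h : ∀ z ∈ Metric.ball (0 : ℂ) 1, HasSum (fun n => c n * z ^ n) (f z)) :
    HasFPowerSeriesAt f (FormalMultilinearSeries.ofScalars ℂ c) 0 := by
  rw [hasFPowerSeriesAt_iff]
  filter_upwards [Metric.ball_mem_nhds (0 : ℂ) one_pos] with z hz
  simpa [FormalMultilinearSeries.coeff_ofScalars, mul_comm] using h z hz

theorem coeff_unique {c d : ℕ → ℂ} {f : ℂ → ℂ}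
    (hc : ∀ z ∈ Metric.ball (0 : ℂ) 1, HasSum (fun n => c n * z ^ n) (f z))
    (hd : ∀ z ∈ Metric.ball (0 : ℂ) 1, HasSum (fun n => d n * z ^ n) (f z)) (n : ℕ) :
    c n = d n := by
  have h := (hasFPowerSeriesAt_of_hasSum hc).eq_formalMultilinearSeries
    (hasFPowerSeriesAt_of_hasSum hd)
  have h2 := congrArg (fun p => FormalMultilinearSeries.coeff p n) h
  simpa [FormalMultilinearSeries.coeff_ofScalars] using h2

/-- A power series with bounded coefficients is analytic in the unit disc. -/
theorem differentiableOn_of_hasSum {c : ℕ → ℂ} {C : ℝ} (hC : ∀ n, ‖c n‖ ≤ C) {f : ℂ → ℂ}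
    (h : ∀ z ∈ Metric.ball (0 : ℂ) 1, HasSum (fun n => c n * z ^ n) (f z)) :
    DifferentiableOn ℂ f (Metric.ball 0 1) := by
  set p := FormalMultilinearSeries.ofScalars ℂ c
  have hr : ((1 : NNReal) : ENNReal) ≤ p.radius := by
    refine p.le_radius_of_bound C fun n => ?_
    rw [FormalMultilinearSeries.ofScalars_norm]
    simpa using hC n
  have hp : HasFPowerSeriesOnBall f p 0 1 := by
    refine ⟨by simpa using hr, one_pos, fun {y} hy => ?_⟩
    have hy' : y ∈ Metric.ball (0 : ℂ) 1 := by
      rw [← ENNReal.ofReal_one, Metric.eball_ofReal] at hy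
      exact hy
    have := h y hy'
    rw [zero_add]
    simpa [p, FormalMultilinearSeries.ofScalars_apply_eq, mul_comm] using this
  have := hp.differentiableOn
  rwa [← ENNReal.ofReal_one, Metric.eball_ofReal] at this

end PowerSeries

/-! ### The Herglotz integral and the inner function of a singular measure -/

section Herglotz

variable (μ : Measure UnitAddCircle) [IsFiniteMeasure μ]

theorem one_sub_norm_le (x : UnitAddCircle) (z : ℂ) : 1 - ‖z‖ ≤ ‖pt x - z‖ := by
  have := norm_sub_norm_le (pt x) z
  rwa [norm_pt] at this

theorem pt_sub_ne_zero (x : UnitAddCircle) {z : ℂ} (hz : z ∈ Metric.ball (0 : ℂ) 1) :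
    pt x - z ≠ 0 := by
  rw [mem_ball_zero_iff] at hz
  have := one_sub_norm_le x z
  exact norm_pos_iff.1 (by linarith)

theorem pt_ne_zero (x : UnitAddCircle) : pt x ≠ 0 := by
  rw [← norm_pos_iff, norm_pt]; exact one_pos

theorem integrable_of_continuous {f : UnitAddCircle → ℂ} (hf : Continuous f) : Integrable f μ :=
  hf.integrable_of_hasCompactSupport (HasCompactSupport.of_compactSpace f)

theorem continuous_herglotz_kernel {z : ℂ} (hz : z ∈ Metric.ball (0 : ℂ) 1) :
    Continuous fun x => (pt x + z) / (pt x - z) :=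
  (continuous_pt.add continuous_const).div (continuous_pt.sub continuous_const)
    fun x => pt_sub_ne_zero x hz

/-- The moments `∫ ξⁿ dμ(ξ)`. -/
def moment (n : ℕ) : ℂ := ∫ x, pt x ^ n ∂μ

theorem moment_zero : moment μ 0 = ((μ.real univ : ℝ) : ℂ) := by simp [moment]

/-- The Taylor coefficients of the Herglotz integral. -/
def herglotzCoeff (n : ℕ) : ℂ :=
  2 * (starRingEnd ℂ) (moment μ n) - if n = 0 then ((μ.real univ : ℝ) : ℂ) else 0

/-- The expansion `(ξ + z) / (ξ - z) = 1 + 2 ∑ ξ̄ⁿ zⁿ`, integrated termwise. -/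
theorem hasSum_herglotz {z : ℂ} (hz : z ∈ Metric.ball (0 : ℂ) 1) :
    HasSum (fun n => herglotzCoeff μ n * z ^ n) (herglotz μ z) := by
  have hz1 : ‖z‖ < 1 := by rwa [mem_ball_zero_iff] at hz
  have h1 : HasSum (fun n => ∫ x, (2 * (starRingEnd ℂ) (pt x ^ n) - if n = 0 then 1 else 0) * z ^ n
      ∂μ) (herglotz μ z) := by
    refine hasSum_integral_of_dominated_convergence (fun n _ => 3 * ‖z‖ ^ n) (fun n => ?_)
      (fun n => ?_) ?_ ?_ ?_
    · refine Continuous.aestronglyMeasurable ?_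
      have : Continuous fun x => (starRingEnd ℂ) (pt x ^ n) :=
        Complex.continuous_conj.comp (continuous_pt.pow n)
      fun_prop
    · refine Eventually.of_forall fun x => ?_
      rw [norm_mul, norm_pow]
      refine mul_le_mul_of_nonneg_right ?_ (by positivity)
      refine (norm_sub_le _ _).trans ?_
      have h2 : ‖(2 : ℂ) * (starRingEnd ℂ) (pt x ^ n)‖ = 2 := by
        rw [norm_mul, RCLike.norm_conj, norm_pow, norm_pt]; norm_num
      have h3 : ‖(if n = 0 then (1 : ℂ) else 0)‖ ≤ 1 := by split_ifs <;> simp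
      linarith
    · exact Eventually.of_forall fun x =>
        (summable_geometric_of_lt_one (norm_nonneg z) hz1).mul_left 3
    · exact integrable_const _
    · refine Eventually.of_forall fun x => ?_
      have hw : ‖(starRingEnd ℂ) (pt x) * z‖ < 1 := by
        rw [norm_mul, RCLike.norm_conj, norm_pt, one_mul]; exact hz1
      have h2 := ((hasSum_geometric_of_norm_lt_one hw).mul_left 2).sub
        (hasSum_ite_eq (0 : ℕ) (1 : ℂ))
      have e1 : 2 * (1 - (starRingEnd ℂ) (pt x) * z)⁻¹ - 1 = (pt x + z) / (pt x - z) := by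
        have h3 : 1 - (starRingEnd ℂ) (pt x) * z = (starRingEnd ℂ) (pt x) * (pt x - z) := by
          rw [mul_sub, mul_comm _ (pt x), pt_mul_conj]
        have h4 := pt_sub_ne_zero x hz
        have h5 : ((starRingEnd ℂ) (pt x))⁻¹ = pt x :=
          inv_eq_of_mul_eq_one_left (pt_mul_conj x)
        rw [h3, mul_inv, h5, eq_div_iff h4]
        field_simp
        ring
      rw [e1] at h2
      refine HasSum.congr_fun (h2) fun n => ?_
      rw [sub_mul, mul_assoc, map_pow, mul_pow]
      congr 1
      split_ifs with h
      · simp [h]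
      · simp
  refine HasSum.congr_fun (h1) fun n => ?_
  rw [integral_mul_const, integral_sub, integral_const_mul, integral_conj, herglotzCoeff, moment]
  · split_ifs <;> simp
  · exact (integrable_of_continuous μ
      (Complex.continuous_conj.comp (continuous_pt.pow n))).const_mul 2
  · exact integrable_const _

theorem norm_moment_le (n : ℕ) : ‖moment μ n‖ ≤ μ.real univ := by
  have := norm_integral_le_of_norm_le_const (μ := μ) (f := fun x => pt x ^ n) (C := 1)
    (Eventually.of_forall fun x => by rw [norm_pow, norm_pt, one_pow])
  simpa [moment] using this

theorem differentiableOn_herglotz : DifferentiableOn ℂ (herglotz μ) (Metric.ball 0 1) := by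
  refine differentiableOn_of_hasSum (C := 3 * μ.real univ) (fun n => ?_)
    fun z hz => hasSum_herglotz μ hz
  refine (norm_sub_le _ _).trans ?_
  have h1 := norm_moment_le μ n
  have h2 : ‖(2 : ℂ) * (starRingEnd ℂ) (moment μ n)‖ = 2 * ‖moment μ n‖ := by
    rw [norm_mul, RCLike.norm_conj]; norm_num
  have h3 : ‖(if n = 0 then ((μ.real univ : ℝ) : ℂ) else 0)‖ ≤ μ.real univ := by
    split_ifs
    · rw [Complex.norm_real, Real.norm_of_nonneg measureReal_nonneg]
    · simp
  linarith

theorem herglotz_zero : herglotz μ 0 = ((μ.real univ : ℝ) : ℂ) := by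
  have : ∀ x : UnitAddCircle, (pt x + 0) / (pt x - 0) = 1 := fun x => by
    rw [add_zero, sub_zero, div_self (pt_ne_zero x)]
  rw [herglotz]
  simp only [this]
  simp

/-- The real part of the Herglotz integral is the Poisson integral. -/
theorem re_herglotz {z : ℂ} (hz : z ∈ Metric.ball (0 : ℂ) 1) :
    (herglotz μ z).re = ∫ x, (1 - ‖z‖ ^ 2) / ‖pt x - z‖ ^ 2 ∂μ := by
  have h := integral_re (𝕜 := ℂ) (integrable_of_continuous μ (continuous_herglotz_kernel hz))
  have h' : (herglotz μ z).re = ∫ x, ((pt x + z) / (pt x - z)).re ∂μ := h.symm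
  rw [h']
  congr 1
  ext x
  have h1 := norm_pt x
  have h2 : (pt x).re ^ 2 + (pt x).im ^ 2 = 1 := by
    have := Complex.normSq_eq_norm_sq (pt x)
    rw [h1, Complex.normSq_apply] at this
    nlinarith
  rw [Complex.div_re, ← Complex.normSq_eq_norm_sq, ← Complex.normSq_eq_norm_sq, ← add_div]
  congr 1
  simp only [Complex.normSq_apply, Complex.add_re, Complex.add_im, Complex.sub_re, Complex.sub_im]
  linear_combination h2

theorem re_herglotz_nonneg {z : ℂ} (hz : z ∈ Metric.ball (0 : ℂ) 1) : 0 ≤ (herglotz μ z).re := by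
  rw [re_herglotz μ hz]
  refine integral_nonneg fun x => ?_
  rw [mem_ball_zero_iff] at hz
  have : 0 ≤ 1 - ‖z‖ ^ 2 := by nlinarith [norm_nonneg z]
  positivity

theorem one_le_norm_herglotz_add_one {z : ℂ} (hz : z ∈ Metric.ball (0 : ℂ) 1) :
    1 ≤ ‖herglotz μ z + 1‖ := by
  have h1 := Complex.re_le_norm (herglotz μ z + 1)
  have h2 := re_herglotz_nonneg μ hz
  rw [Complex.add_re, Complex.one_re] at h1
  linarith

theorem herglotz_add_one_ne_zero {z : ℂ} (hz : z ∈ Metric.ball (0 : ℂ) 1) :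
    herglotz μ z + 1 ≠ 0 :=
  norm_pos_iff.1 (by linarith [one_le_norm_herglotz_add_one μ hz])

theorem one_sub_clarkFn {z : ℂ} (hz : z ∈ Metric.ball (0 : ℂ) 1) :
    1 - clarkFn μ z = 2 / (herglotz μ z + 1) := by
  have := herglotz_add_one_ne_zero μ hz
  rw [clarkFn]
  field_simp
  ring

theorem one_sub_clarkFn_ne_zero {z : ℂ} (hz : z ∈ Metric.ball (0 : ℂ) 1) :
    1 - clarkFn μ z ≠ 0 := by
  rw [one_sub_clarkFn μ hz]
  exact div_ne_zero two_ne_zero (herglotz_add_one_ne_zero μ hz)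

theorem clark_formula {z : ℂ} (hz : z ∈ Metric.ball (0 : ℂ) 1) :
    (1 + clarkFn μ z) / (1 - clarkFn μ z) = herglotz μ z := by
  have := herglotz_add_one_ne_zero μ hz
  rw [one_sub_clarkFn μ hz, clarkFn]
  field_simp
  ring

theorem differentiableOn_clarkFn : DifferentiableOn ℂ (clarkFn μ) (Metric.ball 0 1) :=
  ((differentiableOn_herglotz μ).sub_const 1).div ((differentiableOn_herglotz μ).add_const 1)
    fun _ hz => herglotz_add_one_ne_zero μ hz

theorem one_sub_norm_clarkFn_sq {z : ℂ} (hz : z ∈ Metric.ball (0 : ℂ) 1) :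
    1 - ‖clarkFn μ z‖ ^ 2 = 4 * (herglotz μ z).re / ‖herglotz μ z + 1‖ ^ 2 := by
  have h1 : ‖herglotz μ z + 1‖ ≠ 0 := norm_ne_zero_iff.2 (herglotz_add_one_ne_zero μ hz)
  rw [clarkFn, norm_div, div_pow, eq_div_iff (pow_ne_zero 2 h1), sub_mul,
    div_mul_cancel₀ _ (pow_ne_zero 2 h1), ← Complex.normSq_eq_norm_sq,
    ← Complex.normSq_eq_norm_sq]
  simp only [Complex.normSq_apply, Complex.add_re, Complex.add_im, Complex.sub_re, Complex.sub_im,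
    Complex.one_re, Complex.one_im]
  ring

theorem norm_clarkFn_le {z : ℂ} (hz : z ∈ Metric.ball (0 : ℂ) 1) : ‖clarkFn μ z‖ ≤ 1 := by
  have h1 := one_sub_norm_clarkFn_sq μ hz
  have h2 := re_herglotz_nonneg μ hz
  have h3 : 0 ≤ 4 * (herglotz μ z).re / ‖herglotz μ z + 1‖ ^ 2 := by positivity
  nlinarith [norm_nonneg (clarkFn μ z)]

theorem one_sub_norm_clarkFn_sq_le {z : ℂ} (hz : z ∈ Metric.ball (0 : ℂ) 1) :
    1 - ‖clarkFn μ z‖ ^ 2 ≤ 4 * (herglotz μ z).re := by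
  rw [one_sub_norm_clarkFn_sq μ hz]
  have h2 := re_herglotz_nonneg μ hz
  have h3 := one_le_norm_herglotz_add_one μ hz
  exact div_le_self (by positivity) (by nlinarith)

/-! ### The recursion for the moments -/

theorem clarkFn_zero : clarkFn μ 0 = (((μ.real univ - 1) / (μ.real univ + 1) : ℝ) : ℂ) := by
  rw [clarkFn, herglotz_zero]
  push_cast
  rfl

theorem taylorCoeff_zero (h : ℂ → ℂ) : taylorCoeff h 0 = h 0 := by
  simp [taylorCoeff]

/-- Comparison of the Taylor coefficients in `F (1 - θ) = 1 + θ`, where `F` is the Herglotz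
integral. -/
theorem moment_recursion {n : ℕ} (hn : n ≠ 0) :
    (starRingEnd ℂ) (moment μ n) * (1 - clarkFn μ 0) =
      (∑ k ∈ Finset.range n, (starRingEnd ℂ) (moment μ k) * taylorCoeff (clarkFn μ) (n - k))
        - clarkFn μ 0 / (1 - clarkFn μ 0) * taylorCoeff (clarkFn μ) n := by
  set t := taylorCoeff (clarkFn μ) with ht
  have hθ : ∀ z ∈ Metric.ball (0 : ℂ) 1, HasSum (fun n => t n * z ^ n) (clarkFn μ z) :=
    fun z hz => hasSum_taylorCoeff (differentiableOn_clarkFn μ) hz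
  have hF := fun z hz => hasSum_herglotz μ (z := z) hz
  have h1 : ∀ z ∈ Metric.ball (0 : ℂ) 1, HasSum (fun n => (herglotzCoeff μ n -
      ∑ k ∈ Finset.range (n + 1), herglotzCoeff μ k * t (n - k)) * z ^ n)
      (1 + clarkFn μ z) := by
    intro z hz
    have h2 := hasSum_sum_range_mul_of_summable_norm (hF z hz).summable.norm
      (hθ z hz).summable.norm
    rw [(hF z hz).tsum_eq, (hθ z hz).tsum_eq] at h2
    have h3 := (hF z hz).sub h2
    have e1 : herglotz μ z - herglotz μ z * clarkFn μ z = 1 + clarkFn μ z := by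
      have := clark_formula μ hz
      rw [div_eq_iff (one_sub_clarkFn_ne_zero μ hz)] at this
      linear_combination -this
    rw [e1] at h3
    refine HasSum.congr_fun (h3) fun n => ?_
    rw [sub_mul, Finset.sum_mul]
    congr 1
    refine Finset.sum_congr rfl fun k hk => ?_
    have : n = k + (n - k) := by have := Finset.mem_range.1 hk; omega
    nth_rewrite 2 [this]
    rw [pow_add]
    ring
  have h2 : ∀ z ∈ Metric.ball (0 : ℂ) 1, HasSum (fun n => ((if n = 0 then 1 else 0) + t n) * z ^ n)
      (1 + clarkFn μ z) := by
    intro z hz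
    refine HasSum.congr_fun (((hasSum_ite_eq (0 : ℕ) (1 : ℂ)).add (hθ z hz))) fun n => ?_
    rw [add_mul]
    congr 1
    split_ifs with h <;> simp [h]
  have h3 := coeff_unique h1 h2 n
  obtain ⟨k, rfl⟩ := Nat.exists_eq_succ_of_ne_zero hn
  rw [if_neg hn, Finset.sum_range_succ, Nat.sub_self, zero_add] at h3
  have h4 : ∀ j ∈ Finset.range k, herglotzCoeff μ (j + 1) * t (k.succ - (j + 1))
      = 2 * ((starRingEnd ℂ) (moment μ (j + 1)) * t (k.succ - (j + 1))) := by
    intro j _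
    rw [herglotzCoeff, if_neg (Nat.succ_ne_zero j)]
    ring
  rw [Finset.sum_range_succ', Finset.sum_congr rfl h4, ← Finset.mul_sum] at h3
  rw [Finset.sum_range_succ']
  have h5 : t 0 = clarkFn μ 0 := taylorCoeff_zero _
  have h6 : herglotzCoeff μ k.succ = 2 * (starRingEnd ℂ) (moment μ k.succ) := by
    rw [herglotzCoeff, if_neg hn, sub_zero]
  have h7 : herglotzCoeff μ 0 = ((μ.real univ : ℝ) : ℂ) := by
    rw [herglotzCoeff, if_pos rfl, moment_zero, Complex.conj_ofReal]; ring
  have h8 : (starRingEnd ℂ) (moment μ 0) = ((μ.real univ : ℝ) : ℂ) := by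
    rw [moment_zero, Complex.conj_ofReal]
  rw [h5, h6, h7] at h3
  rw [h8]
  have h9 : clarkFn μ 0 / (1 - clarkFn μ 0) = (((μ.real univ : ℝ) : ℂ) - 1) / 2 := by
    have h10 : ((μ.real univ : ℝ) : ℂ) + 1 ≠ 0 := by
      have : (0 : ℝ) < μ.real univ + 1 := by positivity
      exact_mod_cast this.ne'
    rw [one_sub_clarkFn μ (by simp), clarkFn, herglotz_zero]
    field_simp
  rw [h9]
  linear_combination (1 / 2 : ℂ) * h3

/-- The Taylor series of `g` is that of `θ`, shifted and divided by `1 - θ(0)`. -/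
theorem taylorCoeff_clarkG (n : ℕ) :
    taylorCoeff (clarkG μ) n = taylorCoeff (clarkFn μ) (n + 1) / (1 - clarkFn μ 0) := by
  have hθ := differentiableOn_clarkFn μ
  have hg : DifferentiableOn ℂ (clarkG μ) (Metric.ball 0 1) :=
    ((Complex.differentiableOn_dslope (Metric.ball_mem_nhds 0 one_pos)).2 hθ).div_const _
  refine coeff_unique (d := fun n => taylorCoeff (clarkFn μ) (n + 1) / (1 - clarkFn μ 0))
    (fun z hz => hasSum_taylorCoeff hg hz) (fun z hz => ?_) n
  have h1 := hasSum_taylorCoeff hθ hz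
  have h2 : HasSum (fun n => taylorCoeff (clarkFn μ) (n + 1) * z ^ n)
      (dslope (clarkFn μ) 0 z) := by
    by_cases hz0 : z = 0
    · subst hz0
      rw [dslope_same]
      have h3 := hasSum_single (f := fun n => taylorCoeff (clarkFn μ) (n + 1) * (0 : ℂ) ^ n) 0
        (fun n hn => by simp [hn])
      simpa [taylorCoeff] using h3
    · rw [dslope_of_ne _ hz0, slope_def_field, sub_zero, div_eq_mul_inv]
      have h3 := (hasSum_nat_add_iff' 1).2 h1
      simp only [Finset.range_one, Finset.sum_singleton, pow_zero, mul_one, taylorCoeff_zero] at h3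
      refine HasSum.congr_fun ((h3.mul_right z⁻¹)) fun n => ?_
      rw [pow_succ]
      field_simp
  refine HasSum.congr_fun ((h2.div_const _)) fun n => ?_
  ring

end Herglotz

/-! ### The function of a singular measure is inner -/

section Inner

theorem norm_sq_eq_integral (f : L2 leb) : ‖f‖ ^ 2 = ∫ x, ‖f x‖ ^ 2 ∂leb := by
  have h1 : inner ℂ f f = ∫ x, inner ℂ (f x) (f x) ∂leb := L2.inner_def f f
  have h2 : ∀ x, inner ℂ (f x) (f x) = ((‖f x‖ ^ 2 : ℝ) : ℂ) := fun x => by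
    rw [inner_self_eq_norm_sq_to_K]; norm_cast
  simp only [h2] at h1
  have h3 : ∫ x, ((‖f x‖ ^ 2 : ℝ) : ℂ) ∂leb = ((∫ x, ‖f x‖ ^ 2 ∂leb : ℝ) : ℂ) := integral_ofReal
  rw [inner_self_eq_norm_sq_to_K, h3] at h1
  have h4 : (RCLike.ofReal ‖f‖ : ℂ) ^ 2 = ((‖f‖ ^ 2 : ℝ) : ℂ) := by norm_cast
  rw [h4] at h1
  exact Complex.ofReal_injective h1

variable (μ : Measure UnitAddCircle) [IsFiniteMeasure μ]

/-- The Poisson integral of a measure tends to zero radially off a closed set that carries the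
measure. -/
theorem tendsto_re_herglotz_restrict {K : Set UnitAddCircle} (hK : IsClosed K)
    {x : UnitAddCircle} (hx : x ∉ K) :
    Tendsto (fun r : ℝ => (herglotz (μ.restrict K) ((r : ℂ) * pt x)).re) (𝓝[<] 1) (𝓝 0) := by
  obtain ⟨δ, hδ, hδ'⟩ : ∃ δ : ℝ, 0 < δ ∧ ∀ y ∈ K, δ ≤ ‖pt y - pt x‖ := by
    rcases K.eq_empty_or_nonempty with rfl | hne
    · exact ⟨1, one_pos, by simp⟩
    · have hc : Continuous fun y => ‖pt y - pt x‖ := (continuous_pt.sub continuous_const).norm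
      obtain ⟨y, hy, hmin⟩ := hK.isCompact.exists_isMinOn hne hc.continuousOn
      refine ⟨‖pt y - pt x‖, norm_pos_iff.2 (sub_ne_zero.2 fun h => hx ?_), fun z hz => hmin hz⟩
      have : y = x := AddCircle.injective_toCircle (T := 1) one_ne_zero (Subtype.ext h)
      rwa [this] at hy
  have hlim : Tendsto (fun r : ℝ => (1 - r ^ 2) / (δ / 2) ^ 2 * (μ.restrict K).real univ)
      (𝓝[<] 1) (𝓝 0) := by
    have hc : Continuous fun r : ℝ => (1 - r ^ 2) / (δ / 2) ^ 2 * (μ.restrict K).real univ := by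
      fun_prop
    have := (hc.tendsto 1).mono_left (nhdsWithin_le_nhds (s := Iio 1))
    simpa using this
  refine squeeze_zero' ?_ ?_ hlim
  · filter_upwards [Ioo_mem_nhdsLT (zero_lt_one' ℝ)] with r hr
    exact re_herglotz_nonneg _ (ofReal_mul_pt_mem hr.1.le hr.2 x)
  · have h1 : max 0 (1 - δ / 2) < 1 := max_lt one_pos (by linarith)
    filter_upwards [Ioo_mem_nhdsLT h1] with r hr
    have hr0 : 0 < r := (le_max_left _ _).trans_lt hr.1
    have hr1 : 1 - δ / 2 < r := (le_max_right _ _).trans_lt hr.1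
    have hz := ofReal_mul_pt_mem hr0.le hr.2 x
    have hnz : ‖(r : ℂ) * pt x‖ = r := by
      rw [norm_mul, norm_pt, mul_one, Complex.norm_real, Real.norm_of_nonneg hr0.le]
    rw [re_herglotz _ hz, hnz]
    refine (Real.le_norm_self _).trans ?_
    refine norm_integral_le_of_norm_le_const ?_
    filter_upwards [ae_restrict_mem hK.measurableSet] with y hy
    have h2 : δ / 2 ≤ ‖pt y - (r : ℂ) * pt x‖ := by
      have h3 : ‖pt y - pt x‖ ≤ ‖pt y - (r : ℂ) * pt x‖ + ‖(r : ℂ) * pt x - pt x‖ := by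
        simpa using norm_sub_le_norm_sub_add_norm_sub (pt y) ((r : ℂ) * pt x) (pt x)
      have h4 : ‖(r : ℂ) * pt x - pt x‖ = 1 - r := by
        have : (r : ℂ) * pt x - pt x = ((r - 1 : ℝ) : ℂ) * pt x := by push_cast; ring
        rw [this, norm_mul, norm_pt, mul_one, Complex.norm_real, Real.norm_eq_abs,
          abs_of_neg (by linarith [hr.2])]
        ring
      have := hδ' y hy
      linarith
    have h5 : 0 ≤ 1 - r ^ 2 := by nlinarith [hr.2]
    rw [Real.norm_of_nonneg (by positivity)]
    exact div_le_div_of_nonneg_left h5 (by positivity) (pow_le_pow_left₀ (by positivity) h2 2)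

theorem continuous_herglotz_radial {r : ℝ} (h0 : 0 ≤ r) (h1 : r < 1) :
    Continuous fun x => herglotz μ ((r : ℂ) * pt x) :=
  (differentiableOn_herglotz μ).continuousOn.comp_continuous
    (continuous_const.mul continuous_pt) fun x => ofReal_mul_pt_mem h0 h1 x

/-- The mean value over a circle of the Poisson integral of `μ` is the mass of `μ`. -/
theorem integral_re_herglotz {r : ℝ} (h0 : 0 ≤ r) (h1 : r < 1) :
    ∫ x, (herglotz μ ((r : ℂ) * pt x)).re ∂leb = μ.real univ := by
  have hd := dilation_spec (differentiableOn_herglotz μ) h0 h1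
  have e1 : inner ℂ (zmon 0) (dilation (herglotz μ) r) = ((μ.real univ : ℝ) : ℂ) := by
    have := inner_of_hasSum_zmon hd.1 0
    simpa [taylorCoeff_zero, herglotz_zero] using this
  have e2 : inner ℂ (zmon 0) (dilation (herglotz μ) r)
      = ∫ x, herglotz μ ((r : ℂ) * pt x) ∂leb := by
    rw [L2.inner_def]
    refine integral_congr_ae ?_
    filter_upwards [hd.2, coeFn_zmon 0] with x h1 h2
    rw [h1, h2]
    simp
  rw [e1] at e2
  have h := integral_re (𝕜 := ℂ) (integrable_of_continuous leb (continuous_herglotz_radial μ h0 h1))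
  have h' : ∫ x, (herglotz μ ((r : ℂ) * pt x)).re ∂leb
      = (∫ x, herglotz μ ((r : ℂ) * pt x) ∂leb).re := h
  rw [h', ← e2, Complex.ofReal_re]

theorem summable_clarkFn : Summable fun n => ‖taylorCoeff (clarkFn μ) n‖ ^ 2 :=
  summable_taylorCoeff_sq (differentiableOn_clarkFn μ) fun _ hz => norm_clarkFn_le μ hz

/-- A singular measure is carried, up to a part of mass at most `ε`, by a compact Lebesgue null
set. On the circles of radius `r → 1` the Poisson integral of the first part tends to zero almost
everywhere and that of the second part has mean value at most `ε`. -/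
theorem one_sub_le_norm_bdry_sq (hμ : μ ⟂ₘ leb) {ε : ℝ} (hε : 0 < ε) :
    1 - 4 * ε ≤ ‖bdry (clarkFn μ)‖ ^ 2 := by
  obtain ⟨s, hs, hs1, hs2⟩ := hμ
  obtain ⟨K, hKs, hK, hKε⟩ := hs.compl.exists_isClosed_sdiff_lt (μ := μ) (measure_ne_top μ _)
    (ε := ENNReal.ofReal ε) (by simpa using hε)
  have hK0 : leb K = 0 := measure_mono_null hKs hs2
  have hKc : μ.real Kᶜ ≤ ε := by
    refine ENNReal.toReal_le_of_le_ofReal hε.le ?_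
    have h1 : Kᶜ ⊆ s ∪ (sᶜ \ K) := fun x hx => by
      by_cases h : x ∈ s
      · exact Or.inl h
      · exact Or.inr ⟨h, hx⟩
    refine (measure_mono h1).trans ((measure_union_le _ _).trans ?_)
    rw [hs1, zero_add]
    exact hKε.le
  set μ₁ := μ.restrict K
  set μ₂ := μ.restrict Kᶜ
  have hadd : ∀ z ∈ Metric.ball (0 : ℂ) 1, herglotz μ z = herglotz μ₁ z + herglotz μ₂ z :=
    fun z hz => (integral_add_compl hK.measurableSet
      (integrable_of_continuous μ (continuous_herglotz_kernel hz))).symm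
  -- `1 - |θ|²` is bounded by `1` and by four times the Poisson integral; the truncation `u` of the
  -- contribution of `μ₁` makes dominated convergence applicable.
  set u : ℝ → UnitAddCircle → ℝ := fun r x => min 1 (4 * (herglotz μ₁ ((r : ℂ) * pt x)).re)
  have hu0 : ∀ r ∈ Ioo (0 : ℝ) 1, ∀ x, 0 ≤ u r x := fun r hr x =>
    le_min zero_le_one (mul_nonneg (by norm_num)
      (re_herglotz_nonneg _ (ofReal_mul_pt_mem hr.1.le hr.2 x)))
  have huc : ∀ r ∈ Ioo (0 : ℝ) 1, Continuous (u r) := fun r hr =>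
    continuous_const.min (continuous_const.mul
      (Complex.continuous_re.comp (continuous_herglotz_radial μ₁ hr.1.le hr.2)))
  have hint : ∀ {v : UnitAddCircle → ℝ}, Continuous v → Integrable v leb := fun hv =>
    hv.integrable_of_hasCompactSupport (HasCompactSupport.of_compactSpace _)
  have key : ∀ r ∈ Ioo (0 : ℝ) 1,
      1 - (∫ x, u r x ∂leb) - 4 * ε ≤ ‖dilation (clarkFn μ) r‖ ^ 2 := by
    intro r hr
    have hP2 : Continuous fun x => (herglotz μ₂ ((r : ℂ) * pt x)).re :=
      Complex.continuous_re.comp (continuous_herglotz_radial μ₂ hr.1.le hr.2)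
    have hc : Continuous fun x => clarkFn μ ((r : ℂ) * pt x) :=
      (differentiableOn_clarkFn μ).continuousOn.comp_continuous
        (continuous_const.mul continuous_pt) fun x => ofReal_mul_pt_mem hr.1.le hr.2 x
    have e1 : ‖dilation (clarkFn μ) r‖ ^ 2 = ∫ x, ‖clarkFn μ ((r : ℂ) * pt x)‖ ^ 2 ∂leb := by
      rw [norm_sq_eq_integral]
      refine integral_congr_ae ?_
      filter_upwards [(dilation_spec (differentiableOn_clarkFn μ) hr.1.le hr.2).2] with x hx
      rw [hx]
    have e2 : ∫ x, (1 - u r x - 4 * (herglotz μ₂ ((r : ℂ) * pt x)).re) ∂leb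
        = 1 - (∫ x, u r x ∂leb) - 4 * μ.real Kᶜ := by
      have hi : Integrable (fun x => 1 - u r x) leb := (integrable_const _).sub (hint (huc r hr))
      rw [integral_sub hi ((hint hP2).const_mul 4), integral_sub (integrable_const _) (hint (huc r hr)),
        integral_const_mul, integral_re_herglotz μ₂ hr.1.le hr.2]
      simp [μ₂]
    have h3 : ∫ x, (1 - u r x - 4 * (herglotz μ₂ ((r : ℂ) * pt x)).re) ∂leb
        ≤ ∫ x, ‖clarkFn μ ((r : ℂ) * pt x)‖ ^ 2 ∂leb := by
      refine integral_mono (((integrable_const _).sub (hint (huc r hr))).sub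
        ((hint hP2).const_mul 4)) (hint (hc.norm.pow 2)) fun x => ?_
      have hz := ofReal_mul_pt_mem hr.1.le hr.2 x
      have h4 := one_sub_norm_clarkFn_sq_le μ hz
      rw [hadd _ hz, Complex.add_re] at h4
      have h5 := re_herglotz_nonneg μ₂ hz
      have h6 : 0 ≤ ‖clarkFn μ ((r : ℂ) * pt x)‖ ^ 2 := by positivity
      simp only [u]
      rcases le_total 1 (4 * (herglotz μ₁ ((r : ℂ) * pt x)).re) with h | h
      · rw [min_eq_left h]; linarith
      · rw [min_eq_right h]; linarith
    rw [e1]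
    rw [e2] at h3
    linarith
  have hlim1 : Tendsto (fun r => ∫ x, u r x ∂leb) (𝓝[<] 1) (𝓝 (∫ _, (0 : ℝ) ∂leb)) := by
    refine tendsto_integral_filter_of_dominated_convergence (fun _ => 1) ?_ ?_
      (integrable_const _) ?_
    · filter_upwards [Ioo_mem_nhdsLT (zero_lt_one' ℝ)] with r hr
      exact (huc r hr).aestronglyMeasurable
    · filter_upwards [Ioo_mem_nhdsLT (zero_lt_one' ℝ)] with r hr
      refine Eventually.of_forall fun x => ?_
      rw [Real.norm_of_nonneg (hu0 r hr x)]
      exact min_le_left _ _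
    · have : ∀ᵐ x ∂leb, x ∉ K := measure_eq_zero_iff_ae_notMem.1 hK0
      filter_upwards [this] with x hx
      have h1 := (tendsto_const_nhds (x := (1 : ℝ))).min
        ((tendsto_re_herglotz_restrict μ hK hx).const_mul 4)
      simpa using h1
  rw [integral_zero] at hlim1
  have hlim2 := ((tendsto_const_nhds (x := (1 : ℝ))).sub hlim1).sub_const (4 * ε)
  rw [sub_zero] at hlim2
  have hlim3 := (tendsto_dilation (differentiableOn_clarkFn μ) (summable_clarkFn μ)).norm.pow 2
  refine le_of_tendsto_of_tendsto hlim2 hlim3 ?_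
  filter_upwards [Ioo_mem_nhdsLT (zero_lt_one' ℝ)] with r hr
  exact key r hr

/-- The norm of the boundary function is one, while its values are bounded by one. -/
theorem norm_bdry_clarkFn (hμ : μ ⟂ₘ leb) : ∀ᵐ x ∂leb, ‖bdry (clarkFn μ) x‖ = 1 := by
  have h1 : 1 ≤ ‖bdry (clarkFn μ)‖ ^ 2 := by
    refine le_of_forall_pos_le_add fun ε hε => ?_
    have := one_sub_le_norm_bdry_sq μ hμ (ε := ε / 4) (by positivity)
    linarith
  have h2 := norm_bdry_le (differentiableOn_clarkFn μ) (fun z hz => norm_clarkFn_le μ hz)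
  rw [norm_sq_eq_integral] at h1
  have hi : Integrable (fun x => ‖bdry (clarkFn μ) x‖ ^ 2) leb :=
    (Lp.memLp (bdry (clarkFn μ))).integrable_norm_pow (by norm_num)
  have h3 : (fun x => 1 - ‖bdry (clarkFn μ) x‖ ^ 2) =ᵐ[leb] 0 := by
    rw [← integral_eq_zero_iff_of_nonneg_ae]
    · have h4 : 0 ≤ ∫ x, (1 - ‖bdry (clarkFn μ) x‖ ^ 2) ∂leb := by
        refine integral_nonneg_of_ae ?_
        filter_upwards [h2] with x hx
        have := norm_nonneg (bdry (clarkFn μ) x)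
        simp only [Pi.zero_apply]
        nlinarith
      rw [integral_sub (integrable_const _) hi] at h4 ⊢
      simp only [integral_const, probReal_univ, smul_eq_mul, mul_one] at h4 ⊢
      linarith
    · filter_upwards [h2] with x hx
      have := norm_nonneg (bdry (clarkFn μ) x)
      simp only [Pi.zero_apply]
      nlinarith
    · exact (integrable_const _).sub hi
  filter_upwards [h3] with x hx
  simp only [Pi.zero_apply] at hx
  have := norm_nonneg (bdry (clarkFn μ) x)
  nlinarith

theorem isInner_clarkFn (hμ : μ ⟂ₘ leb) : IsInner (clarkFn μ) :=
  ⟨differentiableOn_clarkFn μ, ⟨1, fun _ hz => norm_clarkFn_le μ hz⟩, norm_bdry_clarkFn μ hμ⟩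

end Inner

/-! ### The operator `V` -/

section Model

variable (μ : Measure UnitAddCircle) [IsFiniteMeasure μ]

theorem mulZ_pow_mem_H2 (n : ℕ) {f : L2 leb} (hf : f ∈ H2) : (mulZ leb ^ n) f ∈ H2 := by
  induction n with
  | zero => simpa
  | succ n ih =>
    rw [pow_succ', mul_apply_eq_comp]
    exact mulZ_mem_H2 ⟨_, ih⟩

theorem mulZ_pow_zmon (n : ℕ) (k : ℤ) : (mulZ leb ^ n) (zmon k) = zmon (k + n) := by
  induction n with
  | zero => simp
  | succ n ih =>
    rw [pow_succ', mul_apply_eq_comp, ih, mulZ_zmon]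
    push_cast
    ring_nf

theorem inner_zmon_neg_one {f : L2 leb} (hf : f ∈ H2) : inner ℂ (zmon (-1)) f = 0 :=
  mem_H2.1 hf _ (by norm_num)

/-- A function in `H²` with mean value zero is divisible by `z`. -/
theorem mulZEquiv_symm_mem_H2 {f : L2 leb} (hf : f ∈ H2) (h0 : inner ℂ (zmon 0) f = 0) :
    (mulZEquiv leb).symm f ∈ H2 := by
  rw [mem_H2]
  intro n hn
  rw [inner_zmon_mulZEquiv_symm]
  rcases eq_or_lt_of_le (Int.add_one_le_iff.2 hn) with h | h
  · rw [h, h0]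
  · exact mem_H2.1 hf _ h

theorem conj_clarkFn_zero : (starRingEnd ℂ) (clarkFn μ 0) = clarkFn μ 0 := by
  rw [clarkFn_zero, Complex.conj_ofReal]

theorem one_sub_clarkFn_zero_ne_zero : 1 - clarkFn μ 0 ≠ 0 :=
  one_sub_clarkFn_ne_zero μ (by simp)

theorem inner_zmon_bdry_clarkFn (n : ℕ) :
    inner ℂ (zmon (n : ℤ)) (bdry (clarkFn μ)) = taylorCoeff (clarkFn μ) n :=
  inner_zmon_bdry (summable_clarkFn μ) n

theorem inner_zmon_zero_bdry_clarkFn :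
    inner ℂ (zmon 0) (bdry (clarkFn μ)) = clarkFn μ 0 := by
  have := inner_zmon_bdry_clarkFn μ 0
  rwa [taylorCoeff_zero] at this

theorem inner_bdry_clarkFn_zmon_zero :
    inner ℂ (bdry (clarkFn μ)) (zmon 0) = clarkFn μ 0 := by
  rw [← inner_conj_symm, inner_zmon_zero_bdry_clarkFn, conj_clarkFn_zero]

/-- The function `g` is, up to a factor, the backward shift of `θ`. -/
theorem mulZ_bdry_clarkG : (1 - clarkFn μ 0) • mulZ leb (bdry (clarkG μ))
    = bdry (clarkFn μ) - clarkFn μ 0 • zmon 0 := by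
  have hg : Summable fun n => ‖taylorCoeff (clarkG μ) n‖ ^ 2 := by
    simp only [taylorCoeff_clarkG, norm_div, div_pow]
    exact ((summable_nat_add_iff 1).2 (summable_clarkFn μ)).div_const _
  refine ext_inner_zmon fun n => ?_
  rw [inner_smul_right, inner_zmon_mulZ, inner_sub_right, inner_smul_right, inner_zmon]
  rcases lt_trichotomy n 0 with hn | rfl | hn
  · rw [mem_H2.1 (bdry_mem_H2 _) _ (by omega), mem_H2.1 (bdry_mem_H2 _) _ hn, if_neg hn.ne]
    simp
  · rw [mem_H2.1 (bdry_mem_H2 _) _ (by norm_num), inner_zmon_zero_bdry_clarkFn]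
    simp
  · obtain ⟨k, rfl⟩ : ∃ k : ℕ, n = (k : ℤ) + 1 := ⟨(n - 1).toNat, by omega⟩
    rw [add_sub_cancel_right, inner_zmon_bdry hg, taylorCoeff_clarkG,
      mul_div_cancel₀ _ (one_sub_clarkFn_zero_ne_zero μ), if_neg hn.ne']
    have := inner_zmon_bdry_clarkFn μ (k + 1)
    push_cast at this
    rw [this]
    simp

/-- The functional `f ↦ (z f, θ)` is a combination of the two functionals that occur in `Ṽ`. -/
theorem inner_bdry_clarkFn_mulZ (f : L2 leb) : inner ℂ (bdry (clarkFn μ)) (mulZ leb f)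
    = (1 - clarkFn μ 0) * inner ℂ (bdry (clarkG μ)) f
      + clarkFn μ 0 * inner ℂ (zmon (-1)) f := by
  have h1 : bdry (clarkFn μ) = (1 - clarkFn μ 0) • mulZ leb (bdry (clarkG μ))
      + clarkFn μ 0 • zmon 0 := by rw [mulZ_bdry_clarkG]; abel
  rw [h1, inner_add_left, inner_smul_left, inner_smul_left, inner_mulZ_mulZ, inner_zmon_mulZ,
    map_sub, map_one, conj_clarkFn_zero]
  norm_num

theorem inner_bdry_clarkFn_mulZ_of_mem {f : L2 leb} (hf : f ∈ H2) :
    inner ℂ (bdry (clarkFn μ)) (mulZ leb f)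
      = (1 - clarkFn μ 0) * inner ℂ (bdry (clarkG μ)) f := by
  rw [inner_bdry_clarkFn_mulZ, inner_zmon_neg_one hf, mul_zero, add_zero]

theorem coe_modelV (f : H2) : (modelV μ f : L2 leb)
    = mulZ leb f + inner ℂ (bdry (clarkG μ)) (f : L2 leb) • (zmon 0 - bdry (clarkFn μ)) := rfl

variable {μ} (hμ : μ ⟂ₘ leb)
include hμ

theorem isUnimodular_bdry_clarkFn : IsUnimodular leb (bdry (clarkFn μ)) :=
  ⟨Lp.aestronglyMeasurable _, norm_bdry_clarkFn μ hμ⟩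

/-- Multiplication by `θ` in `L²(𝕋)`. -/
def mulTheta : L2 leb →ₗᵢ[ℂ] L2 leb := mulU (isUnimodular_bdry_clarkFn hμ)

theorem mulTheta_zmon_zero : mulTheta hμ (zmon 0) = bdry (clarkFn μ) := by
  apply Lp.ext
  filter_upwards [coeFn_mulU (isUnimodular_bdry_clarkFn hμ) (zmon 0), coeFn_zmon 0] with x h1 h2
  have h1' : mulTheta hμ (zmon 0) x = bdry (clarkFn μ) x * zmon 0 x := h1
  rw [h1', h2, fourier_zero, mul_one]

theorem mulTheta_mulZ (f : L2 leb) : mulTheta hμ (mulZ leb f) = mulZ leb (mulTheta hμ f) := by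
  rw [← mulU_pt, ← mulU_pt]
  exact mulU_comm _ _ f

theorem norm_bdry_clarkFn_eq_one : ‖bdry (clarkFn μ)‖ = 1 := by
  rw [← mulTheta_zmon_zero hμ, LinearIsometry.norm_map, norm_zmon]

theorem inner_bdry_clarkFn_self : inner ℂ (bdry (clarkFn μ)) (bdry (clarkFn μ)) = (1 : ℂ) := by
  rw [inner_self_eq_norm_sq_to_K, norm_bdry_clarkFn_eq_one hμ]; simp

theorem inner_bdry_clarkFn_mulTheta (f : L2 leb) :
    inner ℂ (bdry (clarkFn μ)) (mulTheta hμ f) = inner ℂ (zmon 0) f := by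
  rw [← mulTheta_zmon_zero hμ, LinearIsometry.inner_map_map]

theorem mulTheta_mem_H2 {f : L2 leb} (hf : f ∈ H2) : mulTheta hμ f ∈ H2 := by
  have h1 := (hasSum_zmon f).mapL (mulTheta hμ).toContinuousLinearMap
  refine isClosed_H2.mem_of_tendsto h1 (Eventually.of_forall fun s => H2.sum_mem fun n _ => ?_)
  rcases lt_or_ge n 0 with hn | hn
  · rw [mem_H2.1 hf n hn, zero_smul, map_zero]
    exact H2.zero_mem
  · rw [map_smul]
    refine H2.smul_mem _ ?_
    obtain ⟨k, rfl⟩ := Int.eq_ofNat_of_zero_le hn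
    have h2 : ∀ k : ℕ, mulTheta hμ (zmon (k : ℤ)) = (mulZ leb ^ k) (bdry (clarkFn μ)) := by
      intro k
      induction k with
      | zero => simpa using mulTheta_zmon_zero hμ
      | succ k ih =>
        rw [pow_succ', mul_apply_eq_comp, ← ih, ← mulTheta_mulZ, mulZ_zmon]
        push_cast
        rfl
    change mulTheta hμ (zmon (k : ℤ)) ∈ H2
    rw [h2]
    exact mulZ_pow_mem_H2 k (bdry_mem_H2 _)

theorem mem_innerH2 {f : H2} :
    f ∈ innerH2 (clarkFn μ) ↔ ∃ h : H2, (f : L2 leb) = mulTheta hμ h := by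
  constructor
  · rintro ⟨h, hh⟩
    exact ⟨h, Lp.ext (hh.trans (coeFn_mulU (isUnimodular_bdry_clarkFn hμ) (h : L2 leb)).symm)⟩
  · rintro ⟨h, hh⟩
    refine ⟨h, ?_⟩
    rw [hh]
    exact coeFn_mulU (isUnimodular_bdry_clarkFn hμ) (h : L2 leb)

theorem mem_modelSpace {f : H2} :
    f ∈ modelSpace (clarkFn μ) ↔ ∀ h ∈ H2, inner ℂ (mulTheta hμ h) (f : L2 leb) = 0 := by
  rw [modelSpace, Submodule.mem_orthogonal]
  constructor
  · intro h k hk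
    exact h ⟨mulTheta hμ k, mulTheta_mem_H2 hμ hk⟩ ((mem_innerH2 hμ).2 ⟨⟨k, hk⟩, rfl⟩)
  · intro h u hu
    obtain ⟨k, hk⟩ := (mem_innerH2 hμ).1 hu
    rw [Submodule.coe_inner, hk]
    exact h k k.2

theorem inner_clarkG_mulTheta {h : L2 leb} (hh : h ∈ H2) :
    inner ℂ (bdry (clarkG μ)) (mulTheta hμ h) = 0 := by
  have h1 := inner_bdry_clarkFn_mulZ_of_mem μ (mulTheta_mem_H2 hμ hh)
  rw [← mulTheta_mulZ, inner_bdry_clarkFn_mulTheta, inner_zmon_mulZ, zero_sub,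
    inner_zmon_neg_one hh] at h1
  exact (mul_eq_zero.1 h1.symm).resolve_left (one_sub_clarkFn_zero_ne_zero μ)

theorem modelV_of_mem_innerH2 {f : H2} (hf : f ∈ innerH2 (clarkFn μ)) :
    (modelV μ f : L2 leb) = mulZ leb f := by
  obtain ⟨h, hh⟩ := (mem_innerH2 hμ).1 hf
  rw [coe_modelV, hh, inner_clarkG_mulTheta hμ h.2, zero_smul, add_zero]

/-- With `a = (f, g)`, the cross term in `‖z f + a (1 - θ)‖²` is `-2 |a|² (1 - θ(0))`, because
`(z f, θ) = (1 - θ(0)) a`; it cancels `‖a (1 - θ)‖² = 2 |a|² (1 - θ(0))`. -/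
theorem norm_modelV (f : H2) : ‖modelV μ f‖ = ‖f‖ := by
  have h0 : ‖zmon 0 - bdry (clarkFn μ)‖ ^ 2 = 2 * (1 - clarkFn μ 0).re := by
    have h1 := norm_sub_sq (𝕜 := ℂ) (zmon 0) (bdry (clarkFn μ))
    rw [norm_zmon, norm_bdry_clarkFn_eq_one hμ, inner_zmon_zero_bdry_clarkFn] at h1
    rw [h1, Complex.sub_re, Complex.one_re]
    simp only [RCLike.re_to_complex]
    ring
  have h1 := inner_bdry_clarkFn_mulZ_of_mem μ f.2
  set a := inner ℂ (bdry (clarkG μ)) (f : L2 leb) with ha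
  have h2 : inner ℂ (a • (zmon 0 - bdry (clarkFn μ))) (mulZ leb f)
      = -(((‖a‖ ^ 2 : ℝ) : ℂ) * (1 - clarkFn μ 0)) := by
    rw [inner_smul_left, inner_sub_left, h1, inner_zmon_mulZ, zero_sub, inner_zmon_neg_one f.2,
      ← Complex.normSq_eq_norm_sq, Complex.normSq_eq_conj_mul_self]
    ring
  have h3 : (modelV μ f : L2 leb) = a • (zmon 0 - bdry (clarkFn μ)) + mulZ leb f := by
    rw [coe_modelV, add_comm]
  have h4 : ‖modelV μ f‖ ^ 2 = ‖f‖ ^ 2 := by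
    rw [Submodule.coe_norm, h3, norm_add_sq (𝕜 := ℂ), h2, norm_smul, mul_pow, h0, norm_mulZ]
    simp only [RCLike.re_to_complex, Complex.neg_re, Complex.re_ofReal_mul, Submodule.coe_norm]
    ring
  exact (sq_eq_sq₀ (norm_nonneg _) (norm_nonneg _)).1 h4

/-- The range of `V` is the orthogonal complement of `θ` in `H²`. -/
theorem isDefectVector_modelV :
    IsDefectVector (modelV μ) (⟨bdry (clarkFn μ), bdry_mem_H2 _⟩ : H2) := by
  have h0 := one_sub_clarkFn_zero_ne_zero μ
  refine ⟨norm_bdry_clarkFn_eq_one hμ, fun x => ⟨fun hx => ?_, ?_⟩⟩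
  · -- A vector `x` orthogonal to `θ` is `V y` for `y = z̄ (x - a (1 - θ))`.
    rw [Submodule.coe_inner] at hx
    simp only at hx
    -- `x - a (1 - θ)` has mean value zero for this choice of `a`.
    set a := inner ℂ (zmon 0) (x : L2 leb) / (1 - clarkFn μ 0) with ha
    set w : L2 leb := x - a • (zmon 0 - bdry (clarkFn μ)) with hw
    have hwm : w ∈ H2 :=
      H2.sub_mem x.2 (H2.smul_mem _ (H2.sub_mem (zmon_mem_H2 0) (bdry_mem_H2 _)))
    have hw0 : inner ℂ (zmon 0) w = 0 := by
      rw [hw, inner_sub_right, inner_smul_right, inner_sub_right, inner_zmon_zero_bdry_clarkFn,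
        inner_zmon, if_pos rfl, ha, div_mul_cancel₀ _ h0, sub_self]
    have hym := mulZEquiv_symm_mem_H2 hwm hw0
    refine ⟨⟨_, hym⟩, Subtype.ext ?_⟩
    have h1 := inner_bdry_clarkFn_mulZ_of_mem μ hym
    rw [mulZ_mulZEquiv_symm, hw, inner_sub_right, hx, inner_smul_right, inner_sub_right,
      inner_bdry_clarkFn_zmon_zero, inner_bdry_clarkFn_self hμ, ← hw] at h1
    have h2 : inner ℂ (bdry (clarkG μ)) ((mulZEquiv leb).symm w) = a :=
      mul_left_cancel₀ h0 (by rw [← h1]; ring)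
    rw [coe_modelV, h2, mulZ_mulZEquiv_symm, hw, sub_add_cancel]
  · rintro ⟨y, rfl⟩
    rw [Submodule.coe_inner, coe_modelV]
    simp only
    rw [inner_add_right, inner_smul_right, inner_sub_right, inner_bdry_clarkFn_mulZ_of_mem μ y.2,
      inner_bdry_clarkFn_zmon_zero, inner_bdry_clarkFn_self hμ]
    ring

theorem isClosed_innerH2 : IsClosed (innerH2 (clarkFn μ) : Set H2) := by
  have h1 : (innerH2 (clarkFn μ) : Set H2)
      = Subtype.val ⁻¹' (mulTheta hμ '' (H2 : Set (L2 leb))) := by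
    ext f
    rw [SetLike.mem_coe, mem_innerH2 hμ]
    constructor
    · rintro ⟨h, hh⟩
      exact ⟨h, h.2, hh.symm⟩
    · rintro ⟨h, hh, e⟩
      exact ⟨⟨h, hh⟩, e.symm⟩
  rw [h1]
  exact ((mulTheta hμ).isometry.isClosedEmbedding.isClosedMap _ isClosed_H2).preimage
    continuous_subtype_val

theorem modelSpace_orthogonal : (modelSpace (clarkFn μ))ᗮ = innerH2 (clarkFn μ) := by
  rw [modelSpace, Submodule.orthogonal_orthogonal_eq_closure]
  exact (isClosed_innerH2 hμ).submodule_topologicalClosure_eq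

theorem modelV_mem_innerH2 {f : H2} (hf : f ∈ innerH2 (clarkFn μ)) :
    modelV μ f ∈ innerH2 (clarkFn μ) := by
  rw [mem_innerH2 hμ, modelV_of_mem_innerH2 hμ hf]
  obtain ⟨h, hh⟩ := (mem_innerH2 hμ).1 hf
  exact ⟨⟨mulZ leb h, mulZ_mem_H2 h⟩, by rw [hh]; exact (mulTheta_mulZ hμ _).symm⟩

theorem modelV_mulTheta {h : L2 leb} (hh : h ∈ H2) :
    modelV μ ⟨mulTheta hμ h, mulTheta_mem_H2 hμ hh⟩
      = ⟨mulTheta hμ (mulZ leb h), mulTheta_mem_H2 hμ (mulZ_mem_H2 ⟨h, hh⟩)⟩ := by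
  refine Subtype.ext ?_
  rw [modelV_of_mem_innerH2 hμ ((mem_innerH2 hμ).2 ⟨⟨h, hh⟩, rfl⟩)]
  exact (mulTheta_mulZ hμ h).symm

theorem modelV_mem_modelSpace {k : H2} (hk : k ∈ modelSpace (clarkFn μ)) :
    modelV μ k ∈ modelSpace (clarkFn μ) := by
  rw [mem_modelSpace hμ] at hk ⊢
  intro h hh
  -- Split `h` into its mean value and a multiple of `z`.
  set w := h - inner ℂ (zmon 0) h • zmon 0 with hw
  have hwm : w ∈ H2 := H2.sub_mem hh (H2.smul_mem _ (zmon_mem_H2 0))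
  have hw0 : inner ℂ (zmon 0) w = 0 := by
    rw [hw, inner_sub_right, inner_smul_right, inner_zmon, if_pos rfl, mul_one, sub_self]
  have hym := mulZEquiv_symm_mem_H2 hwm hw0
  have e1 : h = inner ℂ (zmon 0) h • zmon 0 + mulZ leb ((mulZEquiv leb).symm w) := by
    rw [mulZ_mulZEquiv_symm, hw]; abel
  have e2 : inner ℂ (mulTheta hμ (mulZ leb ((mulZEquiv leb).symm w))) (modelV μ k : L2 leb)
      = 0 := by
    have h1 := inner_map_of_norm_map (norm_modelV hμ) ⟨_, mulTheta_mem_H2 hμ hym⟩ k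
    rw [modelV_mulTheta hμ hym] at h1
    exact h1.trans (hk _ hym)
  have e3 : inner ℂ (bdry (clarkFn μ)) (modelV μ k : L2 leb) = 0 :=
    ((isDefectVector_modelV hμ).inner_eq_zero_iff _).2 ⟨k, rfl⟩
  rw [e1, map_add, map_smul, inner_add_left, inner_smul_left, mulTheta_zmon_zero, e3, mul_zero,
    zero_add]
  exact e2

/-- `K_θ` lies in the range of `V`, being orthogonal to `θ`; the preimage of `K_θ` is orthogonal to
`θ H²` because `V` is isometric there. -/
theorem exists_modelV_eq {k : H2} (hk : k ∈ modelSpace (clarkFn μ)) :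
    ∃ y ∈ modelSpace (clarkFn μ), modelV μ y = k := by
  have h0 : inner ℂ (⟨bdry (clarkFn μ), bdry_mem_H2 _⟩ : H2) k = 0 := by
    have := (mem_modelSpace hμ).1 hk (zmon 0) (zmon_mem_H2 0)
    rwa [mulTheta_zmon_zero] at this
  obtain ⟨y, rfl⟩ := ((isDefectVector_modelV hμ).inner_eq_zero_iff _).1 h0
  refine ⟨y, (mem_modelSpace hμ).2 fun h hh => ?_, rfl⟩
  have h1 := inner_map_of_norm_map (norm_modelV hμ) ⟨_, mulTheta_mem_H2 hμ hh⟩ y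
  rw [modelV_mulTheta hμ hh] at h1
  exact h1.symm.trans ((mem_modelSpace hμ).1 hk _ (mulZ_mem_H2 ⟨h, hh⟩))

theorem isWoldDecomposition_modelV :
    IsWoldDecomposition (modelV μ) (modelSpace (clarkFn μ)) where
  isometry := norm_modelV hμ
  isClosed := Submodule.isClosed_orthogonal _
  unitary_part := by
    refine le_antisymm ?_ fun k hk => ?_
    · rintro _ ⟨k, hk, rfl⟩
      exact modelV_mem_modelSpace hμ hk
    · obtain ⟨y, hy, e⟩ := exists_modelV_eq hμ hk
      exact ⟨y, hy, e⟩
  invariant_compl := by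
    rw [modelSpace_orthogonal hμ]
    rintro _ ⟨f, hf, rfl⟩
    exact modelV_mem_innerH2 hμ hf
  completely_nonunitary := by
    intro M hM _ hMV
    rw [modelSpace_orthogonal hμ] at hM
    have key : ∀ n : ℕ, ∀ f ∈ M, ∃ g ∈ M, (f : L2 leb) = (mulZ leb ^ n) (g : L2 leb) := by
      intro n
      induction n with
      | zero => exact fun f hf => ⟨f, hf, by simp⟩
      | succ n ih =>
        intro f hf
        obtain ⟨g, hg, e⟩ := ih f hf
        rw [← hMV] at hg
        obtain ⟨g', hg', rfl⟩ := hg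
        refine ⟨g', hg', ?_⟩
        rw [e, pow_succ, mul_apply_eq_comp, ← modelV_of_mem_innerH2 hμ (hM hg')]
        rfl
    rw [Submodule.eq_bot_iff]
    intro f hf
    refine Subtype.ext (eq_zero_of_forall_eq_mulZ_pow fun n => ?_)
    obtain ⟨g, -, e⟩ := key n f hf
    exact ⟨g, g.2, e⟩

end Model

/-! ### The unitary part of `V` -/

/-- Trigonometric polynomials are dense in `L²(ν)` for every finite measure. -/
theorem eq_zero_of_inner_fourier {ν : Measure UnitAddCircle} [IsFiniteMeasure ν] {f : L2 ν}
    (h : ∀ n : ℤ, inner ℂ (ContinuousMap.toLp (E := ℂ) 2 ν ℂ (fourier n)) f = 0) : f = 0 := by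
  have h1 : ∀ G : C(UnitAddCircle, ℂ), inner ℂ (ContinuousMap.toLp (E := ℂ) 2 ν ℂ G) f = 0 := by
    have hc : IsClosed {G : C(UnitAddCircle, ℂ) |
        inner ℂ (ContinuousMap.toLp (E := ℂ) 2 ν ℂ G) f = 0} :=
      isClosed_eq ((ContinuousLinearMap.continuous _).inner continuous_const) continuous_const
    have h2 : ((Submodule.span ℂ (range (fourier (T := 1)))).topologicalClosure : Set _) ⊆
        {G : C(UnitAddCircle, ℂ) | inner ℂ (ContinuousMap.toLp (E := ℂ) 2 ν ℂ G) f = 0} := by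
      rw [Submodule.topologicalClosure_coe]
      refine closure_minimal ?_ hc
      intro G hG
      induction hG using Submodule.span_induction with
      | mem x hx => obtain ⟨n, rfl⟩ := hx; exact h n
      | zero => simp
      | add x y _ _ hx hy =>
        simp only [mem_ofPred_eq, map_add, inner_add_left] at hx hy ⊢
        rw [hx, hy, add_zero]
      | smul c x _ hx =>
        simp only [mem_ofPred_eq, map_smul, inner_smul_left] at hx ⊢
        rw [hx, mul_zero]
    rw [span_fourier_closure_eq_top] at h2
    exact fun G => h2 (Submodule.mem_top)
  have hd := ContinuousMap.toLp_denseRange ℂ ν ℂ (p := 2) (by norm_num)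
  have h2 : inner ℂ f f = (0 : ℂ) :=
    hd.induction_on (p := fun g => inner ℂ g f = (0 : ℂ)) f
      (isClosed_eq (continuous_id.inner continuous_const) continuous_const) h1
  exact inner_self_eq_zero.1 h2

section UnitaryPowers

variable {E : Type*} [NormedAddCommGroup E] [InnerProductSpace ℂ E]

theorem zpow_add_apply (U : E ≃ₗᵢ[ℂ] E) (n m : ℤ) (f : E) : (U ^ (n + m)) f = (U ^ n) ((U ^ m) f) :=
  congrArg (fun W : E ≃ₗᵢ[ℂ] E => W f) (zpow_add U n m)

theorem inner_zpow_zpow {U : E ≃ₗᵢ[ℂ] E} {g : E} {μ : Measure UnitAddCircle}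
    (hm : ∀ n : ℕ, inner ℂ g ((U ^ (n : ℤ)) g) = moment μ n) (n m : ℤ) :
    inner ℂ ((U ^ n) g) ((U ^ m) g) = ∫ x, fourier (m - n) x ∂μ := by
  have key : ∀ n : ℤ, ∀ k : ℕ, inner ℂ ((U ^ n) g) ((U ^ (n + k)) g)
      = ∫ x, fourier (k : ℤ) x ∂μ := by
    intro n k
    rw [zpow_add_apply, LinearIsometryEquiv.inner_map_map, hm, moment]
    simp only [fourier_natCast]
  rcases le_total n m with h | h
  · obtain ⟨k, hk⟩ := Int.eq_ofNat_of_zero_le (sub_nonneg.2 h)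
    have h2 : m = n + k := by omega
    rw [h2, key, add_sub_cancel_left]
  · obtain ⟨k, hk⟩ := Int.eq_ofNat_of_zero_le (sub_nonneg.2 h)
    have h2 : n = m + k := by omega
    rw [← inner_conj_symm, h2, key, ← integral_conj]
    have h3 : m - (m + k) = -(k : ℤ) := by omega
    rw [h3]
    congr 1
    ext x
    rw [fourier_neg]

/-- A unitary operator with a cyclic vector `g` such that `(Uⁿ g, g)` are the moments of `μ` is
multiplication by `z` in `L²(μ)`: the functions `ξⁿ⁻¹` and `Uⁿ g`, `n ∈ ℤ`, have the same Gram
matrix. -/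
theorem exists_equiv_mulZ [CompleteSpace E] {U : E ≃ₗᵢ[ℂ] E} {g : E}
    {μ : Measure UnitAddCircle} [IsFiniteMeasure μ]
    (hm : ∀ n : ℕ, inner ℂ g ((U ^ (n : ℤ)) g) = moment μ n)
    (hc : ∀ f, (∀ n : ℤ, inner ℂ ((U ^ n) g) f = 0) → f = 0) :
    ∃ Ω : L2 μ ≃ₗᵢ[ℂ] E, ∀ f, Ω (mulZ μ f) = U (Ω f) := by
  let x : ℤ → L2 μ := fun n => ContinuousMap.toLp (E := ℂ) 2 μ ℂ (fourier n)
  let y : ℤ → E := fun n => (U ^ (n + 1)) g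
  have hx : ∀ f, (∀ i, inner ℂ (x i) f = 0) → f = 0 := fun f hf => eq_zero_of_inner_fourier hf
  have hy : ∀ f, (∀ i, inner ℂ (y i) f = 0) → f = 0 := fun f hf =>
    hc f fun n => by simpa [y] using hf (n - 1)
  have hxc : ∀ n, ⇑(x n) =ᵐ[μ] fun t => fourier n t := fun n =>
    ContinuousMap.coeFn_toLp (p := 2) (𝕜 := ℂ) μ (fourier n)
  obtain ⟨Ω, hΩ⟩ := exists_equiv_of_gram (x := x) (y := y) (fun i j => by
    simp only [y]
    rw [inner_zpow_zpow hm, L2.inner_def]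
    refine integral_congr_ae ?_
    filter_upwards [hxc i, hxc j] with t h1 h2
    rw [h1, h2, RCLike.inner_apply, ← fourier_neg, ← fourier_add]
    congr 2
    ring) hx hy
  refine ⟨Ω, fun f => ?_⟩
  have h1 : (Ω : L2 μ →L[ℂ] E) ∘L mulZ μ = (U : E →L[ℂ] E) ∘L (Ω : L2 μ →L[ℂ] E) := by
    refine eq_of_eq_on_complete hx fun n => ?_
    change Ω (mulZ μ (x n)) = U (Ω (x n))
    have h2 : mulZ μ (x n) = x (n + 1) := by
      apply Lp.ext
      filter_upwards [coeFn_mulZ μ (x n), hxc n, hxc (n + 1)] with t h1 h2 h3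
      rw [h1, h2, h3, fourier_add, fourier_one, mul_comm]
      rfl
    have h3 : U (y n) = (U ^ (1 : ℤ)) (y n) := by rw [zpow_one]
    rw [h2, hΩ, hΩ, h3]
    simp only [y]
    rw [← zpow_add_apply]
    congr 2
    ring
  exact congrArg (fun A : L2 μ →L[ℂ] E => A f) h1

/-- A version of `exists_equiv_mulZ` for an operator that is unitary on a subspace `K`. The
cyclicity of `g` is stated in terms of the backward orbits `f, V⁻¹ f, V⁻² f, …`. -/
theorem isMulZOn_of_moments [CompleteSpace E] {V : E →L[ℂ] E} {K : Submodule ℂ E}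
    {μ : Measure UnitAddCircle} [IsFiniteMeasure μ] (hK : IsClosed (K : Set E))
    (hV : ∀ f, ‖V f‖ = ‖f‖) (hKV : K.map (V : E →ₗ[ℂ] E) = K) {g : E} (hg : g ∈ K)
    (hm : ∀ n : ℕ, inner ℂ g ((V ^ n) g) = moment μ n)
    (hc : ∀ f : ℕ → E, (∀ n, f n ∈ K) → (∀ n, V (f (n + 1)) = f n) →
      (∀ n, inner ℂ g (f (n + 1)) = 0) → f 0 = 0) : IsMulZOn V K μ := by
  have hKc : CompleteSpace K := hK.completeSpace_coe
  have hmap : ∀ k ∈ K, V k ∈ K := fun k hk => by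
    have : V k ∈ K.map (V : E →ₗ[ℂ] E) := ⟨k, hk, rfl⟩
    rwa [hKV] at this
  let L : K →ₗᵢ[ℂ] K := ⟨(V : E →ₗ[ℂ] E).restrict hmap, fun k => hV k⟩
  let U : K ≃ₗᵢ[ℂ] K := LinearIsometryEquiv.ofSurjective L fun k => by
    obtain ⟨y, hy, e⟩ := hKV.ge k.2
    exact ⟨⟨y, hy⟩, Subtype.ext e⟩
  have hU : ∀ k : K, (U k : E) = V k := fun k => rfl
  have hUn : ∀ n : ℕ, ((U ^ (n : ℤ)) ⟨g, hg⟩ : E) = (V ^ n) g := by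
    intro n
    induction n with
    | zero => rfl
    | succ n ih =>
      rw [Nat.cast_succ, add_comm, zpow_add_apply, zpow_one, hU, ih, pow_succ', mul_apply_eq_comp]
  obtain ⟨Ω, hΩ⟩ := exists_equiv_mulZ (U := U) (g := ⟨g, hg⟩) (μ := μ)
    (fun n => by rw [Submodule.coe_inner, hUn]; exact hm n) (fun f hf => by
      refine Subtype.ext (hc (fun n => ((U ^ (-n : ℤ)) f : K)) (fun n => Subtype.property _)
        (fun n => ?_) (fun n => ?_))
      · rw [← hU]
        have h1 : U ((U ^ (-((n + 1 : ℕ) : ℤ))) f)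
            = (U ^ (1 : ℤ)) ((U ^ (-((n + 1 : ℕ) : ℤ))) f) := by rw [zpow_one]
        rw [h1, ← zpow_add_apply]
        congr 3
        push_cast
        ring
      · have h3 := hf ((n + 1 : ℕ) : ℤ)
        rw [← LinearIsometryEquiv.inner_map_map (U ^ (-((n + 1 : ℕ) : ℤ))), ← zpow_add_apply,
          neg_add_cancel, zpow_zero] at h3
        exact h3)
  exact ⟨Ω, fun f => by rw [hΩ, hU]⟩

end UnitaryPowers

section ClarkUnitary

variable {μ : Measure UnitAddCircle} [IsFiniteMeasure μ] (hμ : μ ⟂ₘ leb)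

/-- The formula for `V`, iterated. -/
theorem modelV_pow_clarkG (n : ℕ) :
    ((modelV μ ^ n) ⟨bdry (clarkG μ), bdry_mem_H2 _⟩ : L2 leb)
      = (mulZ leb ^ n) (bdry (clarkG μ)) + ∑ k ∈ Finset.range n,
        inner ℂ (bdry (clarkG μ)) ((modelV μ ^ k) ⟨bdry (clarkG μ), bdry_mem_H2 _⟩ : L2 leb) •
          (mulZ leb ^ (n - 1 - k)) (zmon 0 - bdry (clarkFn μ)) := by
  induction n with
  | zero => simp
  | succ n ih =>
    rw [pow_succ', mul_apply_eq_comp, coe_modelV, Finset.sum_range_succ, Nat.add_sub_cancel,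
      Nat.sub_self, pow_zero, one_apply_eq_self, ← add_assoc]
    congr 1
    rw [ih, map_add, map_sum, pow_succ', mul_apply_eq_comp]
    congr 1
    refine Finset.sum_congr rfl fun k hk => ?_
    have h1 : n - k = (n - 1 - k) + 1 := by have := Finset.mem_range.1 hk; omega
    rw [map_smul, h1, pow_succ', mul_apply_eq_comp]

include hμ

theorem inner_bdry_clarkFn_mulZ_pow (n : ℕ) :
    inner ℂ (bdry (clarkFn μ)) ((mulZ leb ^ n) (bdry (clarkFn μ))) = if n = 0 then 1 else 0 := by
  have h1 : ∀ n : ℕ, (mulZ leb ^ n) (bdry (clarkFn μ)) = mulTheta hμ (zmon (n : ℤ)) := by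
    intro n
    induction n with
    | zero => simpa using (mulTheta_zmon_zero hμ).symm
    | succ n ih =>
      rw [pow_succ', mul_apply_eq_comp, ih, ← mulTheta_mulZ, mulZ_zmon]
      push_cast
      rfl
  rw [h1, inner_bdry_clarkFn_mulTheta, inner_zmon]
  simp [eq_comm]

theorem inner_clarkG_mulZ_pow_one_sub (n : ℕ) : (1 - clarkFn μ 0) *
    inner ℂ (bdry (clarkG μ)) ((mulZ leb ^ n) (zmon 0 - bdry (clarkFn μ)))
      = (starRingEnd ℂ) (taylorCoeff (clarkFn μ) (n + 1)) := by
  have h0 : zmon 0 ∈ H2 := zmon_mem_H2 0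
  rw [← inner_bdry_clarkFn_mulZ_of_mem μ
    (mulZ_pow_mem_H2 n (H2.sub_mem h0 (bdry_mem_H2 _))), ← mul_apply_eq_comp,
    ← pow_succ', map_sub, inner_sub_right, inner_bdry_clarkFn_mulZ_pow hμ, mulZ_pow_zmon, zero_add,
    ← inner_conj_symm, inner_zmon_bdry_clarkFn, if_neg n.succ_ne_zero, sub_zero]

theorem inner_clarkG_mulZ_pow_clarkG (n : ℕ) : (1 - clarkFn μ 0) ^ 2 *
    inner ℂ (bdry (clarkG μ)) ((mulZ leb ^ n) (bdry (clarkG μ)))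
      = (if n = 0 then 1 else 0)
        - clarkFn μ 0 * (starRingEnd ℂ) (taylorCoeff (clarkFn μ) n) := by
  have h1 : (1 - clarkFn μ 0) • mulZ leb ((mulZ leb ^ n) (bdry (clarkG μ)))
      = (mulZ leb ^ n) (bdry (clarkFn μ)) - clarkFn μ 0 • zmon (n : ℤ) := by
    rw [← mul_apply_eq_comp, ← pow_succ', pow_succ, mul_apply_eq_comp, ← map_smul,
      mulZ_bdry_clarkG, map_sub, map_smul, mulZ_pow_zmon, zero_add]
  rw [sq, mul_assoc, ← inner_bdry_clarkFn_mulZ_of_mem μ (mulZ_pow_mem_H2 n (bdry_mem_H2 _)),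
    ← inner_smul_right, h1, inner_sub_right, inner_smul_right, inner_bdry_clarkFn_mulZ_pow hμ,
    ← inner_conj_symm _ (zmon (n : ℤ)), inner_zmon_bdry_clarkFn]

/-- The numbers `(Vⁿ g, g)` are the moments of `μ`, since both satisfy the same recursion. -/
theorem inner_clarkG_modelV_pow (n : ℕ) : inner ℂ (bdry (clarkG μ))
    ((modelV μ ^ n) ⟨bdry (clarkG μ), bdry_mem_H2 _⟩ : L2 leb) = moment μ n := by
  have h0 := one_sub_clarkFn_zero_ne_zero μ
  induction n using Nat.strong_induction_on with
  | _ n ih =>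
    rcases eq_or_ne n 0 with rfl | hn
    · have h1 := inner_clarkG_mulZ_pow_clarkG hμ 0
      have h2 := clark_formula μ (z := 0) (by simp)
      rw [herglotz_zero, ← moment_zero, div_eq_iff h0] at h2
      rw [if_pos rfl, taylorCoeff_zero, conj_clarkFn_zero] at h1
      rw [pow_zero, one_apply_eq_self] at h1 ⊢
      refine mul_left_cancel₀ (pow_ne_zero 2 h0) ?_
      rw [h1]
      linear_combination (1 - clarkFn μ 0) * h2
    · have h1 := congrArg (starRingEnd ℂ) (moment_recursion μ hn)
      simp only [map_mul, map_sub, map_sum, map_one, map_div₀, conj_clarkFn_zero,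
        Complex.conj_conj] at h1
      have h2 := inner_clarkG_mulZ_pow_clarkG hμ n
      rw [if_neg hn] at h2
      have h3 : ∀ k ∈ Finset.range n, (1 - clarkFn μ 0) * inner ℂ (bdry (clarkG μ))
          (inner ℂ (bdry (clarkG μ)) ((modelV μ ^ k) ⟨bdry (clarkG μ), bdry_mem_H2 _⟩ : L2 leb) •
            (mulZ leb ^ (n - 1 - k)) (zmon 0 - bdry (clarkFn μ)))
          = moment μ k * (starRingEnd ℂ) (taylorCoeff (clarkFn μ) (n - k)) := by
        intro k hk
        have hk' := Finset.mem_range.1 hk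
        have h4 : n - k = (n - 1 - k) + 1 := by omega
        rw [ih k hk', inner_smul_right, mul_left_comm, inner_clarkG_mulZ_pow_one_sub hμ, h4]
      rw [modelV_pow_clarkG, inner_add_right, inner_sum]
      refine mul_left_cancel₀ (pow_ne_zero 2 h0) ?_
      rw [mul_add, h2, sq, mul_assoc, Finset.mul_sum, Finset.sum_congr rfl h3]
      have h5 : clarkFn μ 0 / (1 - clarkFn μ 0) * (1 - clarkFn μ 0) = clarkFn μ 0 :=
        div_mul_cancel₀ _ h0
      linear_combination (-(1 - clarkFn μ 0)) * h1
        + (starRingEnd ℂ) (taylorCoeff (clarkFn μ) n) * h5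

/-- The unitary part of `V` is multiplication by `z` in `L²(μ)`. The function `g` is cyclic for it:
a function `f` in the model space that is orthogonal to the orbit of `g` satisfies `f = zⁿ V⁻ⁿ f`
for all `n`. -/
theorem isMulZOn_modelV : IsMulZOn (modelV μ) (modelSpace (clarkFn μ)) μ := by
  have hW := isWoldDecomposition_modelV hμ
  refine isMulZOn_of_moments hW.isClosed hW.isometry hW.unitary_part
    (g := ⟨bdry (clarkG μ), bdry_mem_H2 _⟩) ?_ (inner_clarkG_modelV_pow hμ) ?_
  · refine (mem_modelSpace hμ).2 fun h hh => ?_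
    rw [← inner_conj_symm]
    simp only
    rw [inner_clarkG_mulTheta hμ hh, map_zero]
  · intro f _ hf hg
    have key : ∀ n : ℕ, (f 0 : L2 leb) = (mulZ leb ^ n) (f n : L2 leb) := by
      intro n
      induction n with
      | zero => simp
      | succ n ih =>
        have h3 : inner ℂ (bdry (clarkG μ)) (f (n + 1) : L2 leb) = 0 := hg n
        rw [ih, ← hf, coe_modelV, h3, zero_smul, add_zero, pow_succ, mul_apply_eq_comp]
    exact Subtype.ext (eq_zero_of_forall_eq_mulZ_pow fun n => ⟨_, (f n).2, key n⟩)

end ClarkUnitary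

/-! ### Orthogonal sums of operators -/

section OrthogonalSum

variable {E F G : Type*} [NormedAddCommGroup E] [InnerProductSpace ℂ E] [CompleteSpace E]
  [NormedAddCommGroup F] [InnerProductSpace ℂ F] [CompleteSpace F]
  [NormedAddCommGroup G] [InnerProductSpace ℂ G] [CompleteSpace G]

/-- The space `E` is the orthogonal sum of the ranges of the isometries `a` and `b`. -/
structure IsOrthogonalSum (a : F →ₗᵢ[ℂ] E) (b : G →ₗᵢ[ℂ] E) : Prop where
  inner_eq_zero : ∀ u v, inner ℂ (a u) (b v) = 0
  exists_eq : ∀ x, ∃ u v, x = a u + b v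

/-- The operator on an orthogonal sum whose parts are `A` and `B`. -/
def glue (a : F →ₗᵢ[ℂ] E) (b : G →ₗᵢ[ℂ] E) (A : F →L[ℂ] F) (B : G →L[ℂ] G) : E →L[ℂ] E :=
  a.toContinuousLinearMap ∘L A ∘L ContinuousLinearMap.adjoint a.toContinuousLinearMap
    + b.toContinuousLinearMap ∘L B ∘L ContinuousLinearMap.adjoint b.toContinuousLinearMap

variable {a : F →ₗᵢ[ℂ] E} {b : G →ₗᵢ[ℂ] E} (h : IsOrthogonalSum a b)
include h

theorem IsOrthogonalSum.glue_apply (A : F →L[ℂ] F) (B : G →L[ℂ] G) (u : F) (v : G) :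
    glue a b A B (a u + b v) = a (A u) + b (B v) := by
  have e1 : ContinuousLinearMap.adjoint a.toContinuousLinearMap (a u + b v) = u := by
    refine ext_inner_left ℂ fun w => ?_
    rw [ContinuousLinearMap.adjoint_inner_right]
    change inner ℂ (a w) (a u + b v) = _
    rw [inner_add_right, h.inner_eq_zero, add_zero, LinearIsometry.inner_map_map]
  have e2 : ContinuousLinearMap.adjoint b.toContinuousLinearMap (a u + b v) = v := by
    refine ext_inner_left ℂ fun w => ?_
    rw [ContinuousLinearMap.adjoint_inner_right]
    change inner ℂ (b w) (a u + b v) = _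
    rw [inner_add_right, ← inner_conj_symm, h.inner_eq_zero, map_zero, zero_add,
      LinearIsometry.inner_map_map]
  change a (A (ContinuousLinearMap.adjoint a.toContinuousLinearMap (a u + b v)))
    + b (B (ContinuousLinearMap.adjoint b.toContinuousLinearMap (a u + b v))) = _
  rw [e1, e2]

theorem IsOrthogonalSum.glue_left (A : F →L[ℂ] F) (B : G →L[ℂ] G) (u : F) :
    glue a b A B (a u) = a (A u) := by
  simpa using h.glue_apply A B u 0

theorem IsOrthogonalSum.glue_right (A : F →L[ℂ] F) (B : G →L[ℂ] G) (v : G) :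
    glue a b A B (b v) = b (B v) := by
  simpa using h.glue_apply A B 0 v

theorem IsOrthogonalSum.norm_sq (u : F) (v : G) : ‖a u + b v‖ ^ 2 = ‖u‖ ^ 2 + ‖v‖ ^ 2 := by
  rw [norm_add_sq (𝕜 := ℂ), h.inner_eq_zero, a.norm_map, b.norm_map]
  simp

theorem IsOrthogonalSum.norm_glue {A : F →L[ℂ] F} {B : G →L[ℂ] G} (hA : ∀ f, ‖A f‖ = ‖f‖)
    (hB : ∀ f, ‖B f‖ = ‖f‖) (x : E) : ‖glue a b A B x‖ = ‖x‖ := by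
  obtain ⟨u, v, rfl⟩ := h.exists_eq x
  rw [h.glue_apply]
  refine (sq_eq_sq₀ (norm_nonneg _) (norm_nonneg _)).1 ?_
  rw [h.norm_sq, h.norm_sq, hA, hB]

theorem IsOrthogonalSum.glue_surjective {A : F →L[ℂ] F} {B : G →L[ℂ] G}
    (hA : Function.Surjective A) (hB : Function.Surjective B) :
    Function.Surjective (glue a b A B) := by
  intro x
  obtain ⟨u, v, rfl⟩ := h.exists_eq x
  obtain ⟨u, rfl⟩ := hA u
  obtain ⟨v, rfl⟩ := hB v
  exact ⟨_, h.glue_apply A B u v⟩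

theorem IsOrthogonalSum.glue_comp {A A' A'' : F →L[ℂ] F} {B B' B'' : G →L[ℂ] G}
    (hA : ∀ f, A'' f = A (A' f)) (hB : ∀ f, B'' f = B (B' f)) (x : E) :
    glue a b A'' B'' x = glue a b A B (glue a b A' B' x) := by
  obtain ⟨u, v, rfl⟩ := h.exists_eq x
  rw [h.glue_apply, h.glue_apply, h.glue_apply, hA, hB]

theorem IsOrthogonalSum.eq_glue {A : F →L[ℂ] F} {B : G →L[ℂ] G} {C : E →L[ℂ] E}
    (hA : ∀ u, C (a u) = a (A u)) (hB : ∀ v, C (b v) = b (B v)) : C = glue a b A B := by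
  ext x
  obtain ⟨u, v, rfl⟩ := h.exists_eq x
  rw [h.glue_apply, map_add, hA, hB]

end OrthogonalSum

section UnitaryOperators

variable {E : Type*} [NormedAddCommGroup E] [InnerProductSpace ℂ E] [CompleteSpace E]

theorem adjoint_apply_apply_of_norm_map {U : E →L[ℂ] E} (hU : ∀ f, ‖U f‖ = ‖f‖) (f : E) :
    ContinuousLinearMap.adjoint U (U f) = f := by
  refine ext_inner_left ℂ fun w => ?_
  rw [ContinuousLinearMap.adjoint_inner_right, inner_map_of_norm_map hU]

theorem mem_unitary_of_surjective {U : E →L[ℂ] E} (hU : ∀ f, ‖U f‖ = ‖f‖)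
    (hs : Function.Surjective U) : U ∈ unitary (E →L[ℂ] E) := by
  rw [Unitary.mem_iff, ContinuousLinearMap.star_eq_adjoint]
  constructor
  · ext f
    exact adjoint_apply_apply_of_norm_map hU f
  · ext f
    obtain ⟨f, rfl⟩ := hs f
    exact congrArg U (adjoint_apply_apply_of_norm_map hU f)

end UnitaryOperators

/-! ### The unitary dilation of `V` -/

theorem mulZEquiv_symm_zmon (n : ℤ) : (mulZEquiv leb).symm (zmon n) = zmon (n - 1) := by
  have h := mulZEquiv_symm_mulZ (zmon (n - 1))
  rwa [mulZ_zmon, sub_add_cancel] at h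

section Dilation

variable {μ : Measure UnitAddCircle} [IsFiniteMeasure μ] (hμ : μ ⟂ₘ leb) {c : ℂ}

theorem modelVtilde_apply (f : L2 leb) : modelVtilde μ c f
    = mulZ leb f + inner ℂ (bdry (clarkG μ)) f • (zmon 0 - bdry (clarkFn μ))
      - inner ℂ (zmon (-1)) f • (zmon 0 - (starRingEnd ℂ) c • bdry (clarkFn μ)) := rfl

theorem modelVtilde_of_mem_H2 (f : H2) : modelVtilde μ c f = modelV μ f := by
  rw [modelVtilde_apply, coe_modelV, inner_zmon_neg_one f.2, zero_smul, sub_zero]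

theorem inner_eq_zero_of_mem_H2 {f g : L2 leb} (hg : g ∈ H2) (hf : f ∈ H2ᗮ) :
    inner ℂ g f = 0 :=
  (Submodule.mem_orthogonal _ _).1 hf g hg

theorem modelVtilde_zmon_neg_one :
    modelVtilde μ c (zmon (-1)) = (starRingEnd ℂ) c • bdry (clarkFn μ) := by
  rw [modelVtilde_apply, inner_eq_zero_of_mem_H2 (bdry_mem_H2 _) zmon_neg_one_mem, mulZ_zmon,
    inner_zmon]
  simp

theorem modelVtilde_mulZEquiv_symm {f : L2 leb} (hf : f ∈ H2ᗮ) :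
    modelVtilde μ c ((mulZEquiv leb).symm f) = f := by
  rw [modelVtilde_apply, mulZ_mulZEquiv_symm, inner_eq_zero_of_mem_H2 (bdry_mem_H2 _)
    (mulZEquiv_symm_mem_H2_orthogonal hf), inner_zmon_mulZEquiv_symm,
    mem_H2_orthogonal.1 hf _ (by norm_num)]
  simp

include hμ

/-- The operator `x ↦ c̄ θ P₊ x + P₋ x` in `L²(𝕋)`, where `P₊` and `P₋` are the projections to `H²`
and its orthogonal complement. It intertwines multiplication by `z` with `Ṽ`. -/
def dilationIntertwiner (hc : ‖c‖ = 1) : L2 leb →ₗᵢ[ℂ] L2 leb where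
  toLinearMap := (((starRingEnd ℂ) c • (mulTheta hμ).toContinuousLinearMap ∘L H2.starProjection
    + (ContinuousLinearMap.id ℂ (L2 leb) - H2.starProjection) : L2 leb →L[ℂ] L2 leb) :
      L2 leb →ₗ[ℂ] L2 leb)
  norm_map' x := by
    change ‖(starRingEnd ℂ) c • mulTheta hμ (H2.starProjection x)
      + (x - H2.starProjection x)‖ = ‖x‖
    have hp : H2.starProjection x ∈ H2 := H2.starProjection_apply_mem x
    have hm : x - H2.starProjection x ∈ H2ᗮ := H2.sub_starProjection_mem_orthogonal x
    refine (sq_eq_sq₀ (norm_nonneg _) (norm_nonneg _)).1 ?_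
    rw [norm_add_sq (𝕜 := ℂ),
      inner_eq_zero_of_mem_H2 (H2.smul_mem _ (mulTheta_mem_H2 hμ hp)) hm, norm_smul,
      LinearIsometry.norm_map, RCLike.norm_conj, hc, one_mul]
    have h1 : x = H2.starProjection x + (x - H2.starProjection x) := by abel
    have h2 := norm_add_sq (𝕜 := ℂ) (H2.starProjection x) (x - H2.starProjection x)
    rw [← h1, inner_eq_zero_of_mem_H2 hp hm] at h2
    exact h2.symm

theorem dilationIntertwiner_apply (hc : ‖c‖ = 1) (x : L2 leb) : dilationIntertwiner hμ hc x
    = (starRingEnd ℂ) c • mulTheta hμ (H2.starProjection x) + (x - H2.starProjection x) := rfl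

theorem dilationIntertwiner_of_mem (hc : ‖c‖ = 1) {x : L2 leb} (hx : x ∈ H2) :
    dilationIntertwiner hμ hc x = (starRingEnd ℂ) c • mulTheta hμ x := by
  rw [dilationIntertwiner_apply, Submodule.starProjection_eq_self_iff.2 hx, sub_self, add_zero]

theorem dilationIntertwiner_of_mem_orthogonal (hc : ‖c‖ = 1) {x : L2 leb} (hx : x ∈ H2ᗮ) :
    dilationIntertwiner hμ hc x = x := by
  rw [dilationIntertwiner_apply, (Submodule.starProjection_apply_eq_zero_iff H2).2 hx]
  simp

theorem modelVtilde_dilationIntertwiner (hc : ‖c‖ = 1) (x : L2 leb) :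
    modelVtilde μ c (dilationIntertwiner hμ hc x) = dilationIntertwiner hμ hc (mulZ leb x) := by
  have hp : H2.starProjection x ∈ H2 := H2.starProjection_apply_mem x
  have hm : x - H2.starProjection x ∈ H2ᗮ := H2.sub_starProjection_mem_orthogonal x
  have h1 : x = H2.starProjection x + (x - H2.starProjection x) := by abel
  obtain ⟨y, hy, e⟩ := exists_eq_of_mem_H2_orthogonal hm
  have e1 : modelVtilde μ c (dilationIntertwiner hμ hc (H2.starProjection x))
      = dilationIntertwiner hμ hc (mulZ leb (H2.starProjection x)) := by
    rw [dilationIntertwiner_of_mem hμ hc hp, dilationIntertwiner_of_mem hμ hc (mulZ_mem_H2 ⟨_, hp⟩),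
      map_smul]
    congr 1
    have h2 := modelVtilde_of_mem_H2 (μ := μ) (c := c) ⟨_, mulTheta_mem_H2 hμ hp⟩
    rw [modelV_mulTheta hμ hp] at h2
    exact h2
  have e2 : modelVtilde μ c (dilationIntertwiner hμ hc (x - H2.starProjection x))
      = dilationIntertwiner hμ hc (mulZ leb (x - H2.starProjection x)) := by
    have h0 : zmon 0 ∈ H2 := zmon_mem_H2 0
    rw [dilationIntertwiner_of_mem_orthogonal hμ hc hm, e, map_add, map_add, map_add, map_smul,
      map_smul, map_smul, modelVtilde_zmon_neg_one, modelVtilde_mulZEquiv_symm hy, mulZ_zmon,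
      mulZ_mulZEquiv_symm, neg_add_cancel, dilationIntertwiner_of_mem hμ hc h0,
      mulTheta_zmon_zero, dilationIntertwiner_of_mem_orthogonal hμ hc hy]
  rw [h1, map_add, map_add, map_add, map_add, e1, e2]

/-- The unitary equivalence of `L²(μ)` and the model space, as an isometry into `L²(𝕋)`. -/
theorem exists_isometry_modelSpace : ∃ a : L2 μ →ₗᵢ[ℂ] L2 leb,
    (∀ u, a u ∈ H2) ∧ (∀ u, modelVtilde μ c (a u) = a (mulZ μ u)) ∧
    ∀ hc : ‖c‖ = 1, IsOrthogonalSum a (dilationIntertwiner hμ hc) := by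
  obtain ⟨Ω, hΩ⟩ := isMulZOn_modelV hμ
  refine ⟨H2.subtypeₗᵢ.comp ((modelSpace (clarkFn μ)).subtypeₗᵢ.comp Ω.toLinearIsometry),
    fun u => (Ω u : H2).2, fun u => ?_, fun hc => ⟨fun u v => ?_, fun x => ?_⟩⟩
  · change modelVtilde μ c ((Ω u : H2) : L2 leb) = ((Ω (mulZ μ u) : H2) : L2 leb)
    rw [modelVtilde_of_mem_H2, hΩ]
  · change inner ℂ ((Ω u : H2) : L2 leb) _ = _
    rw [dilationIntertwiner_apply, inner_add_right, inner_smul_right,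
      inner_eq_zero_of_mem_H2 (Ω u : H2).2 (H2.sub_starProjection_mem_orthogonal v),
      ← inner_conj_symm,
      (mem_modelSpace hμ).1 (Ω u).2 _ (H2.starProjection_apply_mem v)]
    simp
  · have hp : H2.starProjection x ∈ H2 := H2.starProjection_apply_mem x
    have hm : x - H2.starProjection x ∈ H2ᗮ := H2.sub_starProjection_mem_orthogonal x
    have hcl : IsClosed (modelSpace (clarkFn μ) : Set H2) := Submodule.isClosed_orthogonal _
    have hcm : CompleteSpace (modelSpace (clarkFn μ)) := hcl.completeSpace_coe
    obtain ⟨k, hk, w, hw, e⟩ :=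
      (modelSpace (clarkFn μ)).exists_add_mem_mem_orthogonal ⟨_, hp⟩
    rw [modelSpace_orthogonal hμ] at hw
    obtain ⟨h, hh⟩ := (mem_innerH2 hμ).1 hw
    refine ⟨Ω.symm ⟨k, hk⟩, c • (h : L2 leb) + (x - H2.starProjection x), ?_⟩
    change x = ((Ω (Ω.symm ⟨k, hk⟩) : H2) : L2 leb) + _
    have hcc : (starRingEnd ℂ) c * c = 1 := by
      rw [mul_comm, Complex.mul_conj, Complex.normSq_eq_norm_sq, hc]; norm_num
    rw [LinearIsometryEquiv.apply_symm_apply, map_add, map_smul,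
      dilationIntertwiner_of_mem hμ hc h.2, dilationIntertwiner_of_mem_orthogonal hμ hc hm,
      smul_smul, mul_comm, hcc, one_smul, ← hh, ← add_assoc]
    have e' : H2.starProjection x = (k : L2 leb) + (w : L2 leb) := congrArg Subtype.val e
    rw [← e']
    abel

theorem modelVtilde_spec (hc : ‖c‖ = 1) :
    (∀ f, ‖modelVtilde μ c f‖ = ‖f‖) ∧ Function.Surjective (modelVtilde μ c) := by
  obtain ⟨a, -, ha, hs⟩ := exists_isometry_modelSpace hμ (c := c)
  rw [(hs hc).eq_glue ha (modelVtilde_dilationIntertwiner hμ hc)]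
  have hsurj : ∀ ν : Measure UnitAddCircle, Function.Surjective (mulZ ν) :=
    fun ν f => ⟨_, mulZ_mulZEquiv_symm f⟩
  exact ⟨(hs hc).norm_glue norm_mulZ norm_mulZ, (hs hc).glue_surjective (hsurj _) (hsurj _)⟩

theorem adjoint_modelVtilde_of_mem (hc : ‖c‖ = 1) {f : L2 leb} (hf : f ∈ H2ᗮ) :
    ContinuousLinearMap.adjoint (modelVtilde μ c) f = (mulZEquiv leb).symm f := by
  have h := adjoint_apply_apply_of_norm_map (modelVtilde_spec hμ hc).1 ((mulZEquiv leb).symm f)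
  rwa [modelVtilde_mulZEquiv_symm hf] at h

/-- The backward orbit of `θ` under `Ṽ` consists of the negative powers of `z`; this is what makes the
dilation minimal. -/
theorem adjoint_modelVtilde_pow_bdry (hc : ‖c‖ = 1) (n : ℕ) :
    (ContinuousLinearMap.adjoint (modelVtilde μ c) ^ (n + 1)) (bdry (clarkFn μ))
      = c • zmon (-(n + 1 : ℤ)) := by
  have hcc : c * (starRingEnd ℂ) c = 1 := by
    rw [Complex.mul_conj, Complex.normSq_eq_norm_sq, hc]; norm_num
  induction n with
  | zero =>
    have h := adjoint_apply_apply_of_norm_map (modelVtilde_spec hμ hc).1 (zmon (-1))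
    rw [modelVtilde_zmon_neg_one, map_smul] at h
    rw [zero_add, pow_one]
    have h2 : -(((0 : ℕ) : ℤ) + 1) = -1 := by norm_num
    rw [h2, ← h, smul_smul, hcc, one_smul]
  | succ n ih =>
    have hm : zmon (-(n + 1 : ℤ)) ∈ H2ᗮ := by
      rw [mem_H2_orthogonal]
      intro k hk
      rw [inner_zmon, if_neg (by omega)]
    rw [pow_succ', mul_apply_eq_comp, ih, map_smul, adjoint_modelVtilde_of_mem hμ hc hm,
      mulZEquiv_symm_zmon]
    have h3 : -(n + 1 : ℤ) - 1 = -(((n + 1 : ℕ) : ℤ) + 1) := by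
      push_cast
      ring
    rw [h3]

theorem isUnitaryDilation_modelVtilde (hc : ‖c‖ = 1) :
    IsUnitaryDilation H2 (modelV μ) (modelVtilde μ c) where
  unitary := mem_unitary_of_surjective (modelVtilde_spec hμ hc).1 (modelVtilde_spec hμ hc).2
  compression n f := by
    have h : (modelVtilde μ c ^ n) (f : L2 leb) = ((modelV μ ^ n) f : H2) := by
      induction n with
      | zero => rfl
      | succ n ih =>
        rw [pow_succ', mul_apply_eq_comp, ih, modelVtilde_of_mem_H2, pow_succ', mul_apply_eq_comp]
    rw [h]
    exact Submodule.orthogonalProjectionOnto_mem_subspace_eq_self _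
  minimal := by
    rw [Submodule.topologicalClosure_eq_top_iff, Submodule.eq_bot_iff]
    intro f hf
    rw [Submodule.mem_orthogonal] at hf
    refine eq_zero_of_inner_zmon fun n => hf _ ?_
    rcases lt_or_ge n 0 with hn | hn
    · obtain ⟨k, rfl⟩ : ∃ k : ℕ, n = -(k + 1 : ℤ) := ⟨(-n - 1).toNat, by omega⟩
      have hcc : (starRingEnd ℂ) c * c = 1 := by
        rw [mul_comm, Complex.mul_conj, Complex.normSq_eq_norm_sq, hc]; norm_num
      refine Submodule.mem_sup_right (Submodule.mem_iSup_of_mem (k + 1) ?_)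
      refine ⟨(starRingEnd ℂ) c • bdry (clarkFn μ), H2.smul_mem _ (bdry_mem_H2 _), ?_⟩
      change (ContinuousLinearMap.adjoint (modelVtilde μ c) ^ (k + 1)) _ = _
      rw [map_smul, adjoint_modelVtilde_pow_bdry hμ hc, smul_smul, hcc, one_smul]
    · obtain ⟨k, rfl⟩ := Int.eq_ofNat_of_zero_le hn
      exact Submodule.mem_sup_left (Submodule.mem_iSup_of_mem 0
        ⟨zmon (k : ℤ), zmon_mem_H2 k, rfl⟩)

end Dilation

/-! ### Exponentials on the line -/

/-- The function `x ↦ √2 exp (t - x)` on `(t, ∞)`, extended by zero. -/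
def expTail (t x : ℝ) : ℂ := (Ioi t).indicator (fun x => ((√2 * Real.exp (t - x) : ℝ) : ℂ)) x

theorem memLp_expTail (t : ℝ) : MemLp (expTail t) 2 (volume : Measure ℝ) := by
  have hm : Measurable (expTail t) := Measurable.indicator (by fun_prop) measurableSet_Ioi
  rw [memLp_two_iff_integrable_sq_norm hm.aestronglyMeasurable]
  have h1 : (fun x => ‖expTail t x‖ ^ 2)
      = (Ioi t).indicator fun x => 2 * Real.exp (2 * t) * Real.exp (-2 * x) := by
    funext x
    by_cases hx : x ∈ Ioi t
    · rw [expTail, indicator_of_mem hx, indicator_of_mem hx, Complex.norm_real, Real.norm_eq_abs,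
        sq_abs, mul_pow, Real.sq_sqrt (by norm_num), ← Real.exp_nat_mul, mul_assoc, ← Real.exp_add]
      congr 2
      push_cast
      ring
    · rw [expTail, indicator_of_notMem hx, indicator_of_notMem hx]
      simp
  rw [h1, integrable_indicator_iff measurableSet_Ioi]
  exact (integrableOn_exp_mul_Ioi (by norm_num) t).const_mul _

/-- The vector `√2 exp (t - x)`, `x > t`, of `L²(ℝ)`. -/
def lineExp (t : ℝ) : L2R := (memLp_expTail t).toLp _

theorem coeFn_lineExp (t : ℝ) : ⇑(lineExp t) =ᵐ[volume] expTail t := (memLp_expTail t).coeFn_toLp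

theorem coeFn_shiftR (t : ℝ) (f : L2R) : ⇑(shiftR t f) =ᵐ[volume] fun x => f (x - t) :=
  Lp.coeFn_compMeasurePreserving f (measurePreserving_sub_right (volume : Measure ℝ) t)

theorem shiftR_add (t s : ℝ) (f : L2R) : shiftR (t + s) f = shiftR t (shiftR s f) := by
  apply Lp.ext
  filter_upwards [coeFn_shiftR (t + s) f, coeFn_shiftR t (shiftR s f),
    (measurePreserving_sub_right (volume : Measure ℝ) t).quasiMeasurePreserving.ae
      (coeFn_shiftR s f)] with x h1 h2 h3
  rw [h1, h2, h3, sub_sub]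

theorem shiftR_zero (f : L2R) : shiftR 0 f = f := by
  apply Lp.ext
  filter_upwards [coeFn_shiftR 0 f] with x h1
  rw [h1, sub_zero]

theorem shiftR_lineExp (t s : ℝ) : shiftR t (lineExp s) = lineExp (t + s) := by
  apply Lp.ext
  filter_upwards [coeFn_shiftR t (lineExp s), coeFn_lineExp (t + s),
    (measurePreserving_sub_right (volume : Measure ℝ) t).quasiMeasurePreserving.ae
      (coeFn_lineExp s)] with x h1 h2 h3
  rw [h1, h2, h3]
  by_cases hx : x ∈ Ioi (t + s)
  · have hx' : x - t ∈ Ioi s := by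
      rw [mem_Ioi] at hx ⊢
      linarith
    rw [expTail, expTail, indicator_of_mem hx, indicator_of_mem hx']
    congr 3
    ring
  · have hx' : x - t ∉ Ioi s := by
      rw [mem_Ioi] at hx ⊢
      linarith
    rw [expTail, expTail, indicator_of_notMem hx, indicator_of_notMem hx']

theorem lineExp_mem_L2plus {t : ℝ} (ht : 0 ≤ t) : lineExp t ∈ L2plus := by
  rw [mem_L2plus]
  filter_upwards [coeFn_lineExp t] with x h1 hx
  rw [h1, expTail, indicator_of_notMem]
  rw [mem_Ioi]
  linarith

theorem inner_lineExp (t : ℝ) (f : L2R) :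
    inner ℂ (lineExp t) f = ∫ x in Ioi t, ((√2 * Real.exp (t - x) : ℝ) : ℂ) * f x := by
  rw [L2.inner_def, ← integral_indicator measurableSet_Ioi]
  refine integral_congr_ae ?_
  filter_upwards [coeFn_lineExp t] with x h1
  rw [h1, RCLike.inner_apply, expTail]
  by_cases hx : x ∈ Ioi t
  · rw [indicator_of_mem hx, indicator_of_mem hx, Complex.conj_ofReal, mul_comm]
  · rw [indicator_of_notMem hx, indicator_of_notMem hx, map_zero, mul_zero]

theorem inner_lineExp_lineExp {s t : ℝ} (h : s ≤ t) :
    inner ℂ (lineExp s) (lineExp t) = ((Real.exp (s - t) : ℝ) : ℂ) := by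
  rw [← inner_conj_symm, inner_lineExp]
  have h1 : ∫ x in Ioi t, ((√2 * Real.exp (t - x) : ℝ) : ℂ) * lineExp s x
      = ∫ x in Ioi t, ((2 * Real.exp (s + t) * Real.exp (-2 * x) : ℝ) : ℂ) := by
    refine setIntegral_congr_ae measurableSet_Ioi ?_
    filter_upwards [coeFn_lineExp s] with x h1 hx
    have hx' : x ∈ Ioi s := lt_of_le_of_lt h hx
    rw [h1, expTail, indicator_of_mem hx', ← Complex.ofReal_mul]
    congr 1
    have e : √2 * √2 = 2 := Real.mul_self_sqrt (by norm_num)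
    calc √2 * Real.exp (t - x) * (√2 * Real.exp (s - x))
        = (√2 * √2) * (Real.exp (t - x) * Real.exp (s - x)) := by ring
      _ = 2 * Real.exp (s + t) * Real.exp (-2 * x) := by
        rw [e, ← Real.exp_add, mul_assoc, ← Real.exp_add]
        congr 2
        ring
  rw [h1, integral_complex_ofReal, Complex.conj_ofReal, integral_const_mul,
    integral_exp_mul_Ioi (by norm_num)]
  congr 1
  have e : Real.exp (s - t) = Real.exp (s + t) * Real.exp (-2 * t) := by
    rw [← Real.exp_add]
    congr 1
    ring
  rw [e]
  ring

/-- By Lebesgue's differentiation theorem, a function orthogonal to all the tails of the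
exponential beyond `a` vanishes beyond `a`. -/
theorem ae_eq_zero_of_inner_lineExp {f : L2R} {a : ℝ}
    (h : ∀ t, a ≤ t → inner ℂ (lineExp t) f = 0) : ∀ᵐ x : ℝ, a < x → f x = 0 := by
  set g : ℝ → ℂ := fun x => ((Real.exp (-x) : ℝ) : ℂ) * f x with hg
  have hs : ((√2 : ℝ) : ℂ) ≠ 0 := by
    rw [Complex.ofReal_ne_zero]
    positivity
  have hgi : ∀ t, IntegrableOn g (Ioi t) := by
    intro t
    have h1 : Integrable (fun x => inner ℂ (lineExp t x) (f x)) (volume : Measure ℝ) :=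
      L2.integrable_inner (lineExp t) f
    have h2 := (h1.integrableOn (s := Ioi t)).const_mul
      ((((√2 : ℝ) : ℂ))⁻¹ * ((Real.exp (-t) : ℝ) : ℂ))
    refine h2.congr ?_
    filter_upwards [ae_restrict_of_ae (coeFn_lineExp t), ae_restrict_mem measurableSet_Ioi]
      with x h3 hx
    rw [h3, RCLike.inner_apply, expTail, indicator_of_mem hx, Complex.conj_ofReal, hg]
    have e : Real.exp (-t) * Real.exp (t - x) = Real.exp (-x) := by
      rw [← Real.exp_add]
      congr 1
      ring
    simp only
    rw [← e, Complex.ofReal_mul, Complex.ofReal_mul]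
    field_simp
  have hgl : LocallyIntegrable g volume := by
    intro x
    exact ⟨Ioi (x - 1), Ioi_mem_nhds (by linarith), hgi _⟩
  have hg0 : ∀ t, a ≤ t → ∫ x in Ioi t, g x = 0 := by
    intro t ht
    have h1 := h t ht
    rw [inner_lineExp] at h1
    have h2 : ∀ x, ((√2 * Real.exp (t - x) : ℝ) : ℂ) * f x
        = (((√2 : ℝ) : ℂ) * ((Real.exp t : ℝ) : ℂ)) * g x := by
      intro x
      rw [hg, sub_eq_add_neg, Real.exp_add]
      push_cast
      ring
    simp only [h2] at h1
    rw [integral_const_mul] at h1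
    exact (mul_eq_zero.1 h1).resolve_left (mul_ne_zero hs (by
      rw [Complex.ofReal_ne_zero]
      exact (Real.exp_pos t).ne'))
  filter_upwards [LocallyIntegrable.ae_hasDerivAt_integral hgl] with x hx hax
  have h1 := hx a
  have h2 : (fun y => ∫ t in a..y, g t) =ᶠ[𝓝 x] fun _ => 0 := by
    filter_upwards [Ioi_mem_nhds hax] with y hy
    have h3 := intervalIntegral.integral_interval_add_Ioi (hgi a) (hgi y)
    rw [hg0 a le_rfl, hg0 y (le_of_lt hy), add_zero] at h3
    exact h3
  have h4 := h1.unique ((hasDerivAt_const x (0 : ℂ)).congr_of_eventuallyEq h2)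
  have h5 : ((Real.exp (-x) : ℝ) : ℂ) ≠ 0 := Complex.ofReal_ne_zero.2 (Real.exp_pos _).ne'
  exact (mul_eq_zero.1 h4).resolve_left h5

theorem eq_zero_of_inner_lineExp {f : L2R} (h : ∀ t, inner ℂ (lineExp t) f = 0) : f = 0 := by
  rw [Lp.eq_zero_iff_ae_eq_zero]
  have h1 : ∀ᵐ x : ℝ, ∀ n : ℕ, -(n : ℝ) < x → f x = 0 :=
    ae_all_iff.2 fun n => ae_eq_zero_of_inner_lineExp fun t _ => h t
  filter_upwards [h1] with x hx
  obtain ⟨n, hn⟩ := exists_nat_gt (-x)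
  exact hx n (by linarith)

theorem eq_zero_of_mem_L2plus {f : L2R} (hf : f ∈ L2plus)
    (h : ∀ t, 0 ≤ t → inner ℂ (lineExp t) f = 0) : f = 0 := by
  rw [Lp.eq_zero_iff_ae_eq_zero]
  filter_upwards [mem_L2plus.1 hf, ae_eq_zero_of_inner_lineExp h, Measure.ae_ne volume (0 : ℝ)]
    with x h1 h2 h3
  rcases lt_or_gt_of_ne h3 with h4 | h4
  · exact h1 h4
  · exact h2 h4

/-! ### Exponentials of the Cayley transform in the disc -/

/-- The function `exp (t (z + 1) / (z - 1))`. -/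
def discExp (t : ℝ) (z : ℂ) : ℂ := Complex.exp ((t : ℂ) * ((z + 1) / (z - 1)))

theorem sub_one_ne_zero_of_mem_ball {z : ℂ} (hz : z ∈ Metric.ball (0 : ℂ) 1) : z - 1 ≠ 0 := by
  intro h
  rw [sub_eq_zero.1 h] at hz
  simp at hz

theorem differentiableOn_discExp (t : ℝ) : DifferentiableOn ℂ (discExp t) (Metric.ball 0 1) :=
  fun z hz => by
    have h := sub_one_ne_zero_of_mem_ball hz
    unfold discExp
    exact DifferentiableAt.differentiableWithinAt (by fun_prop (disch := assumption))

theorem norm_discExp_le {t : ℝ} (ht : 0 ≤ t) {z : ℂ} (hz : z ∈ Metric.ball (0 : ℂ) 1) :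
    ‖discExp t z‖ ≤ 1 := by
  rw [discExp, Complex.norm_exp, Complex.re_ofReal_mul, Real.exp_le_one_iff]
  refine mul_nonpos_of_nonneg_of_nonpos ht ?_
  have h1 : Complex.normSq z < 1 := by
    rw [mem_ball_zero_iff] at hz
    rw [Complex.normSq_eq_norm_sq]
    nlinarith [norm_nonneg z]
  have h2 : ((z + 1) / (z - 1)).re = (Complex.normSq z - 1) / Complex.normSq (z - 1) := by
    rw [Complex.div_re, ← add_div, Complex.normSq_apply z]
    congr 1
    simp
    ring
  rw [h2]
  exact div_nonpos_of_nonpos_of_nonneg (by linarith) (Complex.normSq_nonneg _)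

/-- The orbit of the function `1` under the group `exp (t (z + 1) / (z - 1))`. -/
def circleExp (t : ℝ) : L2 leb := cayleyGroup leb t (zmon 0)

theorem leb_singleton_zero : leb {(0 : UnitAddCircle)} = 0 := by
  have h := AddCircle.volume_closedBall (T := 1) (x := 0) 0
  rw [Metric.closedBall_zero, AddCircle.volume_eq_smul_haarAddCircle] at h
  simpa using h

/-- For `t ≥ 0` the function `exp (t (z + 1) / (z - 1))` is the boundary function of a bounded analytic
function, and thus lies in `H²`. -/
theorem circleExp_eq_bdry {t : ℝ} (ht : 0 ≤ t) : circleExp t = bdry (discExp t) := by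
  apply Lp.ext
  have h1 : ⇑(bdry (discExp t)) =ᵐ[leb] expCayley t := by
    refine bdry_ae_eq_of_tendsto (differentiableOn_discExp t) (summable_taylorCoeff_sq
      (differentiableOn_discExp t) fun z hz => norm_discExp_le ht hz) ?_
    have h0 : ∀ᵐ x ∂leb, x ≠ 0 := by
      rw [ae_iff]
      simpa using! leb_singleton_zero
    filter_upwards [h0] with x hx
    have hx' : pt x - 1 ≠ 0 := sub_ne_zero.2 fun h => hx (pt_eq_one_iff.1 h)
    have hc : ContinuousAt (fun r : ℝ => discExp t ((r : ℂ) * pt x)) 1 := by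
      unfold discExp
      have hx2 : (((1 : ℝ) : ℂ) * pt x) - 1 ≠ 0 := by
        rwa [Complex.ofReal_one, one_mul]
      fun_prop (disch := assumption)
    have h2 := hc.tendsto.mono_left (nhdsWithin_le_nhds (s := Iio 1))
    simp only [Complex.ofReal_one, one_mul] at h2
    exact h2
  filter_upwards [h1, coeFn_cayleyGroup t (zmon 0), coeFn_zmon 0] with x e1 e2 e3
  rw [e1, circleExp, e2, e3]
  simp

theorem inner_zmon_zero_circleExp {t : ℝ} (ht : 0 ≤ t) :
    inner ℂ (zmon 0) (circleExp t) = ((Real.exp (-t) : ℝ) : ℂ) := by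
  have h := inner_zmon_bdry (summable_taylorCoeff_sq (differentiableOn_discExp t)
    fun z hz => norm_discExp_le ht hz) 0
  rw [← circleExp_eq_bdry ht] at h
  rw [Nat.cast_zero] at h
  rw [h, taylorCoeff, iteratedDeriv_zero, Nat.factorial_zero, discExp]
  simp

theorem cayleyGroup_circleExp (t s : ℝ) :
    cayleyGroup leb t (circleExp s) = circleExp (t + s) :=
  (cayleyGroup_add t s _).symm

theorem inner_cayleyGroup (t : ℝ) (f g : L2 leb) :
    inner ℂ (cayleyGroup leb t f) (cayleyGroup leb t g) = inner ℂ f g :=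
  inner_map_of_norm_map (norm_cayleyGroup t) f g

theorem circleExp_zero : circleExp 0 = zmon 0 := cayleyGroup_zero _

theorem inner_circleExp {s t : ℝ} (h : s ≤ t) :
    inner ℂ (circleExp s) (circleExp t) = ((Real.exp (s - t) : ℝ) : ℂ) := by
  have e1 : circleExp s = cayleyGroup leb s (zmon 0) := rfl
  have e2 : circleExp t = cayleyGroup leb s (circleExp (t - s)) := by
    rw [cayleyGroup_circleExp, add_sub_cancel]
  rw [e1, e2, inner_cayleyGroup, inner_zmon_zero_circleExp (by linarith), neg_sub]

/-- Both families have the Gram matrix `exp (-|s - t|)`. -/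
theorem inner_lineExp_eq_inner_circleExp (s t : ℝ) :
    inner ℂ (lineExp s) (lineExp t) = inner ℂ (circleExp s) (circleExp t) := by
  rcases le_total s t with h | h
  · rw [inner_lineExp_lineExp h, inner_circleExp h]
  · rw [← inner_conj_symm, inner_lineExp_lineExp h, ← inner_conj_symm (circleExp s),
      inner_circleExp h]

theorem circleExp_mem_H2 {t : ℝ} (ht : 0 ≤ t) : circleExp t ∈ H2 := by
  rw [circleExp_eq_bdry ht]
  exact bdry_mem_H2 _

theorem isContractionSemigroup_cayleyGroup_neg :
    IsContractionSemigroup fun t => cayleyGroup leb (-t) :=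
  isContractionSemigroup_cayleyGroup.inverse (fun t _ f => norm_cayleyGroup t f) fun t _ f => by
    rw [← cayleyGroup_add, add_neg_cancel, cayleyGroup_zero]

theorem isCogenerator_cayleyGroup_neg : IsCogenerator (fun t => cayleyGroup leb (-t))
    ((mulZEquiv leb).symm : L2 leb →L[ℂ] L2 leb) := by
  obtain ⟨C, hC, -⟩ := isContractionSemigroup_cayleyGroup_neg.exists_cogenerator
  have h : C = ((mulZEquiv leb).symm : L2 leb →L[ℂ] L2 leb) := by
    ext1 u
    have h1 := (isCogenerator_cayleyGroup leb_singleton_zero).apply_apply_of_inverse hC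
      isContractionSemigroup_cayleyGroup (fun t _ f => by
        rw [← cayleyGroup_add, add_neg_cancel, cayleyGroup_zero]) u
    change C u = (mulZEquiv leb).symm u
    rw [← mulZEquiv_symm_mulZ (C u), h1]
  rwa [← h]

/-- A function orthogonal to the functions `exp (t (z + 1) / (z - 1))`, `t ≥ 0`, is orthogonal to
`H²`: those functions span a subspace whose complement is invariant under the inverse group, hence
under multiplication by `z̄`. -/
theorem mem_H2_orthogonal_of_inner_circleExp {f : L2 leb}
    (h : ∀ t, 0 ≤ t → inner ℂ (circleExp t) f = 0) : f ∈ H2ᗮ := by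
  set M : Submodule ℂ (L2 leb) := (Submodule.span ℂ (circleExp '' Ici 0))ᗮ with hM
  have hmem : ∀ g, g ∈ M ↔ ∀ t, 0 ≤ t → inner ℂ (circleExp t) g = 0 := by
    intro g
    rw [hM, Submodule.mem_orthogonal]
    refine ⟨fun h t ht => h _ (Submodule.subset_span ⟨t, ht, rfl⟩), fun h u hu => ?_⟩
    induction hu using Submodule.span_induction with
    | mem x hx =>
      obtain ⟨t, ht, rfl⟩ := hx
      exact h t ht
    | zero => exact inner_zero_left _
    | add x y _ _ hx hy => rw [inner_add_left, hx, hy, add_zero]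
    | smul c x _ hx => rw [inner_smul_left, hx, mul_zero]
  have hinv : ∀ g ∈ M, (mulZEquiv leb).symm g ∈ M := fun g hg =>
    isCogenerator_cayleyGroup_neg.mem_of_invariant isContractionSemigroup_cayleyGroup_neg
      (Submodule.isClosed_orthogonal _) (fun t ht g hg => (hmem _).2 fun s hs => by
        rw [← inner_cayleyGroup t, cayleyGroup_circleExp, ← cayleyGroup_add, add_neg_cancel,
          cayleyGroup_zero]
        exact (hmem g).1 hg _ (add_nonneg ht hs)) hg
  have key : ∀ (n : ℕ), ∀ g ∈ M, inner ℂ (zmon (n : ℤ)) g = 0 := by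
    intro n
    induction n with
    | zero =>
      intro g hg
      rw [Nat.cast_zero, ← circleExp_zero]
      exact (hmem g).1 hg 0 le_rfl
    | succ n ih =>
      intro g hg
      have h1 := ih _ (hinv g hg)
      rw [inner_zmon_mulZEquiv_symm] at h1
      exact_mod_cast h1
  rw [mem_H2_orthogonal]
  intro n hn
  obtain ⟨k, rfl⟩ := Int.eq_ofNat_of_zero_le hn
  exact key k f ((hmem f).2 h)

/-- The span of the whole orbit of `1` is invariant under multiplication by `z` and by `z̄`. -/
theorem eq_zero_of_inner_circleExp {f : L2 leb} (h : ∀ t, inner ℂ (circleExp t) f = 0) :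
    f = 0 := by
  set M : Submodule ℂ (L2 leb) := (Submodule.span ℂ (range circleExp))ᗮ with hM
  have hmem : ∀ g, g ∈ M ↔ ∀ t, inner ℂ (circleExp t) g = 0 := by
    intro g
    rw [hM, Submodule.mem_orthogonal]
    refine ⟨fun h t => h _ (Submodule.subset_span ⟨t, rfl⟩), fun h u hu => ?_⟩
    induction hu using Submodule.span_induction with
    | mem x hx =>
      obtain ⟨t, rfl⟩ := hx
      exact h t
    | zero => exact inner_zero_left _
    | add x y _ _ hx hy => rw [inner_add_left, hx, hy, add_zero]
    | smul c x _ hx => rw [inner_smul_left, hx, mul_zero]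
  have hinv : ∀ g ∈ M, mulZ leb g ∈ M := fun g hg =>
    (isCogenerator_cayleyGroup leb_singleton_zero).mem_of_invariant
      isContractionSemigroup_cayleyGroup
      (Submodule.isClosed_orthogonal _) (fun t _ g hg => (hmem _).2 fun s => by
        rw [← inner_cayleyGroup (-t), cayleyGroup_circleExp, ← cayleyGroup_add, neg_add_cancel,
          cayleyGroup_zero]
        exact (hmem g).1 hg _) hg
  have key : ∀ (n : ℕ), ∀ g ∈ M, inner ℂ (zmon (-(n : ℤ))) g = 0 := by
    intro n
    induction n with
    | zero =>
      intro g hg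
      rw [Nat.cast_zero, neg_zero, ← circleExp_zero]
      exact (hmem g).1 hg 0
    | succ n ih =>
      intro g hg
      have h1 := ih _ (hinv g hg)
      rw [inner_zmon_mulZ] at h1
      have e : -((n + 1 : ℕ) : ℤ) = -(n : ℤ) - 1 := by
        push_cast
        ring
      rw [e]
      exact h1
  refine eq_zero_of_inner_zmon fun n => ?_
  rcases le_total 0 n with hn | hn
  · exact mem_H2_orthogonal.1 (mem_H2_orthogonal_of_inner_circleExp fun t _ => h t) n hn
  · obtain ⟨k, hk⟩ := Int.eq_ofNat_of_zero_le (neg_nonneg.2 hn)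
    have e : n = -(k : ℤ) := by omega
    rw [e]
    exact key k f ((hmem f).2 h)

/-- The unitary operator `L²(ℝ) → L²(𝕋)` carrying the shifts to the multiplications by
`exp (t (z + 1) / (z - 1))`; it maps `L²(ℝ₊)` onto `H²`. -/
theorem exists_lineToCircle : ∃ (J : L2R ≃ₗᵢ[ℂ] L2 leb) (Jp : L2plus ≃ₗᵢ[ℂ] H2),
    (∀ f : L2plus, J f = Jp f) ∧ ∀ t f, J (shiftR t f) = cayleyGroup leb t (J f) := by
  obtain ⟨J, hJ⟩ := exists_equiv_of_gram inner_lineExp_eq_inner_circleExp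
    (fun f => eq_zero_of_inner_lineExp) (fun f => eq_zero_of_inner_circleExp)
  obtain ⟨Jp, hJp⟩ := exists_equiv_of_gram
    (x := fun t : Ici (0 : ℝ) => (⟨lineExp t, lineExp_mem_L2plus t.2⟩ : L2plus))
    (y := fun t : Ici (0 : ℝ) => (⟨circleExp t, circleExp_mem_H2 t.2⟩ : H2))
    (fun s t => inner_lineExp_eq_inner_circleExp s t)
    (fun f hf => Subtype.ext (eq_zero_of_mem_L2plus f.2 fun t ht => hf ⟨t, ht⟩))
    (fun f hf => Subtype.ext (by
      have h1 := mem_H2_orthogonal_of_inner_circleExp fun t ht => hf ⟨t, ht⟩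
      have h2 := (Submodule.mem_orthogonal _ _).1 h1 f f.2
      exact inner_self_eq_zero.1 h2))
  refine ⟨J, Jp, fun f => ?_, fun t f => ?_⟩
  · have h := eq_of_eq_on_complete
      (x := fun t : Ici (0 : ℝ) => (⟨lineExp t, lineExp_mem_L2plus t.2⟩ : L2plus))
      (fun f hf => Subtype.ext (eq_zero_of_mem_L2plus f.2 fun t ht => hf ⟨t, ht⟩))
      (A := (J : L2R →L[ℂ] L2 leb) ∘L L2plus.subtypeL)
      (B := H2.subtypeL ∘L (Jp : L2plus →L[ℂ] H2)) (fun t => by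
        change J (lineExp t) = ((Jp _ : H2) : L2 leb)
        rw [hJ, hJp])
    exact congrArg (fun A : L2plus →L[ℂ] L2 leb => A f) h
  · have h := eq_of_eq_on_complete (fun f => eq_zero_of_inner_lineExp)
      (A := (J : L2R →L[ℂ] L2 leb) ∘L shiftR t)
      (B := cayleyGroup leb t ∘L (J : L2R →L[ℂ] L2 leb)) (fun s => by
        change J (shiftR t (lineExp s)) = cayleyGroup leb t (J (lineExp s))
        rw [shiftR_lineExp, hJ, hJ, cayleyGroup_circleExp])
    exact congrArg (fun A : L2R →L[ℂ] L2 leb => A f) h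

/-! ### Extension by the identity -/

theorem extendById_coe (W : L2plus ≃ₗᵢ[ℂ] L2plus) (f : L2plus) :
    extendById W f = W f := by
  change ((W (L2plus.orthogonalProjectionOnto (f : L2R)) : L2plus) : L2R)
    + ((f : L2R) - L2plus.starProjection (f : L2R)) = _
  rw [Submodule.orthogonalProjectionOnto_mem_subspace_eq_self,
    Submodule.starProjection_eq_self_iff.2 f.2, sub_self, add_zero]

theorem extendById_of_mem_orthogonal (W : L2plus ≃ₗᵢ[ℂ] L2plus) {f : L2R} (hf : f ∈ L2plusᗮ) :
    extendById W f = f := by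
  change ((W (L2plus.orthogonalProjectionOnto f) : L2plus) : L2R)
    + (f - L2plus.starProjection f) = _
  rw [Submodule.orthogonalProjectionOnto_eq_zero_iff.2 hf,
    (Submodule.starProjection_apply_eq_zero_iff L2plus).2 hf]
  simp

theorem exists_eq_add_L2plus (f : L2R) : ∃ p : L2plus, ∃ m ∈ L2plusᗮ, f = p + m := by
  obtain ⟨p, hp, m, hm, h⟩ := L2plus.exists_add_mem_mem_orthogonal f
  exact ⟨⟨p, hp⟩, m, hm, h⟩

theorem norm_sq_add_L2plus (p : L2plus) {m : L2R} (hm : m ∈ L2plusᗮ) :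
    ‖(p : L2R) + m‖ ^ 2 = ‖p‖ ^ 2 + ‖m‖ ^ 2 := by
  rw [norm_add_sq (𝕜 := ℂ), (Submodule.mem_orthogonal _ _).1 hm p p.2]
  simp

theorem norm_extendById (W : L2plus ≃ₗᵢ[ℂ] L2plus) (f : L2R) : ‖extendById W f‖ = ‖f‖ := by
  obtain ⟨p, m, hm, rfl⟩ := exists_eq_add_L2plus f
  refine (sq_eq_sq₀ (norm_nonneg _) (norm_nonneg _)).1 ?_
  rw [map_add, extendById_coe, extendById_of_mem_orthogonal W hm, norm_sq_add_L2plus _ hm,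
    norm_sq_add_L2plus _ hm, LinearIsometryEquiv.norm_map]

theorem extendById_extendById_symm (W : L2plus ≃ₗᵢ[ℂ] L2plus) (f : L2R) :
    extendById W (extendById W.symm f) = f := by
  obtain ⟨p, m, hm, rfl⟩ := exists_eq_add_L2plus f
  rw [map_add, extendById_coe, extendById_of_mem_orthogonal _ hm, map_add, extendById_coe,
    extendById_of_mem_orthogonal _ hm, LinearIsometryEquiv.apply_symm_apply]

theorem norm_shiftR (t : ℝ) (f : L2R) : ‖shiftR t f‖ = ‖f‖ :=
  (Lp.compMeasurePreservingₗᵢ ℂ (fun x : ℝ => x - t)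
    (measurePreserving_sub_right volume t)).norm_map f

theorem shiftR_neg_shiftR (t : ℝ) (f : L2R) : shiftR (-t) (shiftR t f) = f := by
  rw [← shiftR_add, neg_add_cancel, shiftR_zero]

theorem shiftR_shiftR_neg (t : ℝ) (f : L2R) : shiftR t (shiftR (-t) f) = f := by
  rw [← shiftR_add, add_neg_cancel, shiftR_zero]

theorem shiftR_neg_mem_orthogonal {t : ℝ} (ht : 0 ≤ t) {f : L2R} (hf : f ∈ L2plusᗮ) :
    shiftR (-t) f ∈ L2plusᗮ := by
  rw [Submodule.mem_orthogonal] at hf ⊢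
  intro u hu
  rw [← inner_map_of_norm_map (norm_shiftR t), shiftR_shiftR_neg]
  exact hf _ (shiftR_mem_L2plus ht ⟨u, hu⟩)

theorem coe_perturbation (W : ℝ → (L2plus ≃ₗᵢ[ℂ] L2plus)) {t : ℝ} (ht : 0 ≤ t) (f : L2plus) :
    (perturbation W t f : L2R) = perturbationR W t f := by
  have h : shiftR t (f : L2R) = (shiftPlus t f : L2R) := (coe_shiftPlus ht f).symm
  change ((W t (shiftPlus t f) : L2plus) : L2R) = extendById (W t) (shiftR t f)
  rw [h, extendById_coe]

section Restriction

variable {E : Type*} [NormedAddCommGroup E] [InnerProductSpace ℂ E] [CompleteSpace E]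

theorem mem_of_fixes_orthogonal {M : Submodule ℂ E} (hM : IsClosed (M : Set E)) {U : E →L[ℂ] E}
    (hU : ∀ f, ‖U f‖ = ‖f‖) (hfix : ∀ f ∈ Mᗮ, U f = f) {f : E} (hf : f ∈ M) : U f ∈ M := by
  have hc : CompleteSpace M := hM.completeSpace_coe
  rw [← M.orthogonal_orthogonal, Submodule.mem_orthogonal]
  intro u hu
  rw [← hfix u hu, inner_map_of_norm_map hU]
  exact (Submodule.mem_orthogonal' _ _).1 hu f hf

/-- A unitary operator that is the identity on `Mᗮ` restricts to a unitary operator in `M`. -/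
theorem exists_restriction_of_fixes_orthogonal {M : Submodule ℂ E} (hM : IsClosed (M : Set E))
    {U U' : E →L[ℂ] E} (hU : ∀ f, ‖U f‖ = ‖f‖) (hUU' : ∀ f, U (U' f) = f)
    (hfix : ∀ f ∈ Mᗮ, U f = f) : ∃ W : M ≃ₗᵢ[ℂ] M, ∀ f : M, (W f : E) = U f := by
  have hc : CompleteSpace M := hM.completeSpace_coe
  have hU' : ∀ f, ‖U' f‖ = ‖f‖ := fun f => by rw [← hU, hUU']
  have hfix' : ∀ f ∈ Mᗮ, U' f = f := fun f hf => by
    have h : U (U' f - f) = 0 := by rw [map_sub, hUU', hfix f hf, sub_self]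
    rw [← sub_eq_zero, ← norm_eq_zero, ← hU, h, norm_zero]
  obtain ⟨W, hW⟩ := exists_equiv_of_gram (E := M) (F := M) (x := fun f : M => f)
    (y := fun f : M => ⟨U f, mem_of_fixes_orthogonal hM hU hfix f.2⟩)
    (fun f g => (inner_map_of_norm_map hU (f : E) (g : E)).symm)
    (fun f hf => inner_self_eq_zero.1 (hf f))
    (fun f hf => by
      have h := hf ⟨U' f, mem_of_fixes_orthogonal hM hU' hfix' f.2⟩
      have e : (⟨U (U' f), mem_of_fixes_orthogonal hM hU hfix
          (mem_of_fixes_orthogonal hM hU' hfix' f.2)⟩ : M) = f := Subtype.ext (hUU' _)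
      rw [e] at h
      exact inner_self_eq_zero.1 h)
  exact ⟨W, fun f => congrArg Subtype.val (hW f)⟩

theorem continuousOn_apply_of_norm_le {T : ℝ → E →L[ℂ] E} {s : Set ℝ}
    (hn : ∀ t ∈ s, ∀ f, ‖T t f‖ ≤ ‖f‖) (hT : ∀ f, ContinuousOn (fun t => T t f) s) {g : ℝ → E}
    (hg : ContinuousOn g s) : ContinuousOn (fun t => T t (g t)) s := by
  intro t ht
  have h1 : Tendsto (fun r => T r (g r - g t)) (𝓝[s] t) (𝓝 0) := by
    have h2 : Tendsto (fun r => ‖g r - g t‖) (𝓝[s] t) (𝓝 0) := by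
      have := (hg t ht).sub (continuousWithinAt_const (b := g t))
      have h3 := this.tendsto.norm
      simpa using h3
    refine squeeze_zero_norm' ?_ h2
    filter_upwards [self_mem_nhdsWithin] with r hr using hn r hr _
  have h2 := h1.add (hT (g t) t ht).tendsto
  rw [zero_add] at h2
  refine h2.congr fun r => ?_
  rw [map_sub, sub_add_cancel]

end Restriction

/-! ### The cocycle of the model -/

section LineToCircle

variable {J : L2R ≃ₗᵢ[ℂ] L2 leb} {Jp : L2plus ≃ₗᵢ[ℂ] H2} (hJ : ∀ f : L2plus, J f = Jp f)
  (hJs : ∀ t f, J (shiftR t f) = cayleyGroup leb t (J f))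

include hJ

theorem lineToCircle_symm_coe (h : H2) : J.symm (h : L2 leb) = Jp.symm h := by
  rw [LinearIsometryEquiv.symm_apply_eq, hJ, LinearIsometryEquiv.apply_symm_apply]

theorem lineToCircle_mem_H2_iff {f : L2R} : J f ∈ H2 ↔ f ∈ L2plus := by
  constructor
  · intro h
    have h1 := lineToCircle_symm_coe hJ ⟨J f, h⟩
    rw [LinearIsometryEquiv.symm_apply_apply] at h1
    rw [h1]
    exact (Jp.symm ⟨J f, h⟩).2
  · intro h
    have h1 := hJ ⟨f, h⟩
    change J f = _ at h1
    rw [h1]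
    exact (Jp ⟨f, h⟩).2

theorem lineToCircle_mem_H2_orthogonal {f : L2R} (hf : f ∈ L2plusᗮ) : J f ∈ H2ᗮ := by
  rw [Submodule.mem_orthogonal] at hf ⊢
  intro u hu
  rw [← LinearIsometryEquiv.apply_symm_apply J u, LinearIsometryEquiv.inner_map_map]
  refine hf _ ((lineToCircle_mem_H2_iff hJ).1 ?_)
  rwa [LinearIsometryEquiv.apply_symm_apply]

theorem lineToCircle_symm_mem_orthogonal {f : L2 leb} (hf : f ∈ H2ᗮ) : J.symm f ∈ L2plusᗮ := by
  rw [Submodule.mem_orthogonal] at hf ⊢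
  intro u hu
  rw [← LinearIsometryEquiv.inner_map_map J, LinearIsometryEquiv.apply_symm_apply]
  exact hf _ ((lineToCircle_mem_H2_iff hJ).2 hu)

omit hJ
include hJs

/-- The cogenerator of the shifts corresponds to multiplication by `z`. -/
theorem exists_cogenerator_shiftR :
    ∃ S : L2R →L[ℂ] L2R, IsCogenerator shiftR S ∧ ∀ f, J (S f) = mulZ leb (J f) := by
  refine ⟨(J.symm : L2 leb →L[ℂ] L2R) ∘L mulZ leb ∘L (J : L2R →L[ℂ] L2 leb), ?_, fun f => ?_⟩
  · refine (isCogenerator_cayleyGroup leb_singleton_zero).transport J.symm (fun t _ f => ?_)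
      fun f => ?_
    · rw [LinearIsometryEquiv.eq_symm_apply, hJs, LinearIsometryEquiv.apply_symm_apply]
    · change J.symm (mulZ leb (J (J.symm f))) = _
      rw [LinearIsometryEquiv.apply_symm_apply]
  · change J (J.symm (mulZ leb (J f))) = _
    rw [LinearIsometryEquiv.apply_symm_apply]

theorem continuous_shiftR (f : L2R) : Continuous fun t => shiftR t f := by
  have h := J.symm.continuous.comp (continuous_cayleyGroup (J f))
  refine h.congr fun t => ?_
  change J.symm (cayleyGroup leb t (J f)) = _
  rw [← hJs, LinearIsometryEquiv.symm_apply_apply]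

include hJ

/-- For `‖c‖ = 1` there is a cocycle for which the model operators are the cogenerators. The
unitary group `T` for which `Ṽ` is the cogenerator is the orthogonal sum of the group with
cogenerator `z` in `L²(μ)` and of the shifts transferred by the operator
`x ↦ c̄ θ P₊ x + P₋ x`; since `T t` coincides with the shift on the functions supported on
`(-∞, -t)`, the operators `T t S̃_{-t}` are the identity on the negative semiaxis, and their
restrictions to the positive one form the cocycle. -/
theorem exists_cocycle {μ : Measure UnitAddCircle} [IsFiniteMeasure μ] (hμ : μ ⟂ₘ leb)
    (h0 : μ {0} = 0) {c : ℂ} (hc : ‖c‖ = 1) :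
    ∃ W : ℝ → (L2plus ≃ₗᵢ[ℂ] L2plus), IsCocycle W ∧
      (∃ C : L2plus →L[ℂ] L2plus, IsCogenerator (perturbation W) C ∧
        ∀ f, Jp (C f) = modelV μ (Jp f)) ∧
      ∃ Ct : L2R →L[ℂ] L2R, IsCogenerator (perturbationR W) Ct ∧
        ∀ f, J (Ct f) = modelVtilde μ c (J f) := by
  obtain ⟨a₀, -, ha₀, hab₀⟩ := exists_isometry_modelSpace (c := c) hμ
  obtain ⟨S, hS, hJS⟩ := exists_cogenerator_shiftR hJs
  set β := dilationIntertwiner hμ hc with hβ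
  let a : L2 μ →ₗᵢ[ℂ] L2R := J.symm.toLinearIsometry.comp a₀
  let b : L2R →ₗᵢ[ℂ] L2R := J.symm.toLinearIsometry.comp (β.comp J.toLinearIsometry)
  have ha : ∀ u, a u = J.symm (a₀ u) := fun u => rfl
  have hb : ∀ v, b v = J.symm (β (J v)) := fun v => rfl
  have hab : IsOrthogonalSum a b := by
    refine ⟨fun u v => ?_, fun x => ?_⟩
    · rw [ha, hb, LinearIsometryEquiv.inner_map_map]
      exact (hab₀ hc).inner_eq_zero _ _
    · obtain ⟨u, v, h⟩ := (hab₀ hc).exists_eq (J x)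
      refine ⟨u, J.symm v, ?_⟩
      rw [ha, hb, LinearIsometryEquiv.apply_symm_apply, ← map_add, ← h,
        LinearIsometryEquiv.symm_apply_apply]
  -- The isometry `b` is the identity on the negative semiaxis, where `T t` is therefore the shift.
  have hbm : ∀ f ∈ L2plusᗮ, b f = f := fun f hf => by
    rw [hb, hβ, dilationIntertwiner_of_mem_orthogonal hμ hc (lineToCircle_mem_H2_orthogonal hJ hf),
      LinearIsometryEquiv.symm_apply_apply]
  let T : ℝ → L2R →L[ℂ] L2R := fun t => glue a b (cayleyGroup μ t) (shiftR t)
  have hTn : ∀ t f, ‖T t f‖ = ‖f‖ := fun t =>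
    hab.norm_glue (norm_cayleyGroup t) (norm_shiftR t)
  have hTadd : ∀ t s f, T (t + s) f = T t (T s f) := fun t s =>
    hab.glue_comp (cayleyGroup_add t s) (shiftR_add t s)
  have hT0 : ∀ f, T 0 f = f := fun f => by
    obtain ⟨u, v, rfl⟩ := hab.exists_eq f
    change glue a b _ _ _ = _
    rw [hab.glue_apply, cayleyGroup_zero, shiftR_zero]
  have hTcont : ∀ f, Continuous fun t => T t f := fun f => by
    obtain ⟨u, v, rfl⟩ := hab.exists_eq f
    refine ((a.continuous.comp (continuous_cayleyGroup u)).add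
      (b.continuous.comp (continuous_shiftR hJs v))).congr fun t => ?_
    exact (hab.glue_apply _ _ u v).symm
  have hTT : ∀ t f, T t (shiftR (-t) (shiftR t (T (-t) f))) = f := fun t f => by
    rw [shiftR_neg_shiftR, ← hTadd, add_neg_cancel, hT0]
  have hfix : ∀ t, 0 ≤ t → ∀ f ∈ L2plusᗮ, T t (shiftR (-t) f) = f := fun t ht f hf => by
    have h := hab.glue_right (cayleyGroup μ t) (shiftR t) (shiftR (-t) f)
    rw [hbm _ (shiftR_neg_mem_orthogonal ht hf), shiftR_shiftR_neg, hbm f hf] at h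
    exact h
  have hex : ∀ t, ∃ W : L2plus ≃ₗᵢ[ℂ] L2plus, 0 ≤ t →
      ∀ f : L2plus, (W f : L2R) = T t (shiftR (-t) f) := fun t => by
    by_cases ht : 0 ≤ t
    · obtain ⟨W, hW⟩ := exists_restriction_of_fixes_orthogonal isClosed_L2plus
        (U := T t ∘L shiftR (-t)) (U' := shiftR t ∘L T (-t))
        (fun f => (hTn t _).trans (norm_shiftR (-t) f)) (hTT t) (hfix t ht)
      exact ⟨W, fun _ => hW⟩
    · exact ⟨LinearIsometryEquiv.refl ℂ L2plus, fun h => absurd h ht⟩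
  choose W hW using hex
  have hext : ∀ t, 0 ≤ t → ∀ f, extendById (W t) f = T t (shiftR (-t) f) := fun t ht f => by
    obtain ⟨p, m, hm, rfl⟩ := exists_eq_add_L2plus f
    rw [map_add, extendById_coe, extendById_of_mem_orthogonal _ hm, hW t ht, map_add, map_add,
      hfix t ht m hm]
  have hpert : ∀ t, 0 ≤ t → ∀ f, perturbationR W t f = T t f := fun t ht f => by
    change extendById (W t) (shiftR t f) = _
    rw [hext t ht, shiftR_neg_shiftR]
  have hCt : IsCogenerator (perturbationR W) (glue a b (mulZ μ) S) :=
    (isCogenerator_cayleyGroup h0).directSum hS a.toContinuousLinearMap b.toContinuousLinearMap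
      hab.exists_eq (fun t ht f => (hpert t ht.le _).trans (hab.glue_left _ _ f))
      (fun t ht f => (hpert t ht.le _).trans (hab.glue_right _ _ f))
      (hab.glue_left _ _) (hab.glue_right _ _)
  have hJCt : ∀ f, J (glue a b (mulZ μ) S f) = modelVtilde μ c (J f) := fun f => by
    obtain ⟨u, v, rfl⟩ := hab.exists_eq f
    rw [hab.glue_apply, map_add, map_add, ha, ha, hb, hb]
    simp only [LinearIsometryEquiv.apply_symm_apply]
    rw [map_add, ha₀, hβ, modelVtilde_dilationIntertwiner hμ hc, hJS]
  refine ⟨W, ⟨fun f => ?_, ?_, fun t s ht hs => ?_⟩, ⟨(Jp.symm : H2 →L[ℂ] L2plus) ∘L modelV μ ∘L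
    (Jp : L2plus →L[ℂ] H2), hCt.restrict (fun t ht f => coe_perturbation W ht.le f) fun f => ?_,
    fun f => ?_⟩, _, hCt, hJCt⟩
  · rw [Topology.IsEmbedding.subtypeVal.isInducing.continuousOn_iff]
    have h := continuousOn_apply_of_norm_le (T := T) (s := Ici 0) (fun t _ f => (hTn t f).le)
      (fun f => (hTcont f).continuousOn)
      (((continuous_shiftR hJs (f : L2R)).comp continuous_neg).continuousOn (s := Ici 0))
    exact h.congr fun t ht => hW t ht f
  · ext1 f
    apply Subtype.ext
    rw [hW 0 le_rfl, neg_zero, shiftR_zero, hT0]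
    rfl
  · ext1 f
    change _ = extendById (W t) (shiftR t (extendById (W s) (shiftR (-t) f)))
    rw [hext _ (add_nonneg ht hs), hext t ht, hext s hs, shiftR_neg_shiftR, ← hTadd, ← shiftR_add,
      neg_add_rev]
  · apply J.injective
    change J ((Jp.symm (modelV μ (Jp f)) : L2plus) : L2R) = _
    rw [hJ, LinearIsometryEquiv.apply_symm_apply, hJCt, hJ, modelVtilde_of_mem_H2]
  · change Jp (Jp.symm (modelV μ (Jp f))) = _
    rw [LinearIsometryEquiv.apply_symm_apply]

end LineToCircle

theorem IsUnimodularValueAtOne.unique {θ : ℂ → ℂ} {c c' : ℂ} (h : IsUnimodularValueAtOne θ c)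
    (h' : IsUnimodularValueAtOne θ c') : c = c' :=
  tendsto_nhds_unique h.2 h'.2

/-- A unimodular constant that equals `θ(1)` whenever `θ(1)` exists and is unimodular; the cocycle
built from it exists in either case. -/
theorem exists_unimodular_eq (θ : ℂ → ℂ) :
    ∃ c : ℂ, ‖c‖ = 1 ∧ ∀ c', IsUnimodularValueAtOne θ c' → c' = c := by
  by_cases h : ∃ c, IsUnimodularValueAtOne θ c
  · obtain ⟨c, hc⟩ := h
    exact ⟨c, hc.1, fun c' hc' => hc'.unique hc⟩
  · exact ⟨1, norm_one, fun c' hc' => absurd ⟨c', hc'⟩ h⟩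

/-! ### Cocyclic perturbations with a given unitary part -/

/-- The indicator function of the point `1` would be an eigenvector of the cogenerator with the
eigenvalue `1`. -/
theorem measure_singleton_zero_of_isMulZOn {E : Type*} [NormedAddCommGroup E]
    [InnerProductSpace ℂ E] {T : ℝ → E →L[ℂ] E} {C : E →L[ℂ] E} (hC : IsCogenerator T C)
    {K : Submodule ℂ E} {μ : Measure UnitAddCircle} [IsFiniteMeasure μ] (hm : IsMulZOn C K μ) :
    μ {0} = 0 := by
  obtain ⟨Ω, hΩ⟩ := hm
  set u : L2 μ := indicatorConstLp 2 (measurableSet_singleton (0 : UnitAddCircle))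
    (measure_ne_top μ _) (1 : ℂ) with hu
  have hcu : ⇑u =ᵐ[μ] ({0} : Set UnitAddCircle).indicator fun _ => (1 : ℂ) :=
    indicatorConstLp_coeFn
  have h1 : mulZ μ u = u := by
    apply Lp.ext
    filter_upwards [coeFn_mulZ μ u, hcu] with x h1 h2
    rw [h1, h2]
    by_cases hx : x ∈ ({0} : Set UnitAddCircle)
    · rw [pt_eq_one_iff.2 hx, one_mul]
    · rw [indicator_of_notMem hx, mul_zero]
  have h2 : (Ω u : E) = 0 := hC.eq_zero_of_apply_eq_self (by rw [← hΩ, h1])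
  have h3 : ‖u‖ = 0 := by
    rw [← Ω.norm_map]
    exact (congrArg norm h2).trans norm_zero
  have h4 : u = 0 := norm_eq_zero.1 h3
  rw [h4] at hcu
  have h5 : ∀ᵐ x ∂μ, x ≠ 0 := by
    filter_upwards [hcu, Lp.coeFn_zero ℂ 2 μ] with x e1 e2 hx
    rw [e2, indicator_of_mem (show x ∈ ({0} : Set UnitAddCircle) from hx)] at e1
    exact zero_ne_one e1
  rw [ae_iff] at h5
  simpa using! h5

section Converse

variable {W : ℝ → (L2plus ≃ₗᵢ[ℂ] L2plus)} (hW : IsCocycle W)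

theorem norm_perturbationR (t : ℝ) (f : L2R) : ‖perturbationR W t f‖ = ‖f‖ :=
  (norm_extendById (W t) _).trans (norm_shiftR t f)

include hW in
theorem isContractionSemigroup_perturbationR : IsContractionSemigroup (perturbationR W) where
  norm_le t _ f := (norm_perturbationR t f).le
  zero f := by
    change extendById (W 0) (shiftR 0 f) = f
    obtain ⟨p, m, hm, rfl⟩ := exists_eq_add_L2plus f
    rw [shiftR_zero, hW.zero, map_add, extendById_coe, extendById_of_mem_orthogonal _ hm]
    rfl
  add t s ht hs f := by
    change extendById (W (t + s)) (shiftR (t + s) f)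
      = extendById (W t) (shiftR t (extendById (W s) (shiftR s f)))
    rw [hW.add t s ht hs]
    change extendById (W t) (shiftR t (extendById (W s) (shiftR (-t) (shiftR (t + s) f)))) = _
    rw [← shiftR_add, neg_add_cancel_left]
  continuousOn f := by
    obtain ⟨J, Jp, -, hJs⟩ := exists_lineToCircle
    refine continuousOn_apply_of_norm_le (T := fun t => extendById (W t))
      (fun t _ f => (norm_extendById (W t) f).le) (fun f => ?_)
      (continuous_shiftR hJs f).continuousOn
    obtain ⟨p, m, hm, rfl⟩ := exists_eq_add_L2plus f
    have h : ContinuousOn (fun t => ((W t p : L2plus) : L2R) + m) (Ici 0) :=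
      (continuous_subtype_val.comp_continuousOn (hW.continuous p)).add continuousOn_const
    refine h.congr fun t _ => ?_
    rw [map_add, extendById_coe, extendById_of_mem_orthogonal _ hm]

/-- The inverses of the operators `Ṽ_t`. -/
def perturbationInv (W : ℝ → (L2plus ≃ₗᵢ[ℂ] L2plus)) (t : ℝ) : L2R →L[ℂ] L2R :=
  shiftR (-t) ∘L extendById (W t).symm

theorem perturbationR_perturbationInv (t : ℝ) (f : L2R) :
    perturbationR W t (perturbationInv W t f) = f := by
  change extendById (W t) (shiftR t (shiftR (-t) (extendById (W t).symm f))) = f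
  rw [shiftR_shiftR_neg, extendById_extendById_symm]

variable {J : L2R ≃ₗᵢ[ℂ] L2 leb} {Jp : L2plus ≃ₗᵢ[ℂ] H2} (hJ : ∀ f : L2plus, J f = Jp f)
  (hJs : ∀ t f, J (shiftR t f) = cayleyGroup leb t (J f))

include hW hJs

/-- The cogenerator of `Ṽ_t` is unitary, and its inverse acts on the functions on the negative
semiaxis as the inverse of the cogenerator of the shifts: on such functions `Ṽ_t⁻¹` is a shift. -/
theorem exists_cogenerator_perturbationR : ∃ Ct Ct' : L2R →L[ℂ] L2R,
    IsCogenerator (perturbationR W) Ct ∧ (∀ f, ‖Ct f‖ = ‖f‖) ∧ (∀ f, Ct (Ct' f) = f) ∧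
    ∀ f ∈ L2plusᗮ, Ct (J.symm ((mulZEquiv leb).symm (J f))) = f := by
  have hV := isContractionSemigroup_perturbationR hW
  have hV' : IsContractionSemigroup (perturbationInv W) :=
    hV.inverse (fun t _ => norm_perturbationR t) fun t _ => perturbationR_perturbationInv t
  obtain ⟨Ct, hCt, -⟩ := hV.exists_cogenerator
  obtain ⟨Ct', hCt', hCt'r⟩ := hV'.exists_cogenerator
  have hCC' := hCt.apply_apply_of_inverse hCt' hV fun t _ => perturbationR_perturbationInv t
  have hS : IsContractionSemigroup shiftR := ⟨fun t _ f => (norm_shiftR t f).le, shiftR_zero,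
    fun t s _ _ => shiftR_add t s, fun f => (continuous_shiftR hJs f).continuousOn⟩
  have hS' : IsContractionSemigroup fun t => shiftR (-t) :=
    hS.inverse (fun t _ => norm_shiftR t) fun t _ => shiftR_shiftR_neg t
  have hR : IsCogenerator (fun t => shiftR (-t)) ((J.symm : L2 leb →L[ℂ] L2R) ∘L
      ((mulZEquiv leb).symm : L2 leb →L[ℂ] L2 leb) ∘L (J : L2R →L[ℂ] L2 leb)) := by
    refine isCogenerator_cayleyGroup_neg.transport J.symm (fun t _ f => ?_) fun f => ?_
    · rw [LinearIsometryEquiv.eq_symm_apply, hJs, LinearIsometryEquiv.apply_symm_apply]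
    · change J.symm ((mulZEquiv leb).symm (J (J.symm f))) = _
      rw [LinearIsometryEquiv.apply_symm_apply]
      rfl
  refine ⟨Ct, Ct', hCt, hCt.norm_map fun t _ => norm_perturbationR t, hCC', fun f hf => ?_⟩
  have h1 : J.symm ((mulZEquiv leb).symm (J f)) = Ct' f := by
    have h2 := hR.apply_eq_sub_resolventAtOne hS' f
    rw [hCt'r f]
    refine h2.trans ?_
    congr 2
    unfold resolventAtOne
    refine setIntegral_congr_fun measurableSet_Ioi fun t _ => ?_
    change _ • shiftR (-t) f = _ • shiftR (-t) (extendById (W t).symm f)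
    rw [extendById_of_mem_orthogonal _ hf]
  rw [h1, hCC']

include hJ

/-- The vector `Ct z̄`, where `z̄` is transferred to the line, spans the defect space of the
cogenerator `C` of the perturbed semigroup in `L²(ℝ₊)`. -/
theorem exists_isDefectVector {C : L2plus →L[ℂ] L2plus} (hC : IsCogenerator (perturbation W) C) :
    ∃ (Ct : L2R →L[ℂ] L2R) (e : L2plus), IsCogenerator (perturbationR W) Ct ∧
      (∀ f : L2plus, Ct f = C f) ∧ Ct (J.symm (zmon (-1))) = e ∧
      (∀ f ∈ L2plusᗮ, Ct (J.symm ((mulZEquiv leb).symm (J f))) = f) ∧ IsDefectVector C e := by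
  obtain ⟨Ct, Ct', hCt, hn, hCC', hm⟩ := exists_cogenerator_perturbationR hW hJs
  -- The generator of `Ṽ_t` extends that of `V_t`.
  have hCtC : ∀ f : L2plus, Ct f = C f := fun f => by
    obtain ⟨f₀, Af, h1, h2, h3⟩ := hC f
    have h4 : Tendsto (fun t : ℝ => (Complex.I * (t : ℂ))⁻¹ •
        (perturbationR W t (f₀ : L2R) - (f₀ : L2R))) (𝓝[>] 0) (𝓝 (Af : L2R)) := by
      refine ((continuous_subtype_val.tendsto _).comp h1).congr' ?_
      filter_upwards [self_mem_nhdsWithin] with t ht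
      rw [← coe_perturbation W (le_of_lt ht)]
      rfl
    have h5 := hCt.apply_eq (fun t _ f => (norm_perturbationR t f).le) h4
    rw [h3, h2]
    exact h5
  have hinner := inner_map_of_norm_map hn
  have hem : J.symm (zmon (-1)) ∈ L2plusᗮ := lineToCircle_symm_mem_orthogonal hJ zmon_neg_one_mem
  have he : Ct (J.symm (zmon (-1))) ∈ L2plus := by
    rw [← L2plus.orthogonal_orthogonal, Submodule.mem_orthogonal]
    intro u hu
    rw [← hm u hu, hinner, LinearIsometryEquiv.inner_map_map, ← inner_conj_symm,
      inner_zmon_mulZEquiv_symm, neg_add_cancel,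
      mem_H2_orthogonal.1 (lineToCircle_mem_H2_orthogonal hJ hu) 0 le_rfl, map_zero]
  refine ⟨Ct, ⟨_, he⟩, hCt, hCtC, rfl, hm, ?_, fun x => ⟨fun hx => ?_, ?_⟩⟩
  · exact ((hn _).trans (J.symm.norm_map _)).trans (norm_zmon (-1))
  · -- A vector of the negative semiaxis is a combination of `z̄` and of a vector that `Ct` maps back
    -- to the negative semiaxis, so that `Ct⁻¹ x` is orthogonal to both.
    have hy : Ct' x ∈ L2plus := by
      refine L2plus.orthogonal_orthogonal.le ((Submodule.mem_orthogonal _ _).2 ?_)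
      intro u hu
      obtain ⟨h, hh, e⟩ := exists_eq_of_mem_H2_orthogonal (lineToCircle_mem_H2_orthogonal hJ hu)
      have hu' : u = inner ℂ (zmon (-1)) (J u) • J.symm (zmon (-1))
          + J.symm ((mulZEquiv leb).symm (J (J.symm h))) := by
        apply J.injective
        rw [map_add, map_smul]
        simp only [LinearIsometryEquiv.apply_symm_apply]
        exact e
      have hJh := lineToCircle_symm_mem_orthogonal hJ hh
      rw [← hinner, hCC', hu', map_add, map_smul, hm _ hJh, inner_add_left, inner_smul_left]
      have h1 : inner ℂ (Ct (J.symm (zmon (-1)))) (x : L2R) = 0 := hx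
      rw [h1, (Submodule.mem_orthogonal' _ _).1 hJh x x.2, mul_zero, add_zero]
    refine ⟨⟨_, hy⟩, Subtype.ext ?_⟩
    rw [← hCtC]
    exact hCC' _
  · rintro ⟨y, rfl⟩
    change inner ℂ (Ct (J.symm (zmon (-1)))) ((C y : L2plus) : L2R) = 0
    rw [← hCtC, hinner]
    exact (Submodule.mem_orthogonal' _ _).1 hem y y.2

end Converse

/-- A unitary operator `L²(ℝ₊) → H²` and a unimodular constant on the complement define a unitary
operator `L²(ℝ) → L²(𝕋)`. -/
theorem exists_extension {J : L2R ≃ₗᵢ[ℂ] L2 leb} {Jp : L2plus ≃ₗᵢ[ℂ] H2}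
    (hJ : ∀ f : L2plus, J f = Jp f) (Jq : L2plus ≃ₗᵢ[ℂ] H2) {c : ℂ} (hc : ‖c‖ = 1) :
    ∃ J' : L2R ≃ₗᵢ[ℂ] L2 leb, (∀ f : L2plus, J' f = Jq f) ∧ ∀ f ∈ L2plusᗮ, J' f = c • J f := by
  have hcc : (starRingEnd ℂ) c * c = 1 := by
    rw [mul_comm, Complex.mul_conj, Complex.normSq_eq_norm_sq, hc]; norm_num
  have hcc' : c * (starRingEnd ℂ) c = 1 := by rw [mul_comm, hcc]
  have h1 : ∀ (p q : L2plus) (m n : L2R), m ∈ L2plusᗮ → n ∈ L2plusᗮ →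
      inner ℂ ((p : L2R) + m) ((q : L2R) + n)
        = inner ℂ ((Jq p : L2 leb) + c • J m) ((Jq q : L2 leb) + c • J n) := by
    intro p q m n hm hn
    have e1 : inner ℂ (Jq p : L2 leb) (Jq q : L2 leb) = inner ℂ (p : L2R) (q : L2R) :=
      Jq.inner_map_map p q
    rw [inner_add_left, inner_add_right, inner_add_right, inner_add_left, inner_add_right,
      inner_add_right, e1, inner_smul_right, inner_smul_left, inner_smul_left, inner_smul_right,
      inner_eq_zero_of_mem_H2 (Jq p).2 (lineToCircle_mem_H2_orthogonal hJ hn),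
      (Submodule.mem_orthogonal' _ _).1 (lineToCircle_mem_H2_orthogonal hJ hm) _ (Jq q).2,
      (Submodule.mem_orthogonal _ _).1 hn p p.2, (Submodule.mem_orthogonal' _ _).1 hm q q.2,
      LinearIsometryEquiv.inner_map_map, ← mul_assoc, hcc]
    ring
  obtain ⟨J', hJ'⟩ := exists_equiv_of_gram
    (x := fun i : L2plus × (L2plusᗮ : Submodule ℂ L2R) => (i.1 : L2R) + (i.2 : L2R))
    (y := fun i => (Jq i.1 : L2 leb) + c • J (i.2 : L2R))
    (fun i j => h1 i.1 j.1 i.2 j.2 i.2.2 j.2.2)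
    (fun f hf => by
      obtain ⟨p, m, hm, rfl⟩ := exists_eq_add_L2plus f
      exact inner_self_eq_zero.1 (hf (p, ⟨m, hm⟩)))
    (fun f hf => by
      obtain ⟨p, hp, m, hm, e⟩ := H2.exists_add_mem_mem_orthogonal f
      have h2 := hf (Jq.symm ⟨p, hp⟩, ⟨(starRingEnd ℂ) c • J.symm m,
        Submodule.smul_mem _ _ (lineToCircle_symm_mem_orthogonal hJ hm)⟩)
      simp only [map_smul, LinearIsometryEquiv.apply_symm_apply, smul_smul, hcc', one_smul] at h2
      rw [← e] at h2
      exact inner_self_eq_zero.1 h2)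
  refine ⟨J', fun f => ?_, fun f hf => ?_⟩
  · have h := hJ' (f, 0)
    simpa using h
  · have h := hJ' (0, ⟨f, hf⟩)
    simpa using h

/-- A cocyclic perturbation whose cogenerator has unitary part unitarily equivalent to
multiplication by `z` in `L²(μ)` is described by the model operators: both cogenerators have
one-dimensional defect, and the equivalence of Wold decompositions is chosen to carry the vector
`Ct z̄` to `θ`. It is extended to the negative semiaxis by `c J`, because `Ṽ z̄ = c̄ θ`. -/
theorem exists_equiv_modelV {μ : Measure UnitAddCircle} [IsFiniteMeasure μ] (hμ : μ ⟂ₘ leb)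
    {W : ℝ → (L2plus ≃ₗᵢ[ℂ] L2plus)} (hW : IsCocycle W) {C : L2plus →L[ℂ] L2plus}
    (hC : IsCogenerator (perturbation W) C) {K : Submodule ℂ L2plus}
    (hK : IsWoldDecomposition C K) (hm : IsMulZOn C K μ) :
    ∃ Jq : L2plus ≃ₗᵢ[ℂ] H2, (∀ f, Jq (C f) = modelV μ (Jq f)) ∧
      ∀ c : ℂ, ‖c‖ = 1 → ∃ (Ct : L2R →L[ℂ] L2R) (J' : L2R ≃ₗᵢ[ℂ] L2 leb),
        IsCogenerator (perturbationR W) Ct ∧ (∀ f : L2plus, J' f = Jq f) ∧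
        ∀ f, J' (Ct f) = modelVtilde μ c (J' f) := by
  obtain ⟨J, Jp, hJ, hJs⟩ := exists_lineToCircle
  obtain ⟨Ct, e, hCt, hCtC, hCte, hCtm, he⟩ := exists_isDefectVector hW hJ hJs hC
  obtain ⟨Jq, hJq, hJqe⟩ := exists_equiv_of_wold hK (isWoldDecomposition_modelV hμ) he
    (isDefectVector_modelV hμ) hm (isMulZOn_modelV hμ)
  refine ⟨Jq, hJq, fun c hc => ?_⟩
  have hcc : c * (starRingEnd ℂ) c = 1 := by
    rw [Complex.mul_conj, Complex.normSq_eq_norm_sq, hc]; norm_num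
  obtain ⟨J', hJ'p, hJ'm⟩ := exists_extension hJ Jq hc
  refine ⟨Ct, J', hCt, hJ'p, fun f => ?_⟩
  obtain ⟨p, m, hm, rfl⟩ := exists_eq_add_L2plus f
  obtain ⟨h, hh, eq⟩ := exists_eq_of_mem_H2_orthogonal (lineToCircle_mem_H2_orthogonal hJ hm)
  set α := inner ℂ (zmon (-1)) (J m)
  have hm' : m = α • J.symm (zmon (-1)) + J.symm ((mulZEquiv leb).symm (J (J.symm h))) := by
    apply J.injective
    rw [map_add, map_smul]
    simp only [LinearIsometryEquiv.apply_symm_apply]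
    exact eq
  have hJh := lineToCircle_symm_mem_orthogonal hJ hh
  have h1 : Ct m = α • (e : L2R) + J.symm h := by
    rw [hm', map_add, map_smul, hCte, hCtm _ hJh]
  have h2 : (Jq e : L2 leb) = bdry (clarkFn μ) := by rw [hJqe]
  rw [map_add, map_add, map_add, map_add, hCtC, hJ'p, hJ'p, hJq, modelVtilde_of_mem_H2, h1,
    map_add, map_smul, hJ'p, h2, hJ'm _ hJh, hJ'm m hm, LinearIsometryEquiv.apply_symm_apply,
    map_smul, eq, map_add, map_smul, modelVtilde_zmon_neg_one, modelVtilde_mulZEquiv_symm hh,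
    smul_add, smul_smul, smul_smul, mul_right_comm, hcc, one_mul]

/-! ### The boundary value of `θ` at `1` -/

section BoundaryValue

variable {μ : Measure UnitAddCircle} [IsFiniteMeasure μ] {q : ℝ}

theorem measurable_enorm_one_sub_pt : Measurable fun x : UnitAddCircle => ‖1 - pt x‖ₑ :=
  (continuous_const.sub continuous_pt).measurable.enorm

theorem ae_ne_zero_of_lintegral_lt_top (hq : 0 < q) (h : ∫⁻ x, ‖1 - pt x‖ₑ ^ (-q) ∂μ < ⊤) :
    ∀ᵐ x ∂μ, x ≠ 0 := by
  filter_upwards [ae_lt_top (measurable_enorm_one_sub_pt.pow_const _) h.ne] with x hx h0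
  rw [pt_eq_one_iff.2 h0, sub_self, enorm_zero, ENNReal.zero_rpow_of_neg (by linarith)] at hx
  exact lt_irrefl _ hx

/-- Pointwise, `1 / |1 - ξ|` is at most `1 + |1 - ξ|^{-q}`. -/
theorem integrable_inv_one_sub_pt (hq : 1 ≤ q) (h : ∫⁻ x, ‖1 - pt x‖ₑ ^ (-q) ∂μ < ⊤) :
    Integrable (fun x => (pt x - 1)⁻¹) μ := by
  refine ⟨(continuous_pt.sub continuous_const).measurable.inv.aestronglyMeasurable, ?_⟩
  refine lt_of_le_of_lt (lintegral_mono (g := fun x => 1 + ‖1 - pt x‖ₑ ^ (-q)) fun x => ?_) ?_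
  · by_cases hx : pt x - 1 = 0
    · simp [hx]
    · have e : ‖(pt x - 1)⁻¹‖ₑ = ‖1 - pt x‖ₑ ^ (-1 : ℝ) := by
        rw [enorm_inv hx, ENNReal.rpow_neg_one, ← enorm_neg, neg_sub]
      change ‖(pt x - 1)⁻¹‖ₑ ≤ _
      rw [e]
      rcases le_total ‖1 - pt x‖ₑ 1 with h1 | h1
      · exact (ENNReal.rpow_le_rpow_of_exponent_ge h1 (by linarith)).trans le_add_self
      · refine le_trans ?_ le_self_add
        rw [ENNReal.rpow_neg_one]
        exact ENNReal.inv_le_one.2 h1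
  · rw [lintegral_add_left measurable_const, lintegral_const, one_mul]
    exact ENNReal.add_lt_top.2 ⟨measure_lt_top μ _, h⟩

theorem norm_pt_sub_one_le {r : ℝ} (h0 : 0 ≤ r) (h1 : r < 1) (x : UnitAddCircle) :
    ‖pt x - 1‖ ≤ 2 * ‖pt x - r‖ := by
  have e1 : ‖(r : ℂ) - 1‖ = 1 - r := by
    rw [← Complex.ofReal_one, ← Complex.ofReal_sub, Complex.norm_real, Real.norm_eq_abs,
      abs_sub_comm, abs_of_nonneg (by linarith)]
  have e2 := one_sub_norm_le x (r : ℂ)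
  rw [Complex.norm_real, Real.norm_eq_abs, abs_of_nonneg h0] at e2
  have e3 := norm_add_le (pt x - r) ((r : ℂ) - 1)
  rw [sub_add_sub_cancel, e1] at e3
  linarith

/-- By dominated convergence the Herglotz integral has a radial limit at `1`, when `1 / |1 - ξ|` is
integrable: `|ξ - 1| ≤ 2 |ξ - r|`. -/
theorem tendsto_herglotz (h0 : ∀ᵐ x ∂μ, x ≠ 0) (hi : Integrable (fun x => (pt x - 1)⁻¹) μ) :
    Tendsto (fun r : ℝ => herglotz μ (r : ℂ)) (𝓝[<] 1) (𝓝 (∫ x, cayley x ∂μ)) := by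
  have hr : ∀ᶠ r : ℝ in 𝓝[<] 1, 0 ≤ r ∧ r < 1 := by
    filter_upwards [Ioo_mem_nhdsLT (zero_lt_one' ℝ)] with r hr using ⟨hr.1.le, hr.2⟩
  refine tendsto_integral_filter_of_dominated_convergence
    (fun x => 4 * ‖(pt x - 1)⁻¹‖) ?_ ?_ (hi.norm.const_mul 4) ?_
  · exact Eventually.of_forall fun r => ((continuous_pt.add continuous_const).measurable.div
      (continuous_pt.sub continuous_const).measurable).aestronglyMeasurable
  · filter_upwards [hr] with r hr
    filter_upwards [h0] with x hx
    have hx' : 0 < ‖pt x - 1‖ := norm_pos_iff.2 (sub_ne_zero.2 fun h => hx (pt_eq_one_iff.1 h))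
    have h1 := norm_pt_sub_one_le hr.1 hr.2 x
    have h2 : ‖pt x + r‖ ≤ 2 := by
      refine (norm_add_le _ _).trans ?_
      rw [norm_pt, Complex.norm_real, Real.norm_eq_abs, abs_of_nonneg hr.1]
      linarith [hr.2]
    have h3 : 0 < ‖pt x - r‖ := by linarith
    rw [norm_div, norm_inv, ← div_eq_mul_inv, div_le_div_iff₀ h3 hx']
    nlinarith
  · filter_upwards [h0] with x hx
    have hx' : pt x - ((1 : ℝ) : ℂ) ≠ 0 := by
      rw [Complex.ofReal_one]
      exact sub_ne_zero.2 fun h => hx (pt_eq_one_iff.1 h)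
    have hc : ContinuousAt (fun r : ℝ => (pt x + (r : ℂ)) / (pt x - (r : ℂ))) 1 := by
      fun_prop (disch := assumption)
    have h2 := hc.tendsto.mono_left (nhdsWithin_le_nhds (s := Iio 1))
    simp only [Complex.ofReal_one] at h2
    exact h2

/-- The limit of the Herglotz integral is the imaginary number `∫ (ξ + 1) / (ξ - 1) dμ`, whence
`θ(1) = (F - 1) / (F + 1)` is unimodular. -/
theorem exists_unimodularValueAtOne (h0 : ∀ᵐ x ∂μ, x ≠ 0)
    (hi : Integrable (fun x => (pt x - 1)⁻¹) μ) :
    ∃ c : ℂ, IsUnimodularValueAtOne (clarkFn μ) c := by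
  have hF := tendsto_herglotz h0 hi
  set b : ℝ := ∫ x, (cayley x).im ∂μ with hb
  have e : ∫ x, cayley x ∂μ = Complex.I * b := by
    rw [hb, ← integral_complex_ofReal, ← integral_const_mul]
    exact integral_congr_ae (Eventually.of_forall cayley_eq)
  rw [e] at hF
  have hne : Complex.I * b + 1 ≠ 0 := fun h => by
    have := congrArg Complex.re h
    simp at this
  refine ⟨(Complex.I * b - 1) / (Complex.I * b + 1), ?_, ?_⟩
  · have e2 : Complex.I * b - 1 = -(starRingEnd ℂ) (Complex.I * b + 1) := by
      rw [map_add, map_mul, Complex.conj_I, Complex.conj_ofReal, map_one]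
      ring
    rw [norm_div, e2, norm_neg, RCLike.norm_conj, div_self (norm_ne_zero_iff.2 hne)]
  · exact (hF.sub_const 1).div (hF.add_const 1) hne

end BoundaryValue

/-! ### Equivalent measures -/

section EquivalentMeasure

variable {α : Type*} [MeasurableSpace α] {μ : Measure α} {w : α → ℂ}

theorem absolutelyContinuous_withDensity_enorm_sq (hw : Measurable w) (h0 : ∀ᵐ x ∂μ, w x ≠ 0) :
    μ ≪ μ.withDensity fun x => ‖w x‖ₑ ^ 2 := by
  refine withDensity_absolutelyContinuous' (hw.enorm.pow_const 2).aemeasurable ?_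
  filter_upwards [h0] with x hx
  simpa using hx

theorem eLpNorm_withDensity_enorm_sq (hw : Measurable w) {f : α → ℂ}
    (hf : AEStronglyMeasurable f (μ.withDensity fun x => ‖w x‖ₑ ^ 2)) :
    eLpNorm f 2 (μ.withDensity fun x => ‖w x‖ₑ ^ 2) = eLpNorm (fun x => w x * f x) 2 μ := by
  have h2 : (2 : ENNReal) ≠ 0 := by norm_num
  rw [eLpNorm_eq_lintegral_rpow_enorm_toReal h2 (by norm_num),
    eLpNorm_eq_lintegral_rpow_enorm_toReal h2 (by norm_num)]
  congr 1
  rw [lintegral_withDensity_eq_lintegral_mul₀' (hw.enorm.pow_const 2).aemeasurable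
    (hf.enorm.pow_const _)]
  refine lintegral_congr fun x => ?_
  simp [enorm_mul, mul_pow]

/-- Multiplication by `w` is a unitary operator from `L²(|w|² μ)` to `L²(μ)`. -/
theorem exists_equiv_withDensity (hw : Measurable w) (h0 : ∀ᵐ x ∂μ, w x ≠ 0) :
    ∃ Φ : Lp ℂ 2 (μ.withDensity fun x => ‖w x‖ₑ ^ 2) ≃ₗᵢ[ℂ] Lp ℂ 2 μ,
      ∀ f, ⇑(Φ f) =ᵐ[μ] fun x => w x * f x := by
  set ν := μ.withDensity fun x => ‖w x‖ₑ ^ 2 with hν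
  have hac : μ ≪ ν := absolutelyContinuous_withDensity_enorm_sq hw h0
  have hmem : ∀ f : Lp ℂ 2 ν, MemLp (fun x => w x * f x) 2 μ := fun f =>
    ⟨hw.aestronglyMeasurable.mul ((Lp.aestronglyMeasurable f).mono_ac hac), by
      rw [← eLpNorm_withDensity_enorm_sq hw (Lp.aestronglyMeasurable f)]
      exact (Lp.memLp f).2⟩
  have hco : ∀ f : Lp ℂ 2 ν, ⇑((hmem f).toLp _) =ᵐ[μ] fun x => w x * f x := fun f =>
    (hmem f).coeFn_toLp
  let Φ₀ : Lp ℂ 2 ν →ₗᵢ[ℂ] Lp ℂ 2 μ :=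
    { toFun := fun f => (hmem f).toLp _
      map_add' := fun f g => by
        apply Lp.ext
        filter_upwards [hco (f + g), hco f, hco g, hac.ae_le (Lp.coeFn_add f g),
          Lp.coeFn_add ((hmem f).toLp _) ((hmem g).toLp _)] with x h1 h2 h3 h4 h5
        rw [h1, h5, Pi.add_apply, h2, h3, h4, Pi.add_apply, mul_add]
      map_smul' := fun c f => by
        apply Lp.ext
        filter_upwards [hco (c • f), hco f, hac.ae_le (Lp.coeFn_smul c f),
          Lp.coeFn_smul c ((hmem f).toLp _)] with x h1 h2 h3 h4
        rw [h1, RingHom.id_apply, h4, Pi.smul_apply, h2, h3, Pi.smul_apply, smul_eq_mul,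
          smul_eq_mul, mul_left_comm]
      norm_map' := fun f => by
        change ‖(hmem f).toLp _‖ = _
        rw [Lp.norm_toLp, ← eLpNorm_withDensity_enorm_sq hw (Lp.aestronglyMeasurable f),
          Lp.norm_def] }
  refine ⟨LinearIsometryEquiv.ofSurjective Φ₀ fun g => ?_, hco⟩
  have hgm : AEStronglyMeasurable (fun x => (w x)⁻¹ * g x) ν :=
    (hw.inv.aestronglyMeasurable.mul (Lp.aestronglyMeasurable g)).mono_ac
      (withDensity_absolutelyContinuous _ _)
  have hae : (fun x => w x * ((w x)⁻¹ * g x)) =ᵐ[μ] g := by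
    filter_upwards [h0] with x hx
    rw [mul_inv_cancel_left₀ hx]
  have hg : MemLp (fun x => (w x)⁻¹ * g x) 2 ν := ⟨hgm, by
    rw [eLpNorm_withDensity_enorm_sq hw hgm, eLpNorm_congr_ae hae]
    exact (Lp.memLp g).2⟩
  refine ⟨hg.toLp _, ?_⟩
  apply Lp.ext
  filter_upwards [hco (hg.toLp _), hac.ae_le hg.coeFn_toLp, hae] with x h1 h2 h3
  change ((hmem (hg.toLp _)).toLp _ : Lp ℂ 2 μ) x = _
  rw [h1, h2, h3]

end EquivalentMeasure

/-- The measure `|1 - ξ|^q μ` is equivalent to `μ`, with `|1 - ξ|^{-q}` integrable. -/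
theorem exists_equivalent_measure {μ : Measure UnitAddCircle} [IsFiniteMeasure μ]
    (h0 : μ {0} = 0) {q : ℝ} (hq : 0 < q) :
    ∃ ν : Measure UnitAddCircle, IsFiniteMeasure ν ∧ ν ≪ μ ∧ μ ≪ ν ∧
      ∫⁻ x, ‖1 - pt x‖ₑ ^ (-q) ∂ν < ⊤ ∧
      ∃ Φ : L2 ν ≃ₗᵢ[ℂ] L2 μ, ∀ f, Φ (mulZ ν f) = mulZ μ (Φ f) := by
  set w : UnitAddCircle → ℂ := fun x => ((‖1 - pt x‖ ^ (q / 2) : ℝ) : ℂ) with hw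
  have hwm : Measurable w := by
    refine Complex.measurable_ofReal.comp (Measurable.pow_const ?_ _)
    exact (continuous_const.sub continuous_pt).norm.measurable
  have hwe : ∀ x, ‖w x‖ₑ ^ 2 = ‖1 - pt x‖ₑ ^ q := fun x => by
    have h1 : ‖w x‖ₑ = ‖1 - pt x‖ₑ ^ (q / 2) := by
      rw [← ofReal_norm, hw, Complex.norm_real, Real.norm_eq_abs,
        abs_of_nonneg (Real.rpow_nonneg (norm_nonneg _) _),
        ← ENNReal.ofReal_rpow_of_nonneg (norm_nonneg _) (by linarith), ofReal_norm]
    rw [h1, ← ENNReal.rpow_natCast, ← ENNReal.rpow_mul]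
    congr 1
    push_cast
    ring
  have hw0 : ∀ᵐ x ∂μ, w x ≠ 0 := by
    have h1 : ∀ᵐ x ∂μ, x ≠ 0 := by
      rw [ae_iff]
      simpa using! h0
    filter_upwards [h1] with x hx
    have h2 : 0 < ‖1 - pt x‖ :=
      norm_pos_iff.2 (sub_ne_zero.2 fun h => hx (pt_eq_one_iff.1 h.symm))
    rw [hw]
    exact Complex.ofReal_ne_zero.2 (Real.rpow_pos_of_pos h2 _).ne'
  have hac := absolutelyContinuous_withDensity_enorm_sq hwm hw0
  obtain ⟨Φ, hΦ⟩ := exists_equiv_withDensity hwm hw0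
  refine ⟨_, ?_, withDensity_absolutelyContinuous _ _, hac, ?_, Φ, fun f => ?_⟩
  · refine isFiniteMeasure_withDensity (ne_of_lt ?_)
    refine lt_of_le_of_lt (lintegral_mono (g := fun _ => (2 : ENNReal) ^ q) fun x => ?_) ?_
    · rw [hwe]
      refine ENNReal.rpow_le_rpow ?_ hq.le
      refine (enorm_sub_le).trans ?_
      rw [← ofReal_norm, ← ofReal_norm, norm_pt, norm_one, ENNReal.ofReal_one]
      norm_num
    · rw [lintegral_const]
      exact ENNReal.mul_lt_top (ENNReal.rpow_lt_top_of_nonneg hq.le (by norm_num))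
        (measure_lt_top μ _)
  · rw [lintegral_withDensity_eq_lintegral_mul _ (hwm.enorm.pow_const 2)
      (measurable_enorm_one_sub_pt.pow_const _)]
    refine lt_of_le_of_lt (lintegral_mono (g := fun _ => (1 : ENNReal)) fun x => ?_) ?_
    · rw [Pi.mul_apply, hwe, ENNReal.rpow_neg]
      exact ENNReal.mul_inv_le_one _
    · rw [lintegral_const, one_mul]
      exact measure_lt_top μ _
  · apply Lp.ext
    filter_upwards [hΦ (mulZ _ f), hΦ f, hac.ae_le (coeFn_mulZ _ f), coeFn_mulZ μ (Φ f)]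
      with x h1 h2 h3 h4
    rw [h1, h3, h4, h2, mul_left_comm]

end CocyclicModel

end

theorem proposition7 (μ : Measure UnitAddCircle) [IsFiniteMeasure μ]
    (hμ : μ ⟂ₘ leb) :
    -- `θ` is an inner function given by Clark's formula
    (IsInner (clarkFn μ) ∧
      ∀ z ∈ Metric.ball (0 : ℂ) 1, clarkFn μ z ≠ 1 ∧
        (1 + clarkFn μ z) / (1 - clarkFn μ z) =
          ∫ x, (pt x + z) / (pt x - z) ∂μ) ∧
    -- the Wold decomposition of `V` is `K_θ ⊕ θ H²`, with unitary part multiplication by `z` in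
    -- `L²(μ)` and completely nonunitary part the restriction of the shift
    (IsWoldDecomposition (modelV μ)
        (modelSpace (clarkFn μ)) ∧
      (modelSpace (clarkFn μ))ᗮ =
        innerH2 (clarkFn μ) ∧
      IsMulZOn (modelV μ)
        (modelSpace (clarkFn μ)) μ ∧
      ∀ f ∈ innerH2 (clarkFn μ),
        (modelV μ f : L2 leb) =
          mulZ leb f) ∧
    -- `Ṽ` is the unitary dilation of `V`, it extends `V`, and `Ṽ* f = z̄ f` on `L² ⊖ H²`
    (∀ c : ℂ, IsUnimodularValueAtOne (clarkFn μ) c →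
      IsUnitaryDilation H2 (modelV μ)
        (modelVtilde μ c) ∧
      (∀ f : H2, modelVtilde μ c f = modelV μ f) ∧
      ∀ f ∈ H2ᗮ,
        ⇑(ContinuousLinearMap.adjoint (modelVtilde μ c) f)
          =ᵐ[leb] fun x => (starRingEnd ℂ) (pt x) * f x) ∧
    -- if `1` is not an eigenvalue, then, in a model of the shifts, `V` and `Ṽ` are the
    -- cogenerators belonging to a cocycle
    (μ {0} = 0 →
      ∃ (J : L2R ≃ₗᵢ[ℂ] L2 leb)
        (Jp : L2plus ≃ₗᵢ[ℂ] H2),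
        (∀ f : L2plus, J f = Jp f) ∧
        (∃ S : L2R →L[ℂ] L2R,
          IsCogenerator shiftR S ∧
          ∀ f, J (S f) = mulZ leb (J f)) ∧
        ∃ W : ℝ → (L2plus ≃ₗᵢ[ℂ] L2plus),
          IsCocycle W ∧
          (∃ C : L2plus →L[ℂ] L2plus,
            IsCogenerator (perturbation W) C ∧
            ∀ f, Jp (C f) = modelV μ (Jp f)) ∧
          ∀ c : ℂ, IsUnimodularValueAtOne (clarkFn μ) c →
            ∃ Ct : L2R →L[ℂ] L2R,
              IsCogenerator (perturbationR W) Ct ∧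
              ∀ f, J (Ct f) = modelVtilde μ c (J f)) ∧
    -- conversely, every cocyclic perturbation whose cogenerator has unitary part multiplication
    -- by `z` in `L²(μ)` is described by `V` and `Ṽ` up to unitary equivalence
    (∀ W : ℝ → (L2plus ≃ₗᵢ[ℂ] L2plus), IsCocycle W →
      ∀ C : L2plus →L[ℂ] L2plus,
        IsCogenerator (perturbation W) C →
      ∀ K₀ : Submodule ℂ L2plus, IsWoldDecomposition C K₀ →
        IsMulZOn C K₀ μ →
      μ {0} = 0 ∧
      ∃ Jp : L2plus ≃ₗᵢ[ℂ] H2,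
        (∀ f, Jp (C f) = modelV μ (Jp f)) ∧
        ∀ c : ℂ, IsUnimodularValueAtOne (clarkFn μ) c →
          ∃ (Ct : L2R →L[ℂ] L2R)
            (J : L2R ≃ₗᵢ[ℂ] L2 leb),
            IsCogenerator (perturbationR W) Ct ∧
            (∀ f : L2plus, J f = Jp f) ∧
            ∀ f, J (Ct f) = modelVtilde μ c (J f)) ∧
    -- the value `θ(1)` exists and is unimodular under the integrability condition at `1`
    (∀ q : ℝ, 3 < q → ∫⁻ x, ‖1 - pt x‖ₑ ^ (-q) ∂μ < ⊤ →
      ∃ c : ℂ, IsUnimodularValueAtOne (clarkFn μ) c) ∧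
    -- and that condition can be achieved by passing to an equivalent measure
    (μ {0} = 0 → ∀ q : ℝ, 3 < q →
      ∃ ν : Measure UnitAddCircle, IsFiniteMeasure ν ∧
        ν.AbsolutelyContinuous μ ∧ μ.AbsolutelyContinuous ν ∧
        ∫⁻ x, ‖1 - pt x‖ₑ ^ (-q) ∂ν < ⊤ ∧
        ∃ Φ : L2 ν ≃ₗᵢ[ℂ] L2 μ,
          ∀ f, Φ (mulZ ν f) = mulZ μ (Φ f)) := by
  refine ⟨⟨isInner_clarkFn μ hμ, fun z hz => ⟨fun h => one_sub_clarkFn_ne_zero μ hz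
      (sub_eq_zero.2 h.symm), clark_formula μ hz⟩⟩,
    ⟨isWoldDecomposition_modelV hμ, modelSpace_orthogonal hμ, isMulZOn_modelV hμ,
      fun f hf => modelV_of_mem_innerH2 hμ hf⟩,
    fun c hc => ⟨isUnitaryDilation_modelVtilde hμ hc.1, modelVtilde_of_mem_H2, fun f hf => ?_⟩,
    fun h0 => ?_, fun W hW C hC K hK hm => ?_, fun q hq h => ?_, fun h0 q hq => ?_⟩
  · rw [adjoint_modelVtilde_of_mem hμ hc.1 hf]
    exact coeFn_mulZEquiv_symm f
  · obtain ⟨J, Jp, hJ, hJs⟩ := exists_lineToCircle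
    obtain ⟨c, hc, hcu⟩ := exists_unimodular_eq (clarkFn μ)
    obtain ⟨W, hW, hC, Ct, hCt, hJCt⟩ := exists_cocycle hJ hJs hμ h0 hc
    refine ⟨J, Jp, hJ, exists_cogenerator_shiftR hJs, W, hW, hC, fun c' hc' => ⟨Ct, hCt, ?_⟩⟩
    rwa [hcu c' hc']
  · obtain ⟨Jq, hJq, hJt⟩ := exists_equiv_modelV hμ hW hC hK hm
    exact ⟨measure_singleton_zero_of_isMulZOn hC hm, Jq, hJq, fun c hc => hJt c hc.1⟩
  · exact exists_unimodularValueAtOne (ae_ne_zero_of_lintegral_lt_top (by linarith) h)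
      (integrable_inv_one_sub_pt (by linarith) h)
  · exact exists_equivalent_measure h0 (by linarith)
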